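/- All graphs are simple. For a graph $G$, a list assignment $L$ gives each vertex $v$ a finite set $L(v)$ of colors; an $L$-coloring is a proper coloring $\varphi$ with $\varphi(v)\in L(v)$ for every vertex $v$. A Kempe swap interchanges two distinct colors $a,b$ on one component of the subgraph induced by the vertices colored $a$ or $b$; starting from an $L$-coloring it is $L$-valid if the result is again an $L$-coloring. Two $L$-colorings are $L$-equivalent if one can be transformed into the other by a finite sequence of $L$-valid Kempe swaps. $G$ is degree-swappable if, for every list assignment $L$ with $|L(v)|=d_G(v)$ for all $v$, every two $L$-colorings of $G$ are $L$-equivalent. A barbell is formed from two vertex-disjoint cycles by identifying one vertex of each cycle with distinct ends of a path of length at least $1$, or (a short barbell) from two disjoint cycles by identifying one vertex of the first with one vertex of the second. A $\theta$-graph consists of two distinct vertices $v,w$ and three internally disjoint $v,w$-paths (at most one of which has length $1$). A prism consists of three vertex-disjoint paths $P_i$ from $v_i$ to $w_i$ ($i=1,2,3$), each of length at least $1$, together with the edges of a triangle on $v_1,v_2,v_3$ and of a triangle on $w_1,w_2,w_3$. Lemma. A graph is degree-swappable whenever it is the line graph of either (1) a bipartite barbell (possibly short), or (2) a bipartite $\theta$-graph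 other than $K_{2,3}$, or (3) $K_{2,4}$; moreover the line graph of $K_{2,4}$ is $K_4\,\square\,K_2$. Furthermore, every prism other than $K_3\,\square\,K_2$ is degree-swappable. -/

import Mathlib

/-! ### Kempe swaps for list colourings -/

/-- `KempeSwap G φ ψ`: the proper colouring `ψ` is obtained from the proper colouring `φ` by
choosing two distinct colours `a`, `b` and interchanging them on one connected component `K` of
the subgraph of `G` induced by the vertices that `φ` colours `a` or `b`. -/
def KempeSwap {V C : Type*} (G : SimpleGraph V) (φ ψ : G.Coloring C) : Prop :=
  ∃ a b : C, a ≠ b ∧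
    ∃ K : (G.induce {v | φ v = a ∨ φ v = b}).ConnectedComponent,
      (∀ v ∈ Subtype.val '' K.supp, (φ v = a → ψ v = b) ∧ (φ v = b → ψ v = a)) ∧
      (∀ v ∉ Subtype.val '' K.supp, ψ v = φ v)

/-- The proper colouring `φ` is an `L`-colouring: every vertex gets a colour from its list. -/
def IsListColoring {V C : Type*} (G : SimpleGraph V) (L : V → Finset C)
    (φ : G.Coloring C) : Prop :=
  ∀ v, φ v ∈ L v

/-- One `L`-valid Kempe swap: a Kempe swap from an `L`-colouring to an `L`-colouring. -/
def ValidKempeSwap {V C : Type*} (G : SimpleGraph V) (L : V → Finset C)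
    (φ ψ : G.Coloring C) : Prop :=
  IsListColoring G L φ ∧ IsListColoring G L ψ ∧ KempeSwap G φ ψ

/-- `φ` can be transformed to `ψ` by a finite (possibly empty) sequence of `L`-valid Kempe
swaps. -/
def ListEquivalent {V C : Type*} (G : SimpleGraph V) (L : V → Finset C)
    (φ ψ : G.Coloring C) : Prop :=
  Relation.ReflTransGen (ValidKempeSwap G L) φ ψ

/-- `G` is `L`-swappable: every two `L`-colourings of `G` are `L`-equivalent. -/
def ListSwappable {V C : Type*} (G : SimpleGraph V) (L : V → Finset C) : Prop :=
  ∀ φ ψ : G.Coloring C, IsListColoring G L φ → IsListColoring G L ψ → ListEquivalent G L φ ψ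

/-- `L` is a degree assignment: `|L(v)| = d(v)` for every vertex `v`. -/
def IsDegreeAssignment {V C : Type*} (G : SimpleGraph V) (L : V → Finset C) : Prop :=
  ∀ v, (L v : Set C).encard = (G.neighborSet v).encard

/-- `G` is degree-swappable: `G` is `L`-swappable for every degree assignment `L`, with lists
of colours taken from an arbitrary type. -/
def DegreeSwappable.{u, w} {V : Type u} (G : SimpleGraph V) : Prop :=
  ∀ (C : Type w) (L : V → Finset C), IsDegreeAssignment G L → ListSwappable G L

/-! ### Barbells, theta-graphs and prisms -/

/-- `G` is a barbell, possibly short: it is the union of a cycle `c₁` through `x`, a cycle `c₂`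
through `y`, and a path `p` from `x` to `y`, where `p` meets `c₁` only in `x` and `c₂` only in
`y`, and where the cycles are vertex-disjoint, except that they share exactly the vertex `x = y`
when `p` has length 0 (the short case). -/
def IsBarbell {V : Type*} (G : SimpleGraph V) : Prop :=
  ∃ (x y : V) (c₁ : G.Walk x x) (p : G.Walk x y) (c₂ : G.Walk y y),
    c₁.IsCycle ∧ p.IsPath ∧ c₂.IsCycle ∧
    (∀ z ∈ c₁.support, z ∈ p.support → z = x) ∧
    (∀ z ∈ c₂.support, z ∈ p.support → z = y) ∧
    (∀ z ∈ c₁.support, z ∈ c₂.support → z = x ∧ z = y) ∧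
    (∀ z : V, z ∈ c₁.support ∨ z ∈ p.support ∨ z ∈ c₂.support) ∧
    (∀ e ∈ G.edgeSet, e ∈ c₁.edges ∨ e ∈ p.edges ∨ e ∈ c₂.edges)

/-- `G` is a theta-graph: it is the union of three different, pairwise internally disjoint paths
between two distinct vertices `x` and `y`. (At most one of the paths has length 1, since `G` is
simple.) -/
def IsThetaGraph {V : Type*} (G : SimpleGraph V) : Prop :=
  ∃ (x y : V) (P : Fin 3 → G.Walk x y),
    x ≠ y ∧
    (∀ i, (P i).IsPath) ∧
    (∀ i j, i ≠ j → P i ≠ P j) ∧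
    (∀ i j, i ≠ j → ∀ z ∈ (P i).support, z ∈ (P j).support → z = x ∨ z = y) ∧
    (∀ z : V, ∃ i, z ∈ (P i).support) ∧
    (∀ e ∈ G.edgeSet, ∃ i, e ∈ (P i).edges)

/-- `G` is a prism: it consists of three pairwise vertex-disjoint paths `P i` from `v i` to
`w i`, each of length at least 1, together with the edges of a triangle on the three `v i` and
of a triangle on the three `w i`. -/
def IsPrism {V : Type*} (G : SimpleGraph V) : Prop :=
  ∃ (v w : Fin 3 → V) (P : ∀ i, G.Walk (v i) (w i)),
    (∀ i, (P i).IsPath) ∧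
    (∀ i, 1 ≤ (P i).length) ∧
    (∀ i j, i ≠ j → ∀ z ∈ (P i).support, z ∉ (P j).support) ∧
    (∀ i j, i ≠ j → G.Adj (v i) (v j) ∧ G.Adj (w i) (w j)) ∧
    (∀ z : V, ∃ i, z ∈ (P i).support) ∧
    (∀ e ∈ G.edgeSet, (∃ i, e ∈ (P i).edges) ∨
      ∃ i j, i ≠ j ∧ (e = s(v i, v j) ∨ e = s(w i, w j)))

/-- `H` is (isomorphic to) the line graph of `G`. -/
def IsLineGraphOf {W V : Type*} (H : SimpleGraph W) (G : SimpleGraph V) : Prop :=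
  Nonempty (H ≃g G.lineGraph)

universe u₁ u₂ u₃

/-! Every list has exactly as many colours as its vertex has neighbours, so slack appears only when
a vertex u has a colour that is missing from the list of a neighbour v; call this a free colour.
Freeze u with a free colour. Then v has more colours than remaining neighbours, and if the rest of
the graph is connected, its vertices can be removed one by one from v outwards, each having a spare
colour when its turn comes. A vertex with a spare colour never obstructs swaps among the others
(`Swappable.of_isolate`), so any two colourings that share a free colour at u are equivalent
(`kempeEquiv_of_spare`). Likewise, colourings that differ only on a set inducing a forest are
equivalent (`kempeEquiv_of_forest`). For each graph two tasks remain: lead every colouring to one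
that uses a free colour, and link the classes belonging to different free colours, usually by a
single colouring that uses two of them.

All the graphs except `K₄ □ K₂` consist of three paths, possibly empty, whose ends are joined
(`pathSystem`). Interior vertices of these paths have two colours, so a path forbids only a partial
matching between the colours of its two ends (`eq_of_not_pathExt`), and a free colour at an end
forbids nothing (`pathExt_of_notMem`). If a path forbids two pairs on the same two colours, the
parity of its length tells which pairs these are (`not_pathExt_parity`). Parity is needed for short
barbells and for theta-graphs in which the branch vertices are adjacent.

Leading to a free colour works as follows. In a prism, a class of colourings avoiding the free
colours at both ends of a long path is so rigid that it cannot exist (`StuckPrism.elim`); line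
graphs of theta-graphs whose paths all have length at least two are prisms too. If the branch
vertices are adjacent, or if a barbell has a handle with one edge, some vertex with four colours
lies in two triangles and `Hub.exists_kempeEquiv` applies. A longer handle is treated by recolouring
both of its ends (`barbell_exists_kempeEquiv`). In a short barbell the four ends form a clique, and
a count of arcs suffices (`exists_kempeEquiv_of_clique`).

In `K₄ □ K₂` every colouring uses a free colour unless all lists are equal, and free colours are
linked by `colorsLinked`. Equal lists reduce to derangements of four colours.

Throughout, `MultiSwap` allows several components to be swapped at once;
`listEquivalent_of_interchangesAt` splits this into single Kempe swaps. -/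

/-- `φ` is a proper colouring of `G` from the lists `L`. -/
def IsProperList {V C : Type*} (G : SimpleGraph V) (L : V → Finset C) (φ : V → C) : Prop :=
  (∀ v, φ v ∈ L v) ∧ ∀ u v, G.Adj u v → φ u ≠ φ v

/-- `ψ` arises from `φ` by interchanging the colours `a` and `b` at some vertices. -/
def InterchangesAt {V C : Type*} (a b : C) (φ ψ : V → C) : Prop :=
  ∀ v, φ v = ψ v ∨ (φ v = a ∧ ψ v = b) ∨ (φ v = b ∧ ψ v = a)

/-- One generalised Kempe swap between proper list colourings: several components of one
two-coloured subgraph may be swapped at once. -/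
def MultiSwap {V C : Type*} (G : SimpleGraph V) (L : V → Finset C) (φ ψ : V → C) : Prop :=
  IsProperList G L φ ∧ IsProperList G L ψ ∧ ∃ a b, InterchangesAt a b φ ψ

/-- The equivalence relation generated by generalised Kempe swaps. -/
def KempeEquiv {V C : Type*} (G : SimpleGraph V) (L : V → Finset C) (φ ψ : V → C) : Prop :=
  Relation.ReflTransGen (MultiSwap G L) φ ψ

/-- Every two proper colourings of `G` from the lists `L` are equivalent. -/
def Swappable {V C : Type*} (G : SimpleGraph V) (L : V → Finset C) : Prop :=
  ∀ φ ψ, IsProperList G L φ → IsProperList G L ψ → KempeEquiv G L φ ψ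

/-! ### Generalised Kempe swaps and deletion of a vertex with a spare colour. -/

section Basic

variable {V C : Type*} {G : SimpleGraph V} {L : V → Finset C}

theorem InterchangesAt.symm {a b : C} {φ ψ : V → C} (h : InterchangesAt a b φ ψ) :
    InterchangesAt a b ψ φ := by
  intro v
  rcases h v with h | h | h
  · exact Or.inl h.symm
  · exact Or.inr (Or.inr ⟨h.2, h.1⟩)
  · exact Or.inr (Or.inl ⟨h.2, h.1⟩)

theorem MultiSwap.symm {φ ψ : V → C} (h : MultiSwap G L φ ψ) : MultiSwap G L ψ φ := by
  obtain ⟨h1, h2, a, b, h3⟩ := h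
  exact ⟨h2, h1, a, b, h3.symm⟩

theorem KempeEquiv.refl (φ : V → C) : KempeEquiv G L φ φ := Relation.ReflTransGen.refl

theorem KempeEquiv.symm {φ ψ : V → C} (h : KempeEquiv G L φ ψ) : KempeEquiv G L ψ φ := by
  induction h with
  | refl => exact Relation.ReflTransGen.refl
  | tail _ hs ih => exact Relation.ReflTransGen.head hs.symm ih

theorem KempeEquiv.trans {φ ψ χ : V → C} (h : KempeEquiv G L φ ψ) (h' : KempeEquiv G L ψ χ) :
    KempeEquiv G L φ χ := Relation.ReflTransGen.trans h h'

theorem MultiSwap.kempeEquiv {φ ψ : V → C} (h : MultiSwap G L φ ψ) : KempeEquiv G L φ ψ :=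
  Relation.ReflTransGen.single h

theorem KempeEquiv.isProperList {φ ψ : V → C} (h : KempeEquiv G L φ ψ)
    (hφ : IsProperList G L φ) : IsProperList G L ψ := by
  induction h with
  | refl => exact hφ
  | tail _ h _ => exact h.2.1

/-- A generalised Kempe swap is a sequence of valid Kempe swaps. -/
theorem listEquivalent_of_interchangesAt [Finite V] {a b : C} (hab : a ≠ b) (n : ℕ) :
    ∀ φ ψ : G.Coloring C, IsListColoring G L φ → IsListColoring G L ψ →
      InterchangesAt a b (φ : V → C) ψ → {v | φ v ≠ ψ v}.ncard ≤ n →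
      ListEquivalent G L φ ψ := by
  classical
  induction n with
  | zero =>
    intro φ ψ _ _ _ hn
    have : {v | φ v ≠ ψ v} = ∅ := (Set.ncard_eq_zero (Set.toFinite _)).1 (by omega)
    have : φ = ψ := by
      ext v
      by_contra hv
      exact (Set.eq_empty_iff_forall_notMem.1 this v) hv
    rw [this]
    exact Relation.ReflTransGen.refl
  | succ n ih =>
    intro φ ψ hφ hψ hd hn
    by_cases he : ∃ v, φ v ≠ ψ v
    swap
    · have : φ = ψ := by
        ext v
        by_contra hv
        exact he ⟨v, hv⟩
      rw [this]
      exact Relation.ReflTransGen.refl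
    obtain ⟨v, hv⟩ := he
    have hvab : φ v = a ∨ φ v = b := by
      rcases hd v with h | h | h
      · exact absurd h hv
      · exact Or.inl h.1
      · exact Or.inr h.1
    set D : Set V := {v | φ v = a ∨ φ v = b} with hD
    set K := (G.induce D).connectedComponentMk ⟨v, hvab⟩ with hK
    set S : Set V := Subtype.val '' K.supp with hS
    have hvS : v ∈ S := ⟨⟨v, hvab⟩, rfl, rfl⟩
    have hSD : ∀ u ∈ S, φ u = a ∨ φ u = b := by
      rintro u ⟨⟨u, hu⟩, -, rfl⟩
      exact hu
    have hclosed : ∀ u ∈ S, ∀ w, G.Adj u w → (φ w = a ∨ φ w = b) → w ∈ S := by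
      rintro u ⟨⟨u, hu⟩, hu', rfl⟩ w huw hw
      refine ⟨⟨w, hw⟩, ?_, rfl⟩
      have : (G.induce D).Adj ⟨w, hw⟩ ⟨u, hu⟩ := huw.symm
      have h2 := SimpleGraph.ConnectedComponent.sound this.reachable
      rw [SimpleGraph.ConnectedComponent.mem_supp_iff] at hu' ⊢
      rw [h2, hu']
    -- If `u` changes, a neighbour `w` coloured `a` or `b` changes too, since otherwise `ψ` would
    -- colour both alike. Hence the whole component of `v` changes.
    have hstep : ∀ u w, G.Adj u w → φ u ≠ ψ u → (φ w = a ∨ φ w = b) → φ w ≠ ψ w := by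
      intro u w huw hu hw
      have h1 := φ.valid huw
      have h2 := ψ.valid huw
      rcases hd u with h | h | h
      · exact absurd h hu
      · grind
      · grind
    have hchange : ∀ u ∈ S, φ u ≠ ψ u := by
      rintro u ⟨⟨u, hu⟩, hu', rfl⟩
      have hr : (G.induce D).Reachable ⟨v, hvab⟩ ⟨u, hu⟩ := by
        rw [SimpleGraph.ConnectedComponent.mem_supp_iff] at hu'
        exact (SimpleGraph.ConnectedComponent.exact hu').symm
      rw [SimpleGraph.reachable_iff_reflTransGen] at hr
      have key : ∀ x : D, Relation.ReflTransGen (G.induce D).Adj ⟨v, hvab⟩ x →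
          φ x ≠ ψ x := by
        intro x hx
        induction hx with
        | refl => exact hv
        | @tail y z _ h ih => exact hstep _ _ h ih z.2
      exact key _ hr
    have hval : ∀ u ∈ S, (φ u = a ∧ ψ u = b) ∨ (φ u = b ∧ ψ u = a) := by
      intro u hu
      rcases hd u with h | h
      · exact absurd h (hchange u hu)
      · exact h
    -- Follow `ψ` on the component and `φ` elsewhere. This is one Kempe swap, and fewer vertices
    -- disagree with `ψ` afterwards.
    let χ : G.Coloring C := SimpleGraph.Coloring.mk (fun u => if u ∈ S then ψ u else φ u) (by
      intro u w huw
      have h1 := φ.valid huw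
      have h2 := ψ.valid huw
      by_cases hu : u ∈ S <;> by_cases hw : w ∈ S <;> simp only [hu, hw, if_true, if_false]
      · exact h2
      · have := hval u hu
        have := hclosed u hu w huw
        grind
      · have := hval w hw
        have := hclosed w hw u huw.symm
        grind
      · exact h1)
    have hχ : ∀ u, χ u = if u ∈ S then ψ u else φ u := fun u => rfl
    have hχL : IsListColoring G L χ := by
      intro u
      rw [hχ]
      split_ifs
      · exact hψ u
      · exact hφ u
    have hsw : ValidKempeSwap G L φ χ := by
      refine ⟨hφ, hχL, a, b, hab, K, ?_, ?_⟩
      · intro u hu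
        have := hval u hu
        rw [hχ, if_pos hu]
        grind
      · intro u hu
        rw [hχ, if_neg hu]
    refine Relation.ReflTransGen.head hsw (ih χ ψ hχL hψ ?_ ?_)
    · intro u
      rw [hχ]
      split_ifs
      · exact Or.inl rfl
      · exact hd u
    · have hlt : {v | χ v ≠ ψ v}.ncard < {v | φ v ≠ ψ v}.ncard := by
        refine Set.ncard_lt_ncard ?_ (Set.toFinite _)
        refine ⟨?_, ?_⟩
        · intro u hu
          simp only [Set.mem_ofPred_eq, hχ] at hu ⊢
          split_ifs at hu
          · exact absurd rfl hu
          · exact hu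
        · intro h
          have := h hv
          simp only [Set.mem_ofPred_eq, hχ, if_pos hvS] at this
          exact this rfl
      omega

theorem Swappable.listSwappable [Finite V] (h : Swappable G L) : ListSwappable G L := by
  intro φ ψ hφ hψ
  have key : ∀ f : V → C, KempeEquiv G L φ f → ∃ hf : IsProperList G L f,
      ListEquivalent G L φ (SimpleGraph.Coloring.mk f (fun {u v} h => hf.2 u v h)) := by
    intro f hf
    induction hf with
    | refl => exact ⟨⟨hφ, fun u v h => φ.valid h⟩, Relation.ReflTransGen.refl⟩
    | @tail f g _ hs ih =>
      obtain ⟨hf, h1⟩ := ih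
      obtain ⟨_, hg, a, b, hd⟩ := hs
      refine ⟨hg, h1.trans ?_⟩
      -- A generalised swap may have `a = b`, and then it changes nothing.
      by_cases hab : a = b
      · have : f = g := by
          ext v
          have := hd v
          grind
        subst this
        exact Relation.ReflTransGen.refl
      · exact listEquivalent_of_interchangesAt hab _ _ _ hf.1 hg.1 hd le_rfl
  obtain ⟨_, h1⟩ := key ψ (h φ ψ ⟨hφ, fun u v h => φ.valid h⟩ ⟨hψ, fun u v h => ψ.valid h⟩)
  exact h1

/-- Carries equivalence in a more restrictive problem, such as the one left after fixing some
colours, back to `G` and `L`. -/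
theorem KempeEquiv.mono {G' : SimpleGraph V} {L' : V → Finset C}
    (h : ∀ χ, IsProperList G' L' χ → IsProperList G L χ) {φ ψ : V → C}
    (hk : KempeEquiv G' L' φ ψ) : KempeEquiv G L φ ψ := by
  induction hk with
  | refl => exact Relation.ReflTransGen.refl
  | tail _ hs ih => exact ih.tail ⟨h _ hs.1, h _ hs.2.1, hs.2.2⟩

/-- Swappability is invariant under graph isomorphism. -/
theorem Swappable.of_iso {W : Type*} {H : SimpleGraph W} (e : H ≃g G) {L : W → Finset C}
    (h : Swappable G (fun v => L (e.symm v))) : Swappable H L := by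
  intro φ ψ hφ hψ
  have hpull : ∀ f : W → C, IsProperList H L f →
      IsProperList G (fun v => L (e.symm v)) (fun v => f (e.symm v)) := fun f hf =>
    ⟨fun v => hf.1 _, fun u v huv => hf.2 _ _ (e.symm.map_adj_iff.2 huv)⟩
  have hpush : ∀ f : V → C, IsProperList G (fun v => L (e.symm v)) f →
      IsProperList H L (fun w => f (e w)) := fun f hf =>
    ⟨fun w => by simpa using hf.1 (e w), fun u v huv => hf.2 _ _ (e.map_adj_iff.2 huv)⟩
  have key : ∀ f g : V → C, KempeEquiv G (fun v => L (e.symm v)) f g →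
      KempeEquiv H L (fun w => f (e w)) (fun w => g (e w)) := by
    intro f g hfg
    induction hfg with
    | refl => exact KempeEquiv.refl _
    | tail _ hs ih =>
      obtain ⟨h1, h2, a, b, hd⟩ := hs
      exact ih.tail ⟨hpush _ h1, hpush _ h2, a, b, fun w => hd (e w)⟩
  have := key _ _ (h _ _ (hpull φ hφ) (hpull ψ hψ))
  simpa using this

/-- Recolouring one vertex. -/
theorem kempeEquiv_of_forall_ne {φ ψ : V → C} (hφ : IsProperList G L φ)
    (hψ : IsProperList G L ψ) (w : V) (h : ∀ v, v ≠ w → φ v = ψ v) : KempeEquiv G L φ ψ := by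
  refine MultiSwap.kempeEquiv ⟨hφ, hψ, φ w, ψ w, fun v => ?_⟩
  by_cases hv : v = w
  · subst hv
    exact Or.inr (Or.inl ⟨rfl, rfl⟩)
  · exact Or.inl (h v hv)

theorem swappable_of_forall_not_adj [Finite V] (h : ∀ u v, ¬ G.Adj u v) : Swappable G L := by
  classical
  have : Fintype V := Fintype.ofFinite V
  intro φ ψ hφ hψ
  have key : ∀ S : Finset V, KempeEquiv G L φ (fun v => if v ∈ S then ψ v else φ v) := by
    intro S
    have hp : ∀ S : Finset V, IsProperList G L (fun v => if v ∈ S then ψ v else φ v) := by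
      intro S
      refine ⟨fun v => ?_, fun u v huv => absurd huv (h u v)⟩
      dsimp only
      split_ifs
      · exact hψ.1 v
      · exact hφ.1 v
    induction S using Finset.induction_on with
    | empty => simpa using KempeEquiv.refl φ
    | insert a S _ ih =>
      refine ih.trans (kempeEquiv_of_forall_ne (hp _) (hp _) a ?_)
      intro v hv
      simp [hv]
  simpa using key Finset.univ

/-- The graph obtained from `G` by deleting all edges at `w`. -/
def SimpleGraph.isolate (G : SimpleGraph V) (w : V) : SimpleGraph V where
  Adj u v := G.Adj u v ∧ u ≠ w ∧ v ≠ w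
  symm := ⟨fun _ _ h => ⟨h.1.symm, h.2.2, h.2.1⟩⟩
  loopless := ⟨fun _ h => G.loopless.irrefl _ h.1⟩

theorem neighborSet_isolate (w v : V) :
    ((G.isolate w).neighborSet v) ⊆ G.neighborSet v := fun _ h => h.1

/-- If `w` has more colours than neighbours and deleting the edges at `w` leaves a swappable
graph, then the graph is swappable. -/
theorem Swappable.of_isolate [Finite V] {w : V} (hw : (G.neighborSet w).ncard < (L w).card)
    (h : Swappable (G.isolate w) L) : Swappable G L := by
  classical
  intro φ ψ hφ hψ
  have hres : ∀ χ : V → C, IsProperList G L χ → IsProperList (G.isolate w) L χ :=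
    fun χ hχ => ⟨hχ.1, fun u v huv => hχ.2 u v huv.1⟩
  have upd : ∀ χ : V → C, IsProperList (G.isolate w) L χ → ∀ z ∈ L w,
      (∀ u, G.Adj w u → χ u ≠ z) → IsProperList G L (Function.update χ w z) := by
    intro χ hχ z hz hzu
    refine ⟨fun v => ?_, fun u v huv => ?_⟩
    · by_cases hv : v = w
      · subst hv
        simpa using hz
      · simpa [hv] using hχ.1 v
    · by_cases hu : u = w
      · subst hu
        rw [Function.update_self, Function.update_of_ne huv.ne']
        exact (hzu v huv).symm
      · by_cases hv : v = w
        · subst hv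
          rw [Function.update_self, Function.update_of_ne huv.ne]
          exact hzu u huv.symm
        · rw [Function.update_of_ne hu, Function.update_of_ne hv]
          exact hχ.2 u v ⟨huv, hu, hv⟩
  -- Each swap away from `w` is imitated in `G` while the colour of `w` is adapted; only agreement
  -- off `w` is recorded.
  have lift : ∀ χ χ' : V → C, MultiSwap (G.isolate w) L χ χ' → ∀ φ : V → C,
      IsProperList G L φ → (∀ v, v ≠ w → φ v = χ v) →
      ∃ φ', KempeEquiv G L φ φ' ∧ ∀ v, v ≠ w → φ' v = χ' v := by
    intro χ χ' ⟨hχ, hχ', a, b, hd⟩ φ hφ hag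
    by_cases hfree : ∀ u, G.Adj w u → χ' u ≠ φ w
    · refine ⟨Function.update χ' w (φ w), MultiSwap.kempeEquiv ⟨hφ, upd _ hχ' _ (hφ.1 w) hfree,
        a, b, fun v => ?_⟩, fun v hv => by simp [hv]⟩
      by_cases hv : v = w
      · subst hv
        simp
      · rw [Function.update_of_ne hv, hag v hv]
        exact hd v
    · push Not at hfree
      obtain ⟨u, hwu, hu⟩ := hfree
      -- without loss of generality the colour of `w` is `a`
      obtain ⟨a, b, hd, ha, hub⟩ : ∃ a b, InterchangesAt a b χ χ' ∧ φ w = a ∧ χ u = b := by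
        have h1 := hφ.2 w u hwu
        rw [hag u hwu.ne'] at h1
        rcases hd u with h | h | h
        · exact absurd (h.trans hu).symm h1
        · exact ⟨b, a, fun v => by have := hd v; tauto, by rw [← hu, h.2], h.1⟩
        · exact ⟨a, b, hd, by rw [← hu, h.2], h.1⟩
      have hab : a ≠ b := by
        rintro rfl
        exact hφ.2 w u hwu (by rw [ha, hag u hwu.ne', hub])
      -- First try to move `w` out of the way, to a colour `z` that no neighbour has. Since `u` has
      -- colour `b`, the swap of `a` and `b` does not involve `z`.
      by_cases hz : ∃ z ∈ L w, z ≠ a ∧ ∀ u, G.Adj w u → φ u ≠ z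
      · obtain ⟨z, hzL, hza, hzu⟩ := hz
        have hzb : z ≠ b := by
          rintro rfl
          exact hzu u hwu (by rw [hag u hwu.ne', hub])
        refine ⟨Function.update χ' w z, ?_, fun v hv => by simp [hv]⟩
        have p1 := upd φ (hres φ hφ) z hzL hzu
        have p2 : IsProperList G L (Function.update χ' w z) := by
          refine upd χ' hχ' z hzL fun u' hu' h => ?_
          have h1 := hzu u' hu'
          rw [hag u' hu'.ne'] at h1
          have := hd u'
          grind
        refine (kempeEquiv_of_forall_ne hφ p1 w fun v hv => by simp [hv]).trans
          (MultiSwap.kempeEquiv ⟨p1, p2, a, b, fun v => ?_⟩)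
        by_cases hv : v = w
        · subst hv
          simp
        · rw [Function.update_of_ne hv, Function.update_of_ne hv, hag v hv]
          exact hd v
      · push Not at hz
        -- every neighbour of `w` has its own colour from `L w`
        have hsub : ((L w).erase a : Set C) ⊆ φ '' G.neighborSet w := by
          intro z hz'
          rw [Finset.mem_coe, Finset.mem_erase] at hz'
          obtain ⟨u', hu', h'⟩ := hz z hz'.2 hz'.1
          exact ⟨u', hu', h'⟩
        have haL : a ∈ L w := ha ▸ hφ.1 w
        have hcard : ((L w).erase a : Set C).ncard + 1 = (L w).card := by
          rw [Set.ncard_coe_finset]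
          exact Finset.card_erase_add_one haL
        have hfin : (φ '' G.neighborSet w).Finite := Set.toFinite _
        have h1 := Set.ncard_le_ncard hsub hfin
        have h2 : (φ '' G.neighborSet w).ncard ≤ (G.neighborSet w).ncard :=
          Set.ncard_image_le (Set.toFinite _)
        have hinj : Set.InjOn φ (G.neighborSet w) :=
          Set.injOn_of_ncard_image_eq (by omega) (Set.toFinite _)
        have heq : ((L w).erase a : Set C) = φ '' G.neighborSet w :=
          Set.eq_of_subset_of_ncard_le hsub (by omega) hfin
        have hφu : φ u = b := by rw [hag u hwu.ne', hub]
        have hbL : b ∈ L w := by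
          have : b ∈ ((L w).erase a : Set C) := by
            rw [heq]
            exact ⟨u, hwu, hφu⟩
          exact (Finset.mem_erase.1 (Finset.mem_coe.1 this)).2
        -- The neighbours have distinct colours, so `u` is the only one coloured `b`. Therefore `w`
        -- can join the swap and take `b`.
        refine ⟨Function.update χ' w b, MultiSwap.kempeEquiv ⟨hφ, ?_, a, b, fun v => ?_⟩,
          fun v hv => by simp [hv]⟩
        · refine upd χ' hχ' b hbL fun u' hu' h => ?_
          by_cases huu : u' = u
          · subst huu
            grind
          · have h3 : φ u' ≠ b := fun h => huu (hinj hu' hwu (h.trans hφu.symm))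
            have h4 := hφ.2 w u' hu'
            rw [hag u' hu'.ne'] at h3 h4
            have := hd u'
            grind
        · by_cases hv : v = w
          · subst hv
            rw [Function.update_self]
            exact Or.inr (Or.inl ⟨ha, rfl⟩)
          · rw [Function.update_of_ne hv, hag v hv]
            exact hd v
  have main : ∀ χ, KempeEquiv (G.isolate w) L φ χ →
      ∃ φ', KempeEquiv G L φ φ' ∧ ∀ v, v ≠ w → φ' v = χ v := by
    intro χ hχ
    induction hχ with
    | refl => exact ⟨φ, KempeEquiv.refl _, fun _ _ => rfl⟩
    | tail _ hs ih =>
      obtain ⟨φ', h1, h2⟩ := ih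
      obtain ⟨φ'', h3, h4⟩ := lift _ _ hs φ' (h1.isProperList hφ) h2
      exact ⟨φ'', h1.trans h3, h4⟩
  obtain ⟨φ', h1, h2⟩ := main ψ (h φ ψ (hres φ hφ) (hres ψ hψ))
  exact h1.trans (kempeEquiv_of_forall_ne (h1.isProperList hφ) hψ w h2)

end Basic

/-! ### Elimination orders: spare colours and forests. -/

section Elimination

variable {V C : Type*} [Finite V]

open Classical in
/-- A vertex order in which every vertex of `F` either has spare colours or a neighbour that
precedes it yields swappability. -/
theorem swappable_of_spare_rank (r : V → ℕ) (n : ℕ) : ∀ (F : Finset V) (G : SimpleGraph V)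
    (L : V → Finset C), F.card = n → (∀ u v, G.Adj u v → u ∈ F) →
    (∀ v ∈ F, (G.neighborSet v).ncard < (L v).card ∨
      ((G.neighborSet v).ncard ≤ (L v).card ∧ ∃ u, G.Adj v u ∧ r u < r v)) →
    Swappable G L := by
  induction n with
  | zero =>
    intro F G L hF hG _
    rw [Finset.card_eq_zero] at hF
    subst hF
    exact swappable_of_forall_not_adj fun u v h => absurd (hG u v h) (Finset.notMem_empty u)
  | succ n ih =>
    intro F G L hF hG hr
    -- Nothing precedes a vertex of minimal rank, so it must have a spare colour. Deleting its edges
    -- costs its neighbours a neighbour but no colour, so they become spare in turn.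
    obtain ⟨v, hv, hmin⟩ := F.exists_min_image r (Finset.card_pos.1 (by omega))
    have hlt : (G.neighborSet v).ncard < (L v).card := by
      rcases hr v hv with h | ⟨_, u, hu, hlt⟩
      · exact h
      · exact absurd (hmin u (hG u v hu.symm)) (by omega)
    refine Swappable.of_isolate hlt (ih (F.erase v) _ L ?_ ?_ ?_)
    · rw [Finset.card_erase_of_mem hv]
      omega
    · intro u w h
      exact Finset.mem_erase.2 ⟨h.2.1, hG u w h.1⟩
    · intro u hu
      obtain ⟨huv, huF⟩ := Finset.mem_erase.1 hu
      have hle := Set.ncard_le_ncard (neighborSet_isolate (G := G) v u) (Set.toFinite _)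
      by_cases hadj : G.Adj u v
      · left
        have : ((G.isolate v).neighborSet u).ncard < (G.neighborSet u).ncard := by
          refine Set.ncard_lt_ncard ⟨neighborSet_isolate v u, fun h => ?_⟩ (Set.toFinite _)
          exact (h (show v ∈ G.neighborSet u from hadj)).2.2 rfl
        rcases hr u huF with h | h <;> omega
      · rcases hr u huF with h | ⟨h, w, hw, hlt⟩
        · left
          omega
        · refine Or.inr ⟨by omega, w, ⟨hw, huv, ?_⟩, hlt⟩
          rintro rfl
          exact hadj hw

open Classical in
/-- Forests with degree-sized lists are swappable; acyclicity is witnessed by a vertex order in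
which every vertex has at most one neighbour that does not precede it. -/
theorem swappable_of_forest_rank (r : V → ℕ) (n : ℕ) : ∀ (F : Finset V) (G : SimpleGraph V)
    (L : V → Finset C), F.card = n → (∀ u v, G.Adj u v → u ∈ F) →
    (∀ v, (G.neighborSet v).ncard ≤ (L v).card) →
    (∀ v u u', G.Adj v u → G.Adj v u' → r v ≤ r u → r v ≤ r u' → u = u') →
    Swappable G L := by
  induction n with
  | zero =>
    intro F G L hF hG _ _
    rw [Finset.card_eq_zero] at hF
    subst hF
    exact swappable_of_forall_not_adj fun u v h => absurd (hG u v h) (Finset.notMem_empty u)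
  | succ n ih =>
    intro F G L hF hG hd hr
    obtain ⟨v, hv, hmin⟩ := F.exists_min_image r (Finset.card_pos.1 (by omega))
    have hmin' : ∀ u, G.Adj v u → r v ≤ r u := fun u hu => hmin u (hG u v hu.symm)
    -- No neighbour of `v` precedes it, so `v` is a leaf or isolated.
    have hone : (G.neighborSet v).ncard ≤ 1 := by
      rw [Set.ncard_le_one (Set.toFinite _)]
      exact fun u hu u' hu' => hr v u u' hu hu' (hmin' u hu) (hmin' u' hu')
    have hcard : (F.erase v).card = n := by
      rw [Finset.card_erase_of_mem hv]
      omega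
    have hedge : ∀ u w, (G.isolate v).Adj u w → u ∈ F.erase v := fun u w h =>
      Finset.mem_erase.2 ⟨h.2.1, hG u w h.1⟩
    have hrank : ∀ x u u', (G.isolate v).Adj x u → (G.isolate v).Adj x u' → r x ≤ r u →
        r x ≤ r u' → u = u' := fun x u u' h h' => hr x u u' h.1 h'.1
    have hle : ∀ u, ((G.isolate v).neighborSet u).ncard ≤ (G.neighborSet u).ncard := fun u =>
      Set.ncard_le_ncard (neighborSet_isolate v u) (Set.toFinite _)
    by_cases hlt : (G.neighborSet v).ncard < (L v).card
    · exact Swappable.of_isolate hlt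
        (ih (F.erase v) _ L hcard hedge (fun u => (hle u).trans (hd u)) hrank)
    -- The list of `v` contains a colour of `φ`, so list size and degree are both 1 and the colour
    -- of `v` is forced. Its neighbour loses this colour at most, and also a neighbour, so the
    -- degree bound survives.
    · intro φ ψ hφ hψ
      have hpos : 0 < (L v).card := Finset.card_pos.2 ⟨_, hφ.1 v⟩
      have hL1 : (L v).card = 1 := by
        have := hd v
        omega
      obtain ⟨s, hs⟩ := Finset.card_eq_one.1 hL1
      have hval : ∀ χ, IsProperList G L χ → χ v = s := fun χ hχ => by
        have := hχ.1 v
        rwa [hs, Finset.mem_singleton] at this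
      set L' : V → Finset C := fun u => if G.Adj u v then (L u).erase s else L u with hL'
      have hto : ∀ χ, IsProperList G L χ → IsProperList (G.isolate v) L' χ := by
        refine fun χ hχ => ⟨fun u => ?_, fun u w h => hχ.2 u w h.1⟩
        simp only [hL']
        split_ifs with h
        · refine Finset.mem_erase.2 ⟨?_, hχ.1 u⟩
          have := hχ.2 u v h
          rwa [hval χ hχ] at this
        · exact hχ.1 u
      have hfrom : ∀ χ, IsProperList (G.isolate v) L' χ → IsProperList G L χ := by
        intro χ hχ
        have hmem : ∀ u, χ u ∈ L u := by
          intro u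
          have := hχ.1 u
          simp only [hL'] at this
          split_ifs at this with h
          · exact Finset.mem_of_mem_erase this
          · exact this
        have hv1 : χ v = s := by
          have := hmem v
          rwa [hs, Finset.mem_singleton] at this
        have hne : ∀ u, G.Adj u v → χ u ≠ s := by
          intro u h
          have := hχ.1 u
          simp only [hL', if_pos h] at this
          exact Finset.ne_of_mem_erase this
        refine ⟨hmem, fun u w huw => ?_⟩
        by_cases hu : u = v
        · subst hu
          rw [hv1]
          exact (hne w huw.symm).symm
        · by_cases hw : w = v
          · subst hw
            rw [hv1]
            exact hne u huw
          · exact hχ.2 u w ⟨huw, hu, hw⟩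
      refine KempeEquiv.mono hfrom (ih (F.erase v) _ L' hcard hedge (fun u => ?_) hrank φ ψ
        (hto φ hφ) (hto ψ hψ))
      simp only [hL']
      split_ifs with h
      · have h1 : ((G.isolate v).neighborSet u).ncard < (G.neighborSet u).ncard := by
          refine Set.ncard_lt_ncard ⟨neighborSet_isolate v u, fun h' => ?_⟩ (Set.toFinite _)
          exact (h' (show v ∈ G.neighborSet u from h)).2.2 rfl
        have h2 := Finset.pred_card_le_card_erase (s := L u) (a := s)
        have := hd u
        omega
      · exact (hle u).trans (hd u)

variable {G : SimpleGraph V} {L : V → Finset C}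

/-- The edges of `G` with both ends in `F`. -/
def SimpleGraph.within (G : SimpleGraph V) (F : Set V) : SimpleGraph V where
  Adj u v := G.Adj u v ∧ u ∈ F ∧ v ∈ F
  symm := ⟨fun _ _ h => ⟨h.1.symm, h.2.2, h.2.1⟩⟩
  loopless := ⟨fun _ h => G.loopless.irrefl _ h.1⟩

open Classical in
/-- The colours that remain available when `φ` is fixed outside of `F`. -/
noncomputable def residualList (G : SimpleGraph V) (L : V → Finset C) (φ : V → C) (F : Set V)
    (v : V) : Finset C :=
  if v ∈ F then (L v).filter (fun c => ∀ u, G.Adj v u → u ∉ F → φ u ≠ c) else {φ v}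

theorem isProperList_residual {φ ψ : V → C} {F : Set V} (hψ : IsProperList G L ψ)
    (h : ∀ v, v ∉ F → φ v = ψ v) : IsProperList (G.within F) (residualList G L φ F) ψ := by
  classical
  refine ⟨fun v => ?_, fun u v huv => hψ.2 u v huv.1⟩
  unfold residualList
  split_ifs with hv
  · refine Finset.mem_filter.2 ⟨hψ.1 v, fun u hu huF => ?_⟩
    rw [h u huF]
    exact hψ.2 u v hu.symm
  · rw [Finset.mem_singleton, h v hv]

theorem IsProperList.of_residual {φ χ : V → C} {F : Set V} (hφ : IsProperList G L φ)
    (hχ : IsProperList (G.within F) (residualList G L φ F) χ) : IsProperList G L χ := by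
  classical
  have hout : ∀ v, v ∉ F → χ v = φ v := by
    intro v hv
    have := hχ.1 v
    unfold residualList at this
    rwa [if_neg hv, Finset.mem_singleton] at this
  have hin : ∀ v, v ∈ F → χ v ∈ L v ∧ ∀ u, G.Adj v u → u ∉ F → φ u ≠ χ v := by
    intro v hv
    have := hχ.1 v
    unfold residualList at this
    rwa [if_pos hv, Finset.mem_filter] at this
  refine ⟨fun v => ?_, fun u v huv => ?_⟩
  · by_cases hv : v ∈ F
    · exact (hin v hv).1
    · rw [hout v hv]
      exact hφ.1 v
  · by_cases hu : u ∈ F <;> by_cases hv : v ∈ F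
    · exact hχ.2 u v ⟨huv, hu, hv⟩
    · rw [hout v hv]
      exact ((hin u hu).2 v huv hv).symm
    · rw [hout u hu]
      exact (hin v hv).2 u huv.symm hu
    · rw [hout u hu, hout v hv]
      exact hφ.2 u v huv

/-- Every colour lost by `v` belongs to a neighbour outside of `F`, so the list shrinks no more than
the degree does. An outside neighbour whose colour is not in `L v` costs a neighbour without costing
a colour. -/
theorem ncard_within_le {φ : V → C} {F : Set V} {v : V} (hv : v ∈ F)
    (hd : (G.neighborSet v).ncard ≤ (L v).card) :
    ((G.within F).neighborSet v).ncard ≤ (residualList G L φ F v).card ∧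
    ((∃ u, G.Adj v u ∧ u ∉ F ∧ φ u ∉ L v) →
      ((G.within F).neighborSet v).ncard < (residualList G L φ F v).card) := by
  classical
  set O : Set V := G.neighborSet v \ F with hO
  have h1 : ((G.within F).neighborSet v).ncard + O.ncard = (G.neighborSet v).ncard := by
    have : (G.within F).neighborSet v = G.neighborSet v ∩ F := by
      ext u
      exact ⟨fun h => ⟨h.1, h.2.2⟩, fun h => ⟨h.1, hv, h.2⟩⟩
    rw [this, hO]
    exact Set.ncard_inter_add_ncard_sdiff_eq_ncard _ _ (Set.toFinite _)
  have h2 : ((L v : Set C) \ φ '' O) = (residualList G L φ F v : Set C) := by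
    ext c
    unfold residualList
    rw [if_pos hv]
    simp only [Set.mem_sdiff, Finset.mem_coe, Finset.mem_filter, hO, Set.mem_image]
    constructor
    · rintro ⟨h, h'⟩
      exact ⟨h, fun u hu huF he => h' ⟨u, ⟨hu, huF⟩, he⟩⟩
    · rintro ⟨h, h'⟩
      refine ⟨h, ?_⟩
      rintro ⟨u, ⟨hu, huF⟩, he⟩
      exact h' u hu huF he
  have h3 : ((L v : Set C) \ φ '' O).ncard = (residualList G L φ F v).card := by
    rw [h2, Set.ncard_coe_finset]
  have h4 : ((L v : Set C) ∩ φ '' O).ncard + ((L v : Set C) \ φ '' O).ncard = (L v).card := by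
    rw [Set.ncard_inter_add_ncard_sdiff_eq_ncard _ _ (Set.toFinite _), Set.ncard_coe_finset]
  have h5 : (φ '' O).ncard ≤ O.ncard := Set.ncard_image_le (Set.toFinite _)
  have h6 : ((L v : Set C) ∩ φ '' O).ncard ≤ (φ '' O).ncard :=
    Set.ncard_le_ncard Set.inter_subset_right (Set.toFinite _)
  refine ⟨by omega, ?_⟩
  rintro ⟨u, hu, huF, huL⟩
  have h7 : ((L v : Set C) ∩ φ '' O).ncard < (φ '' O).ncard := by
    refine Set.ncard_lt_ncard ⟨Set.inter_subset_right, fun h => ?_⟩ (Set.toFinite _)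
    exact huL (h ⟨u, ⟨hu, huF⟩, rfl⟩).1
  omega

/-- Colourings that agree outside of a set `F` are equivalent if every vertex of `F` is linked
inside `F` to a vertex with a spare colour. -/
theorem kempeEquiv_of_spare (hd : ∀ v, (G.neighborSet v).ncard ≤ (L v).card) {φ ψ : V → C}
    (hφ : IsProperList G L φ) (hψ : IsProperList G L ψ) (F : Set V)
    (hag : ∀ v, v ∉ F → φ v = ψ v) (r : V → ℕ)
    (hr : ∀ v ∈ F, (∃ u, G.Adj v u ∧ u ∉ F ∧ φ u ∉ L v) ∨ ∃ u ∈ F, G.Adj v u ∧ r u < r v) :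
    KempeEquiv G L φ ψ := by
  classical
  have : Fintype V := Fintype.ofFinite V
  refine KempeEquiv.mono (fun χ => hφ.of_residual)
    (swappable_of_spare_rank r _ (Finset.univ.filter (· ∈ F)) (G.within F) (residualList G L φ F)
      rfl ?_ ?_ φ ψ (isProperList_residual hφ fun _ _ => rfl) (isProperList_residual hψ hag))
  · intro u v h
    simpa using h.2.1
  · intro v hv
    have hv : v ∈ F := by simpa using hv
    have := ncard_within_le (φ := φ) hv (hd v)
    rcases hr v hv with h | ⟨u, hu, hvu, hlt⟩
    · exact Or.inl (this.2 h)
    · exact Or.inr ⟨this.1, u, ⟨hvu, hv, hu⟩, hlt⟩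

/-- Colourings that agree outside of a set inducing a forest are equivalent. -/
theorem kempeEquiv_of_forest (hd : ∀ v, (G.neighborSet v).ncard ≤ (L v).card) {φ ψ : V → C}
    (hφ : IsProperList G L φ) (hψ : IsProperList G L ψ) (F : Set V)
    (hag : ∀ v, v ∉ F → φ v = ψ v) (r : V → ℕ)
    (hr : ∀ v ∈ F, ∀ u ∈ F, ∀ u' ∈ F, G.Adj v u → G.Adj v u' → r v ≤ r u → r v ≤ r u' → u = u') :
    KempeEquiv G L φ ψ := by
  classical
  have : Fintype V := Fintype.ofFinite V
  refine KempeEquiv.mono (fun χ => hφ.of_residual)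
    (swappable_of_forest_rank r _ (Finset.univ.filter (· ∈ F)) (G.within F)
      (residualList G L φ F) rfl ?_ ?_ ?_ φ ψ (isProperList_residual hφ fun _ _ => rfl)
      (isProperList_residual hψ hag))
  · intro u v h
    simpa using h.2.1
  · intro v
    by_cases hv : v ∈ F
    · exact (ncard_within_le (φ := φ) hv (hd v)).1
    · have : (G.within F).neighborSet v = ∅ := by
        ext u
        simp only [SimpleGraph.mem_neighborSet, Set.mem_empty_iff_false, iff_false]
        exact fun h => hv h.2.1
      rw [this, Set.ncard_empty]
      omega
  · intro v u u' h h'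
    exact hr v h.2.1 u h.2.2 u' h'.2.2 h.1 h'.1

end Elimination

/-! ### Extending end colours along paths with two-element lists. -/

/-- Colours `α`, `β` at the ends of a path with `n` edges extend to the interior vertices, where
vertex `s` has the list `M s`. -/
def PathExt {C : Type*} (M : ℕ → Finset C) (n : ℕ) (α β : C) : Prop :=
  ∃ f : ℕ → C, f 0 = α ∧ f n = β ∧ (∀ s, 0 < s → s < n → f s ∈ M s) ∧ ∀ s < n, f s ≠ f (s + 1)

section PathExt

variable {C : Type*}

theorem pathExt_one {M : ℕ → Finset C} {α β : C} : PathExt M 1 α β ↔ α ≠ β := by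
  constructor
  · rintro ⟨f, rfl, rfl, -, h⟩
    exact h 0 (by omega)
  · intro h
    refine ⟨fun s => if s = 0 then α else β, by simp, by simp, fun s _ _ => by omega, ?_⟩
    intro s hs
    have : s = 0 := by omega
    subst this
    simpa using h

theorem pathExt_succ {M : ℕ → Finset C} {n : ℕ} (hn : 0 < n) {α β : C} :
    PathExt M (n + 1) α β ↔ ∃ z ∈ M 1, z ≠ α ∧ PathExt (fun s => M (s + 1)) n z β := by
  constructor
  · rintro ⟨f, rfl, rfl, h1, h2⟩
    refine ⟨f 1, h1 1 (by omega) (by omega), (h2 0 (by omega)).symm, fun s => f (s + 1), rfl, rfl,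
      fun s _ hs' => h1 (s + 1) (by omega) (by omega), fun s hs => h2 (s + 1) (by omega)⟩
  · rintro ⟨z, hz, hza, f, rfl, rfl, h1, h2⟩
    refine ⟨fun s => if s = 0 then α else f (s - 1), by simp, by simp, ?_, ?_⟩
    · intro s hs hs'
      simp only [if_neg (show s ≠ 0 by omega)]
      by_cases h : s = 1
      · subst h
        exact hz
      · have := h1 (s - 1) (by omega) (by omega)
        simp only at this
        rwa [show s - 1 + 1 = s by omega] at this
    · intro s hs
      by_cases h : s = 0
      · subst h
        simpa using hza.symm
      · simp only [if_neg h, if_neg (show s + 1 ≠ 0 by omega)]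
        have := h2 (s - 1) (by omega)
        rwa [show s - 1 + 1 = s + 1 - 1 by omega] at this

theorem pathExt_reverse {M : ℕ → Finset C} {n : ℕ} {α β : C} (h : PathExt M n α β) :
    PathExt (fun s => M (n - s)) n β α := by
  obtain ⟨f, rfl, rfl, h1, h2⟩ := h
  refine ⟨fun s => f (n - s), by simp, by simp, fun s hs hs' => h1 _ (by omega) (by omega), ?_⟩
  intro s hs
  have := h2 (n - (s + 1)) (by omega)
  rw [show n - (s + 1) + 1 = n - s by omega] at this
  exact this.symm

theorem PathExt.congr {M M' : ℕ → Finset C} {n : ℕ} {α β : C} (h : PathExt M n α β)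
    (hM : ∀ s, 0 < s → s < n → M s = M' s) : PathExt M' n α β := by
  obtain ⟨f, h1, h2, h3, h4⟩ := h
  exact ⟨f, h1, h2, fun s hs hs' => hM s hs hs' ▸ h3 s hs hs', h4⟩

theorem pathExt_reverse_iff {M : ℕ → Finset C} {n : ℕ} {α β : C} :
    PathExt M n α β ↔ PathExt (fun s => M (n - s)) n β α := by
  refine ⟨pathExt_reverse, fun h => (pathExt_reverse h).congr fun s _ hs' => ?_⟩
  rw [show n - (n - s) = s by omega]

/-- With two-element lists, every colour at the first end excludes at most one colour at the
last end. -/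
theorem eq_of_not_pathExt {n : ℕ} (hn : 0 < n) : ∀ {M : ℕ → Finset C}
    (_ : ∀ s, 0 < s → s < n → (M s).card = 2) {α β β' : C},
    ¬ PathExt M n α β → ¬ PathExt M n α β' → β = β' := by
  induction n, hn using Nat.le_induction with
  | base =>
    intro M _ α β β' h h'
    have h1 : α = β := by simpa [pathExt_one] using h
    have h2 : α = β' := by simpa [pathExt_one] using h'
    exact h1.symm.trans h2
  | succ n hn ih =>
    classical
    intro M hM α β β' h h'
    rw [pathExt_succ hn] at h h'
    -- A colour `z ≠ α` of the first interior vertex inherits both exclusions on the shorter path.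
    obtain ⟨z, hz, hza⟩ := Finset.exists_mem_ne (by rw [hM 1 (by omega) (by omega)]; omega) α
    exact ih (M := fun s => M (s + 1)) (fun s hs hs' => hM (s + 1) (by omega) (by omega))
      (fun he => h ⟨z, hz, hza, he⟩) (fun he => h' ⟨z, hz, hza, he⟩)

theorem eq_of_not_pathExt' {n : ℕ} (hn : 0 < n) {M : ℕ → Finset C}
    (hM : ∀ s, 0 < s → s < n → (M s).card = 2) {α α' β : C}
    (h : ¬ PathExt M n α β) (h' : ¬ PathExt M n α' β) : α = α' := by
  rw [pathExt_reverse_iff] at h h'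
  exact eq_of_not_pathExt hn (fun s hs hs' => hM (n - s) (by omega) (by omega)) h h'

/-- A colour outside the list of the first interior vertex excludes nothing. -/
theorem pathExt_of_notMem {n : ℕ} (hn : 2 ≤ n) {M : ℕ → Finset C}
    (hM : ∀ s, 0 < s → s < n → (M s).card = 2) {α : C} (h : α ∉ M 1) (β : C) :
    PathExt M n α β := by
  classical
  obtain ⟨m, rfl⟩ : ∃ m, n = m + 1 := ⟨n - 1, by omega⟩
  rw [pathExt_succ (by omega)]
  obtain ⟨z, z', hzz, hz⟩ := Finset.card_eq_two.1 (hM 1 (by omega) (by omega))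
  have hz1 : z ∈ M 1 := by simp [hz]
  have hz2 : z' ∈ M 1 := by simp [hz]
  by_contra hcon
  push Not at hcon
  -- Both colours of `M 1` are compatible with `α`, so an excluded `β` would be excluded by two
  -- colours on the shorter path.
  exact hzz (eq_of_not_pathExt' (n := m) (by omega) (M := fun s => M (s + 1))
    (fun s hs hs' => hM (s + 1) (by omega) (by omega))
    (hcon z hz1 (fun h' => h (h' ▸ hz1))) (hcon z' hz2 (fun h' => h (h' ▸ hz2))))

theorem pathExt_of_notMem' {n : ℕ} (hn : 2 ≤ n) {M : ℕ → Finset C}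
    (hM : ∀ s, 0 < s → s < n → (M s).card = 2) {β : C} (h : β ∉ M (n - 1)) (α : C) :
    PathExt M n α β := by
  rw [pathExt_reverse_iff]
  exact pathExt_of_notMem hn (fun s hs hs' => hM (n - s) (by omega) (by omega)) h α

/-- If a path with two-element lists excludes two pairs on the same two colours, then the parity
of its length decides which pairs these are. -/
theorem not_pathExt_parity {n : ℕ} (hn : 0 < n) : ∀ {M : ℕ → Finset C}
    (_ : ∀ s, 0 < s → s < n → (M s).card = 2) {α β α' β' : C}, α ≠ β →
    ¬ PathExt M n α α' → ¬ PathExt M n β β' → (α' = α ∨ α' = β) →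
    (α' = α ↔ Odd n) := by
  induction n, hn using Nat.le_induction with
  | base =>
    intro M _ α β α' β' _ h h' _
    have h1 : α = α' := by simpa [pathExt_one] using h
    simp [h1]
  | succ n hn ih =>
    classical
    intro M hM α β α' β' hab h h' hor
    rw [pathExt_succ hn] at h h'
    push Not at h h'
    obtain ⟨z, z', hzz, hz⟩ := Finset.card_eq_two.1 (hM 1 (by omega) (by omega))
    have hz1 : z ∈ M 1 := by simp [hz]
    have hz2 : z' ∈ M 1 := by simp [hz]
    have hM' : ∀ s, 0 < s → s < n → ((fun s => M (s + 1)) s).card = 2 := fun s hs hs' =>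
      hM (s + 1) (by omega) (by omega)
    have huniq : ∀ {x y w}, ¬ PathExt (fun s => M (s + 1)) n x w →
        ¬ PathExt (fun s => M (s + 1)) n y w → x = y := fun h h' =>
      eq_of_not_pathExt' (by omega) hM' h h'
    -- If `α` were not in `M 1`, both colours of `M 1` would exclude `α'` on the shorter path.
    have hα : z = α ∨ z' = α := by
      by_contra hcon
      push Not at hcon
      exact hzz (huniq (h z hz1 hcon.1) (h z' hz2 hcon.2))
    have hβ : z = β ∨ z' = β := by
      by_contra hcon
      push Not at hcon
      exact hzz (huniq (h' z hz1 hcon.1) (h' z' hz2 hcon.2))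
    have hmem : α ∈ M 1 ∧ β ∈ M 1 := by
      constructor
      · rcases hα with rfl | rfl <;> assumption
      · rcases hβ with rfl | rfl <;> assumption
    -- On the shorter path `β` excludes `α'` and `α` excludes `β'`: each edge exchanges the roles of
    -- the two colours.
    have k1 := h β hmem.2 hab.symm
    have k2 := h' α hmem.1 hab
    have := ih hM' hab.symm k1 k2 hor.symm
    rw [Nat.odd_add_one, ← this]
    grind

end PathExt

/-! ### Systems of three paths with identified ends -/

/-- Vertex `s` of a path with `m` vertices is its first (`false`) or last (`true`) vertex. -/
def AtEnd (m s : ℕ) : Bool → Prop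
  | false => s = 0
  | true => s + 1 = m

/-- Three disjoint paths on `n 0`, `n 1`, `n 2` vertices; moreover, ends of these paths are
adjacent if they carry the same label. -/
def pathSystem (n : Fin 3 → ℕ) (lab : Fin 3 → Bool → Bool) : SimpleGraph (Σ i, Fin (n i)) where
  Adj p q := p ≠ q ∧ ((p.1 = q.1 ∧ ((p.2 : ℕ) + 1 = q.2 ∨ (q.2 : ℕ) + 1 = p.2)) ∨
    ∃ b b', AtEnd (n p.1) p.2 b ∧ AtEnd (n q.1) q.2 b' ∧ lab p.1 b = lab q.1 b')
  symm := ⟨by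
    rintro p q ⟨h, h'⟩
    refine ⟨h.symm, ?_⟩
    rcases h' with ⟨h1, h2⟩ | ⟨b, b', h1, h2, h3⟩
    · exact Or.inl ⟨h1.symm, h2.symm⟩
    · exact Or.inr ⟨b', b, h2, h1, h3.symm⟩⟩
  loopless := ⟨fun _ h => h.1 rfl⟩

theorem sigma_fin_eq_iff {n : Fin 3 → ℕ} {p q : Σ i, Fin (n i)} :
    p = q ↔ p.1 = q.1 ∧ (p.2 : ℕ) = q.2 := by
  obtain ⟨i, s⟩ := p
  obtain ⟨j, t⟩ := q
  constructor
  · rintro h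
    rw [h]
    simp
  · rintro ⟨h1, h2⟩
    dsimp only at h1 h2
    subst h1
    rw [Fin.ext h2]

theorem pathSystem_adj {n : Fin 3 → ℕ} {lab : Fin 3 → Bool → Bool} {p q : Σ i, Fin (n i)} :
    (pathSystem n lab).Adj p q ↔
      (p.1 = q.1 ∧ ((p.2 : ℕ) + 1 = q.2 ∨ (q.2 : ℕ) + 1 = p.2)) ∨
      (¬ (p.1 = q.1 ∧ (p.2 : ℕ) = q.2) ∧
        (((p.2 : ℕ) = 0 ∧ (q.2 : ℕ) = 0 ∧ lab p.1 false = lab q.1 false) ∨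
        ((p.2 : ℕ) = 0 ∧ (q.2 : ℕ) + 1 = n q.1 ∧ lab p.1 false = lab q.1 true) ∨
        ((p.2 : ℕ) + 1 = n p.1 ∧ (q.2 : ℕ) = 0 ∧ lab p.1 true = lab q.1 false) ∨
        ((p.2 : ℕ) + 1 = n p.1 ∧ (q.2 : ℕ) + 1 = n q.1 ∧ lab p.1 true = lab q.1 true))) := by
  simp only [pathSystem, ne_eq, sigma_fin_eq_iff, Bool.exists_bool, AtEnd]
  constructor
  · rintro ⟨h1, h2⟩
    tauto
  · rintro (⟨h1, h2⟩ | ⟨h1, h2⟩)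
    · exact ⟨fun h => by omega, Or.inl ⟨h1, h2⟩⟩
    · exact ⟨h1, Or.inr (by tauto)⟩

/-- Passes from positions `x`, `y` of vertices on walks to positions `x'`, `y'` of edges containing
them: an end vertex of a walk lies on an end edge. -/
theorem sharedEnd {x y x' y' m m' k k' : ℕ} {P Q R S : Prop}
    (h : ((x = 0 ∧ y = 0 ∧ P) ∨ (x = 0 ∧ y + 1 = m ∧ Q)) ∨
      ((x + 1 = k ∧ y = 0 ∧ R) ∨ (x + 1 = k ∧ y + 1 = m ∧ S)))
    (h1 : x = 0 → x' = 0) (h2 : x + 1 = k → x' + 1 = k') (h3 : y = 0 → y' = 0)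
    (h4 : y + 1 = m → y' + 1 = m') :
    (x' = 0 ∧ y' = 0 ∧ P) ∨ (x' = 0 ∧ y' + 1 = m' ∧ Q) ∨ (x' + 1 = k' ∧ y' = 0 ∧ R) ∨
      (x' + 1 = k' ∧ y' + 1 = m' ∧ S) := by
  tauto

/-- The line graph of a union of three walks whose vertices coincide only at equally labelled
ends. -/
theorem lineGraph_iso_pathSystem {V : Type*} {B : SimpleGraph V} (n : Fin 3 → ℕ)
    (lab : Fin 3 → Bool → Bool) (g : Fin 3 → ℕ → V)
    (hadj : ∀ i, ∀ s < n i, B.Adj (g i s) (g i (s + 1)))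
    (hsurj : ∀ e ∈ B.edgeSet, ∃ i, ∃ s < n i, e = s(g i s, g i (s + 1)))
    (hinj : ∀ i, ∀ s < n i, ∀ j, ∀ t < n j,
      s(g i s, g i (s + 1)) = s(g j t, g j (t + 1)) → i = j ∧ s = t)
    (hcoin : ∀ i, ∀ s ≤ n i, ∀ j, ∀ t ≤ n j, (g i s = g j t ↔ (i = j ∧ s = t) ∨
      ∃ b b', AtEnd (n i + 1) s b ∧ AtEnd (n j + 1) t b' ∧ lab i b = lab j b')) :
    Nonempty (B.lineGraph ≃g pathSystem n lab) := by
  -- The edge between vertices `s` and `s + 1` of a walk becomes vertex `s` of a path, so a walk of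
  -- length `n i` yields a path with `n i` vertices.
  let F : (Σ i, Fin (n i)) → B.edgeSet := fun p =>
    ⟨s(g p.1 p.2, g p.1 (p.2 + 1)), hadj p.1 p.2 p.2.2⟩
  have hF : Function.Bijective F := by
    constructor
    · intro p q h
      rw [sigma_fin_eq_iff]
      exact hinj _ _ p.2.2 _ _ q.2.2 (congrArg Subtype.val h)
    · rintro ⟨e, he⟩
      obtain ⟨i, s, hs, rfl⟩ := hsurj e he
      exact ⟨⟨i, ⟨s, hs⟩⟩, rfl⟩
  refine ⟨(RelIso.mk (Equiv.ofBijective F hF) ?_ : pathSystem n lab ≃g B.lineGraph).symm⟩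
  intro p q
  rw [SimpleGraph.lineGraph_adj_iff_exists]
  have hval : ∀ p, ((Equiv.ofBijective F hF p : B.edgeSet) : Sym2 V) =
    s(g p.1 p.2, g p.1 (p.2 + 1)) := fun p => rfl
  simp only [hval, Sym2.mem_iff, ne_eq, (Equiv.ofBijective F hF).injective.eq_iff]
  have hp := p.2.2
  have hq := q.2.2
  have c00 := hcoin p.1 p.2 hp.le q.1 q.2 hq.le
  have c01 := hcoin p.1 p.2 hp.le q.1 (q.2 + 1) hq
  have c10 := hcoin p.1 (p.2 + 1) hp q.1 q.2 hq.le
  have c11 := hcoin p.1 (p.2 + 1) hp q.1 (q.2 + 1) hq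
  have hex : (∃ v, (v = g p.1 p.2 ∨ v = g p.1 (p.2 + 1)) ∧ (v = g q.1 q.2 ∨ v = g q.1 (q.2 + 1)))
      ↔ (g p.1 p.2 = g q.1 q.2 ∨ g p.1 p.2 = g q.1 (q.2 + 1) ∨ g p.1 (p.2 + 1) = g q.1 q.2 ∨
        g p.1 (p.2 + 1) = g q.1 (q.2 + 1)) := by
    constructor
    · rintro ⟨v, h | h, h' | h'⟩
      · exact Or.inl (h.symm.trans h')
      · exact Or.inr (Or.inl (h.symm.trans h'))
      · exact Or.inr (Or.inr (Or.inl (h.symm.trans h')))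
      · exact Or.inr (Or.inr (Or.inr (h.symm.trans h')))
    · rintro (h | h | h | h)
      · exact ⟨_, Or.inl rfl, Or.inl h⟩
      · exact ⟨_, Or.inl rfl, Or.inr h⟩
      · exact ⟨_, Or.inr rfl, Or.inl h⟩
      · exact ⟨_, Or.inr rfl, Or.inr h⟩
  rw [hex, c00, c01, c10, c11, pathSystem_adj, sigma_fin_eq_iff]
  simp only [Bool.exists_bool, AtEnd]
  constructor
  · rintro ⟨h1, h2⟩
    by_cases hc : p.1 = q.1 ∧ ((p.2 : ℕ) + 1 = q.2 ∨ (q.2 : ℕ) + 1 = p.2)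
    · exact Or.inl hc
    · refine Or.inr ⟨h1, ?_⟩
      rcases h2 with (⟨e, h⟩ | h) | (⟨e, h⟩ | h) | (⟨e, h⟩ | h) | (⟨e, h⟩ | h)
      · exact absurd ⟨e, h⟩ h1
      · exact sharedEnd h (by omega) (by omega) (by omega) (by omega)
      · exact absurd ⟨e, by omega⟩ hc
      · exact sharedEnd h (by omega) (by omega) (by omega) (by omega)
      · exact absurd ⟨e, by omega⟩ hc
      · exact sharedEnd h (by omega) (by omega) (by omega) (by omega)
      · exact absurd ⟨e, by omega⟩ h1
      · exact sharedEnd h (by omega) (by omega) (by omega) (by omega)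
  · rintro (⟨h1, h2⟩ | ⟨h1, h2⟩)
    · refine ⟨by omega, ?_⟩
      rcases h2 with h2 | h2
      · exact Or.inr (Or.inr (Or.inl (Or.inl ⟨h1, h2⟩)))
      · exact Or.inr (Or.inl (Or.inl ⟨h1, h2.symm⟩))
    · refine ⟨h1, ?_⟩
      rcases h2 with h2 | h2 | h2 | h2
      · exact Or.inl (Or.inr (Or.inl (Or.inl h2)))
      · exact Or.inr (Or.inl (Or.inr (Or.inl (Or.inr ⟨h2.1, by omega, h2.2.2⟩))))
      · exact Or.inr (Or.inr (Or.inl (Or.inr (Or.inr (Or.inl ⟨by omega, h2.2.1, h2.2.2⟩)))))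
      · exact Or.inr (Or.inr (Or.inr (Or.inr (Or.inr (Or.inr ⟨by omega, by omega, h2.2.2⟩)))))

/-! ### Colour systems on the ends of a prism -/

section Triangle

variable {C : Type*} {R₁ R₂ R₃ : C → Prop} {P : C → C → C → Prop} {c : C}

/-- Colour triples of a triangle with lists `R₁`, `R₂`, `R₃`, closed under moves that keep some
colour, among which the first vertex never gets the available colour `c`. -/
structure StuckTriangle (R₁ R₂ R₃ : C → Prop) (P : C → C → C → Prop) (c : C) : Prop where
  two₂ : ∀ x, ∃ y, y ≠ x ∧ R₂ y
  two₃ : ∀ x, ∃ y, y ≠ x ∧ R₃ y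
  val : ∀ {a b d}, P a b d → R₁ a ∧ R₂ b ∧ R₃ d ∧ a ≠ b ∧ a ≠ d ∧ b ≠ d
  closed : ∀ {a b d a' b' d'}, P a b d → R₁ a' → R₂ b' → R₃ d' → a' ≠ b' → a' ≠ d' → b' ≠ d' →
    (a = a' ∨ b = b' ∨ d = d') → P a' b' d'
  avail : R₁ c
  avoid : ∀ {a b d}, P a b d → a ≠ c

theorem StuckTriangle.swap (h : StuckTriangle R₁ R₂ R₃ P c) :
    StuckTriangle R₁ R₃ R₂ (fun a b d => P a d b) c where
  two₂ := h.two₃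
  two₃ := h.two₂
  val := fun hp => by
    have := h.val hp
    grind
  closed := fun hp h1 h2 h3 h4 h5 h6 h7 =>
    h.closed hp h1 h3 h2 h5 h4 h6.symm (by tauto)
  avail := h.avail
  avoid := fun hp => h.avoid hp

/-- Otherwise the first vertex could take `c` while the other two keep their colours. -/
theorem StuckTriangle.used (h : StuckTriangle R₁ R₂ R₃ P c) {a b d : C} (hp : P a b d) :
    b = c ∨ d = c := by
  by_contra hcon
  push Not at hcon
  have := h.val hp
  exact h.avoid (h.closed hp h.avail this.2.1 this.2.2.1 hcon.1.symm hcon.2.symm this.2.2.2.2.2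
    (Or.inr (Or.inl rfl))) rfl

/-- With any colour other than `c` and `d`, the second vertex would release `c` to the first while
the third keeps `d`. Since a colour other than `c` is available, `d` must be. -/
theorem StuckTriangle.second (h : StuckTriangle R₁ R₂ R₃ P c) {a d : C} (hp : P a c d) (x : C) :
    R₂ x ↔ x = c ∨ x = d := by
  have hv := h.val hp
  have key : ∀ x, R₂ x → x = c ∨ x = d := by
    intro x hx
    by_contra hcon
    push Not at hcon
    exact h.avoid (h.closed hp h.avail hx hv.2.2.1 hcon.1.symm hv.2.2.2.2.2 hcon.2
      (Or.inr (Or.inr rfl))) rfl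
  obtain ⟨y, hy, hy2⟩ := h.two₂ c
  have := key y hy2
  refine ⟨key x, ?_⟩
  rintro (rfl | rfl)
  · exact hv.2.1
  · have : y = x := by tauto
    exact this ▸ hy2

/-- If `c` is available at the third vertex, exchange the second and third colours and apply
`StuckTriangle.second` there. If not, only `d` and `a` remain at the third vertex, and a further
colour at the first would contradict the lists already found. -/
theorem StuckTriangle.dichotomy (h : StuckTriangle R₁ R₂ R₃ P c) {a d : C} (hp : P a c d) :
    (∀ x, R₃ x ↔ x = c ∨ x = d) ∨
      (∀ x, R₃ x ↔ x = d ∨ x = a) ∧ ∀ x, R₁ x ↔ x = a ∨ x = c := by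
  have hsub : ∀ {a d}, P a c d → ∀ y, R₃ y → y = d ∨ y = c ∨ y = a := by
    intro a d hp y hy
    have hv := h.val hp
    by_contra hcon
    push Not at hcon
    have hp' := h.closed hp hv.1 hv.2.1 hy hv.2.2.2.1 hcon.2.2.symm hcon.2.1.symm (Or.inl rfl)
    have h2 := (h.second hp' d).1 ((h.second hp d).2 (Or.inr rfl))
    grind
  have hv := h.val hp
  have hd2 : R₂ d := (h.second hp d).2 (Or.inr rfl)
  by_cases hc : R₃ c
  · left
    have hp' := h.closed hp hv.1 hd2 hc hv.2.2.2.2.1 hv.2.2.2.1 hv.2.2.2.2.2.symm (Or.inl rfl)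
    exact fun x => h.swap.second hp' x
  · right
    obtain ⟨y, hy, hy3⟩ := h.two₃ d
    have hya : y = a := by
      have := hsub hp y hy3
      grind
    subst hya
    refine ⟨fun x => ⟨fun hx => ?_, ?_⟩, fun x => ⟨fun hx => ?_, ?_⟩⟩
    · have := hsub hp x hx
      grind
    · rintro (rfl | rfl)
      · exact hv.2.2.1
      · exact hy3
    · by_contra hcon
      push Not at hcon
      by_cases hxd : x = d
      · subst hxd
        have hp' := h.closed hp hx hv.2.1 hy3 hv.2.2.2.2.2.symm hy.symm hv.2.2.2.1.symm
          (Or.inr (Or.inl rfl))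
        have := (h.second hp' x).1 hd2
        grind
      · have hp' := h.closed hp hx hv.2.1 hv.2.2.1 hcon.2 hxd hv.2.2.2.2.2 (Or.inr (Or.inl rfl))
        have := hsub hp' y hy3
        grind
    · rintro (rfl | rfl)
      · exact hv.1
      · exact h.avail

end Triangle

/-! ### Stuck classes of end colours in a prism do not exist. -/

/-- Colours of the six triangle vertices of a prism: `A i`, `B i` are the lists at the two ends
of path `i`, and `X i x y` holds if `x`, `y` extend to the interior of path `i`. -/
structure EndLists (C : Type*) where
  (A₁ A₂ A₃ B₁ B₂ B₃ : Finset C)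
  (X₁ X₂ X₃ : C → C → Prop)

/-- The six colours extend to a colouring of the prism. -/
def EndLists.Valid {C : Type*} (S : EndLists C) (a₁ a₂ a₃ b₁ b₂ b₃ : C) : Prop :=
  (a₁ ∈ S.A₁ ∧ a₂ ∈ S.A₂ ∧ a₃ ∈ S.A₃ ∧ a₁ ≠ a₂ ∧ a₁ ≠ a₃ ∧ a₂ ≠ a₃) ∧
  (b₁ ∈ S.B₁ ∧ b₂ ∈ S.B₂ ∧ b₃ ∈ S.B₃ ∧ b₁ ≠ b₂ ∧ b₁ ≠ b₃ ∧ b₂ ≠ b₃) ∧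
  S.X₁ a₁ b₁ ∧ S.X₂ a₂ b₂ ∧ S.X₃ a₃ b₃

/-- Every colour at one end excludes at most one colour at the other end. -/
def IsMatching {C : Type*} (X : C → C → Prop) : Prop :=
  (∀ x y y', ¬ X x y → ¬ X x y' → y = y') ∧ ∀ x x' y, ¬ X x y → ¬ X x' y → x = x'

theorem exists_ne_mem_of_card {C : Type*} {A : Finset C} (hA : A.card = 3) {Y : C → Prop}
    (hY : ∀ x x', ¬ Y x → ¬ Y x' → x = x') (z : C) : ∃ y, y ≠ z ∧ y ∈ A ∧ Y y := by
  classical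
  obtain ⟨u, hu, v, hv, huv⟩ := Finset.one_lt_card.1
    (show 1 < (A.erase z).card by have := Finset.pred_card_le_card_erase (s := A) (a := z); omega)
  rw [Finset.mem_erase] at hu hv
  by_cases h : Y u
  · exact ⟨u, hu.1, hu.2, h⟩
  · exact ⟨v, hv.1, hv.2, by_contra fun h' => huv (hY u v h h')⟩

theorem exists_third_mem {C : Type*} {A : Finset C} (hA : A.card = 3) (x y : C) :
    ∃ m ∈ A, m ≠ x ∧ m ≠ y := by
  classical
  obtain ⟨m, hm⟩ : ((A.erase x).erase y).Nonempty := by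
    rw [← Finset.card_pos]
    have h1 := Finset.pred_card_le_card_erase (s := A) (a := x)
    have h2 := Finset.pred_card_le_card_erase (s := A.erase x) (a := y)
    omega
  rw [Finset.mem_erase, Finset.mem_erase] at hm
  exact ⟨m, hm.2.2, hm.2.1, hm.1⟩

/-- A class of end colours of a prism that is closed under the moves available in every prism and
avoids the colours `c` and `c'`, which are unrestricted along the first path. -/
structure StuckPrism {C : Type*} (S : EndLists C) (P : C → C → C → C → C → C → Prop)
    (c c' : C) : Prop where
  cardA₁ : S.A₁.card = 3
  cardA₂ : S.A₂.card = 3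
  cardA₃ : S.A₃.card = 3
  cardB₁ : S.B₁.card = 3
  cardB₂ : S.B₂.card = 3
  cardB₃ : S.B₃.card = 3
  mX₁ : IsMatching S.X₁
  mX₂ : IsMatching S.X₂
  mX₃ : IsMatching S.X₃
  memc : c ∈ S.A₁
  memc' : c' ∈ S.B₁
  freec : ∀ y, S.X₁ c y
  freec' : ∀ x, S.X₁ x c'
  val : ∀ {a₁ a₂ a₃ b₁ b₂ b₃}, P a₁ a₂ a₃ b₁ b₂ b₃ → S.Valid a₁ a₂ a₃ b₁ b₂ b₃
  closed : ∀ {a₁ a₂ a₃ b₁ b₂ b₃ x₁ x₂ x₃ y₁ y₂ y₃}, P a₁ a₂ a₃ b₁ b₂ b₃ →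
    S.Valid x₁ x₂ x₃ y₁ y₂ y₃ → ((a₁ = x₁ ∧ (b₂ = y₂ ∨ b₃ = y₃)) ∨
      (a₂ = x₂ ∧ (b₁ = y₁ ∨ b₃ = y₃)) ∨ (a₃ = x₃ ∧ (b₁ = y₁ ∨ b₂ = y₂))) →
    P x₁ x₂ x₃ y₁ y₂ y₃
  avoid : ∀ {a₁ a₂ a₃ b₁ b₂ b₃}, P a₁ a₂ a₃ b₁ b₂ b₃ → a₁ ≠ c
  avoid' : ∀ {a₁ a₂ a₃ b₁ b₂ b₃}, P a₁ a₂ a₃ b₁ b₂ b₃ → b₁ ≠ c'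
  slide₂ : ∀ {a₁ a₂ a₃ b₁ b₂ b₃ x₃ y₃}, P a₁ a₂ a₃ b₁ b₂ b₃ → ¬ S.Valid c a₂ x₃ c' b₂ y₃
  slide₃ : ∀ {a₁ a₂ a₃ b₁ b₂ b₃ x₂ y₂}, P a₁ a₂ a₃ b₁ b₂ b₃ → ¬ S.Valid c x₂ a₃ c' y₂ b₃

namespace StuckPrism

variable {C : Type*} {S : EndLists C} {P : C → C → C → C → C → C → Prop} {c c' : C}

/-- This symmetry and `swapEnds` reduce the possible positions of `c` and `c'` to two. -/
theorem swapPaths (h : StuckPrism S P c c') :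
    StuckPrism ⟨S.A₁, S.A₃, S.A₂, S.B₁, S.B₃, S.B₂, S.X₁, S.X₃, S.X₂⟩
      (fun a₁ a₂ a₃ b₁ b₂ b₃ => P a₁ a₃ a₂ b₁ b₃ b₂) c c' where
  cardA₁ := h.cardA₁
  cardA₂ := h.cardA₃
  cardA₃ := h.cardA₂
  cardB₁ := h.cardB₁
  cardB₂ := h.cardB₃
  cardB₃ := h.cardB₂
  mX₁ := h.mX₁
  mX₂ := h.mX₃
  mX₃ := h.mX₂
  memc := h.memc
  memc' := h.memc'
  freec := h.freec
  freec' := h.freec'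
  val := fun hp => by
    have := h.val hp
    simp only [EndLists.Valid] at this ⊢
    grind
  closed := fun hp hv hs => h.closed hp (by
    simp only [EndLists.Valid] at hv ⊢
    grind) (by tauto)
  avoid := fun hp => h.avoid hp
  avoid' := fun hp => h.avoid' hp
  slide₂ := fun {_ _ _ _ _ _ x₃ y₃} hp hv => h.slide₃ (x₂ := x₃) (y₂ := y₃) hp (by
    simp only [EndLists.Valid] at hv ⊢
    grind)
  slide₃ := fun {_ _ _ _ _ _ x₂ y₂} hp hv => h.slide₂ (x₃ := x₂) (y₃ := y₂) hp (by
    simp only [EndLists.Valid] at hv ⊢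
    grind)

theorem swapEnds (h : StuckPrism S P c c') :
    StuckPrism ⟨S.B₁, S.B₂, S.B₃, S.A₁, S.A₂, S.A₃, fun x y => S.X₁ y x, fun x y => S.X₂ y x,
      fun x y => S.X₃ y x⟩
      (fun a₁ a₂ a₃ b₁ b₂ b₃ => P b₁ b₂ b₃ a₁ a₂ a₃) c' c where
  cardA₁ := h.cardB₁
  cardA₂ := h.cardB₂
  cardA₃ := h.cardB₃
  cardB₁ := h.cardA₁
  cardB₂ := h.cardA₂
  cardB₃ := h.cardA₃
  mX₁ := ⟨fun x y y' h1 h2 => h.mX₁.2 _ _ _ h1 h2, fun x y y' h1 h2 => h.mX₁.1 _ _ _ h1 h2⟩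
  mX₂ := ⟨fun x y y' h1 h2 => h.mX₂.2 _ _ _ h1 h2, fun x y y' h1 h2 => h.mX₂.1 _ _ _ h1 h2⟩
  mX₃ := ⟨fun x y y' h1 h2 => h.mX₃.2 _ _ _ h1 h2, fun x y y' h1 h2 => h.mX₃.1 _ _ _ h1 h2⟩
  memc := h.memc'
  memc' := h.memc
  freec := h.freec'
  freec' := h.freec
  val := fun hp => ⟨(h.val hp).2.1, (h.val hp).1, (h.val hp).2.2⟩
  closed := fun hp hv hs => h.closed hp ⟨hv.2.1, hv.1, hv.2.2⟩ (by tauto)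
  avoid := fun hp => h.avoid' hp
  avoid' := fun hp => h.avoid hp
  slide₂ := fun hp hv => h.slide₂ hp ⟨hv.2.1, hv.1, hv.2.2⟩
  slide₃ := fun hp hv => h.slide₃ hp ⟨hv.2.1, hv.1, hv.2.2⟩

/-- With the last triangle fixed, a move that keeps one colour of the first triangle also keeps a
colour at the last end of another path, so it is among the moves of the prism. -/
theorem triangle (h : StuckPrism S P c c') {b₁ b₂ b₃ : C} :
    StuckTriangle (fun x => x ∈ S.A₁ ∧ S.X₁ x b₁) (fun x => x ∈ S.A₂ ∧ S.X₂ x b₂)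
      (fun x => x ∈ S.A₃ ∧ S.X₃ x b₃) (fun a₁ a₂ a₃ => P a₁ a₂ a₃ b₁ b₂ b₃) c where
  two₂ := exists_ne_mem_of_card h.cardA₂ fun x x' => h.mX₂.2 x x' b₂
  two₃ := exists_ne_mem_of_card h.cardA₃ fun x x' => h.mX₃.2 x x' b₃
  val := fun hp => by
    have := h.val hp
    simp only [EndLists.Valid] at this
    tauto
  closed := fun hp h1 h2 h3 h4 h5 h6 hs => by
    have := h.val hp
    exact h.closed hp ⟨⟨h1.1, h2.1, h3.1, h4, h5, h6⟩, this.2.1, h1.2, h2.2, h3.2⟩ (by tauto)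
  avail := ⟨h.memc, h.freec _⟩
  avoid := fun hp => h.avoid hp

variable {a₁ a₂ a₃ b₁ b₂ b₃ : C}

/-- Exchanging the second and third colours of the first triangle would stay in the class. At the
last triangle, the path that carries `c'` would then forbid its remaining colour for two different
colours at the first end, which a matching does not allow. -/
theorem not_dichotomy_left (h : StuckPrism S P c c') (hp : P a₁ c a₃ b₁ b₂ b₃)
    (hA : ∀ x, x ∈ S.A₃ ∧ S.X₃ x b₃ ↔ x = c ∨ x = a₃) : False := by
  have hv := h.val hp
  have h2 := h.triangle.second hp
  simp only [EndLists.Valid] at hv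
  have hc3 := (hA c).2 (Or.inl rfl)
  have ha2 := (h2 a₃).2 (Or.inr rfl)
  have hp' : P a₁ a₃ c b₁ b₂ b₃ := h.closed hp ⟨⟨hv.1.1, ha2.1, hc3.1, by grind⟩, hv.2.1,
    hv.2.2.1, ha2.2, hc3.2⟩ (by tauto)
  rcases h.swapEnds.triangle.used hp with rfl | rfl
  · have k := h.swapEnds.triangle.second hp
    have k' := h.swapEnds.triangle.second hp'
    obtain ⟨n, hn, hn1, hn2⟩ := exists_third_mem h.cardB₂ b₂ b₃
    have e1 : ¬ S.X₂ c n := fun hx => by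
      have := (k n).1 ⟨hn, hx⟩
      tauto
    have e2 : ¬ S.X₂ a₃ n := fun hx => by
      have := (k' n).1 ⟨hn, hx⟩
      tauto
    exact hv.1.2.2.2.2.2 (h.mX₂.2 _ _ _ e1 e2)
  · have k := h.swapPaths.swapEnds.triangle.second hp
    have k' := h.swapPaths.swapEnds.triangle.second hp'
    obtain ⟨n, hn, hn1, hn2⟩ := exists_third_mem h.cardB₃ b₃ b₂
    have e1 : ¬ S.X₃ a₃ n := fun hx => by
      have := (k n).1 ⟨hn, hx⟩
      tauto
    have e2 : ¬ S.X₃ c n := fun hx => by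
      have := (k' n).1 ⟨hn, hx⟩
      tauto
    exact hv.1.2.2.2.2.2 (h.mX₃.2 _ _ _ e2 e1)

/-- Only the cyclic alternative of the dichotomy survives. -/
theorem rotation (h : StuckPrism S P c c') (hp : P a₁ c a₃ b₁ b₂ b₃) :
    (∀ x, x ∈ S.A₁ ∧ S.X₁ x b₁ ↔ x = a₁ ∨ x = c) ∧
    (∀ x, x ∈ S.A₂ ∧ S.X₂ x b₂ ↔ x = c ∨ x = a₃) ∧
    (∀ x, x ∈ S.A₃ ∧ S.X₃ x b₃ ↔ x = a₃ ∨ x = a₁) := by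
  rcases h.triangle.dichotomy hp with hA | ⟨h3, h1⟩
  · exact (h.not_dichotomy_left hp hA).elim
  · exact ⟨h1, h.triangle.second hp, h3⟩

/-- Moving the ends of the second path to their remaining colours `m`, `n` keeps `a₃` and `b₁` and
would give `c` to the first path. The only possible obstacle is a clash of `n` with `b₁`. -/
theorem second_eq_of_rotation (h : StuckPrism S P c c') (hp : P a₁ c a₃ b₁ c' b₃) :
    ∃ n ∈ S.B₂, n ≠ c' ∧ n ≠ b₃ ∧ ¬ S.X₂ c n ∧ n = b₁ := by
  have hv := h.val hp
  simp only [EndLists.Valid] at hv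
  obtain ⟨r1, r2, r3⟩ := h.rotation hp
  obtain ⟨q1, q2, q3⟩ := h.swapEnds.rotation hp
  simp only at q1 q2 q3
  obtain ⟨n, hn, hn1, hn2⟩ := exists_third_mem h.cardB₂ c' b₃
  have hXn : ¬ S.X₂ c n := fun hx => by
    have := (q2 n).1 ⟨hn, hx⟩
    tauto
  refine ⟨n, hn, hn1, hn2, hXn, ?_⟩
  by_contra hne
  obtain ⟨m, hm, hm1, hm2⟩ := exists_third_mem h.cardA₂ c a₃
  have hmn : S.X₂ m n := by
    by_contra hx
    exact hm1 (h.mX₂.2 _ _ _ hx hXn)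
  have hval : S.Valid c m a₃ b₁ n b₃ :=
    ⟨⟨h.memc, hm, hv.1.2.2.1, hm1.symm, hv.1.2.2.2.2.2, hm2⟩,
      ⟨hv.2.1.1, hn, hv.2.1.2.2.1, Ne.symm hne, hv.2.1.2.2.2.2.1, hn2⟩,
      h.freec _, hmn, hv.2.2.2.2⟩
  exact h.avoid (h.closed hp hval (by tauto)) rfl

/-- By `second_eq_of_rotation` at both ends, the remaining colours of the second path are those that
the first path has now. So the first path can move to `c`, `c'` and the second to these colours
while the third stays, which is a forbidden slide. -/
theorem not_aligned (h : StuckPrism S P c c') : ¬ P a₁ c a₃ b₁ c' b₃ := by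
  intro hp
  have hv := h.val hp
  simp only [EndLists.Valid] at hv
  obtain ⟨q1, q2, q3⟩ := h.swapEnds.rotation hp
  simp only at q1 q2 q3
  obtain ⟨n, hn, hn1, hn2, hXn, rfl⟩ := h.second_eq_of_rotation hp
  obtain ⟨m, hm, hm1, hm2, hXm, rfl⟩ := h.swapEnds.second_eq_of_rotation hp
  refine h.slide₃ (x₂ := m) (y₂ := n) hp
    ⟨⟨h.memc, hm, hv.1.2.2.1, hm1.symm, hv.1.2.2.2.2.2, hm2⟩,
      ⟨h.memc', hn, hv.2.1.2.2.1, hn1.symm, hv.2.1.2.2.2.2.2, hn2⟩, h.freec _, ?_, hv.2.2.2.2⟩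
  by_contra hx
  exact hm1 (h.mX₂.2 _ _ _ hx hXn)

/-- By rotation the second path can take `a₃` at its first end, while the third path takes remaining
colours `m`, `n`. If `n = b₁`, then `c'` can pass to the first path; otherwise `c'` disappears from
the last triangle. Neither is possible in a stuck class. -/
theorem not_opposed (h : StuckPrism S P c c') : ¬ P a₁ c a₃ b₁ b₂ c' := by
  intro hp
  have hv := h.val hp
  simp only [EndLists.Valid] at hv
  obtain ⟨r1, r2, r3⟩ := h.rotation hp
  obtain ⟨q1, q3, q2⟩ := h.swapPaths.swapEnds.rotation hp
  simp only at q1 q2 q3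
  obtain ⟨m, hm, hm1, hm2⟩ := exists_third_mem h.cardA₃ a₃ a₁
  obtain ⟨n, hn, hn1, hn2⟩ := exists_third_mem h.cardB₃ c' b₂
  have hXn : ¬ S.X₃ a₃ n := fun hx => by
    have := (q3 n).1 ⟨hn, hx⟩
    tauto
  have hmn : S.X₃ m n := by
    by_contra hx
    exact hm1 (h.mX₃.2 _ _ _ hx hXn)
  have ha2 := (r2 a₃).2 (Or.inr rfl)
  by_cases hnb : n = b₁
  · subst hnb
    have hc1 := (q1 c').2 (Or.inr rfl)
    have hval : S.Valid a₁ a₃ m c' b₂ n :=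
      ⟨⟨hv.1.1, ha2.1, hm, hv.1.2.2.2.2.1, hm2.symm, hm1.symm⟩,
        ⟨hc1.1, hv.2.1.2.1, hn, hv.2.1.2.2.2.2.2.symm, hn1.symm, hn2.symm⟩,
        hc1.2, ha2.2, hmn⟩
    exact h.avoid' (h.closed hp hval (by tauto)) rfl
  · have hval : S.Valid a₁ a₃ m b₁ b₂ n :=
      ⟨⟨hv.1.1, ha2.1, hm, hv.1.2.2.2.2.1, hm2.symm, hm1.symm⟩,
        ⟨hv.2.1.1, hv.2.1.2.1, hn, hv.2.1.2.2.2.1, Ne.symm hnb, hn2.symm⟩,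
        hv.2.2.1, ha2.2, hmn⟩
    have hp' := h.closed hp hval (by tauto)
    rcases h.swapEnds.triangle.used hp' with hu | hu
    · exact hv.2.1.2.2.2.2.2 hu
    · exact hn1 hu

/-- Each of `c`, `c'` sits on the second or third path, and the two sit on the same path or on
different ones. -/
theorem elim (h : StuckPrism S P c c') : ¬ P a₁ a₂ a₃ b₁ b₂ b₃ := by
  intro hp
  rcases h.triangle.used hp with rfl | rfl <;> rcases h.swapEnds.triangle.used hp with rfl | rfl
  · exact h.not_aligned hp
  · exact h.not_opposed hp
  · exact h.swapPaths.not_opposed hp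
  · exact h.swapPaths.not_aligned hp

end StuckPrism

/-! ### Linking the free colours at the ends of a prism. -/

section PrismRelation

variable {C : Type*}

/-- The colours `α i`, `β i` at the two ends of path `i` extend to a colouring of the prism. -/
def ValidEnds (A B : Fin 3 → Finset C) (X : Fin 3 → C → C → Prop) (α β : Fin 3 → C) : Prop :=
  (∀ i, α i ∈ A i) ∧ (∀ i, β i ∈ B i) ∧ (∀ i j, i ≠ j → α i ≠ α j) ∧ (∀ i j, i ≠ j → β i ≠ β j) ∧
    ∀ i, X i (α i) (β i)

/-- An equivalence relation on end colours of a prism that contains the moves available in every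
prism; `GA i`, `GB i` are the colours that are unrestricted along path `i`. -/
structure PrismRelation (A B : Fin 3 → Finset C) (X : Fin 3 → C → C → Prop)
    (GA GB : Fin 3 → C → Prop) (E : (Fin 3 → C) → (Fin 3 → C) → (Fin 3 → C) → (Fin 3 → C) → Prop) :
    Prop where
  cardA : ∀ i, (A i).card = 3
  cardB : ∀ i, (B i).card = 3
  matching : ∀ i, IsMatching (X i)
  symm : ∀ {α β α' β'}, E α β α' β' → E α' β' α β
  trans : ∀ {α β α' β' α'' β''}, ValidEnds A B X α' β' → E α β α' β' → E α' β' α'' β'' →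
    E α β α'' β''
  cross : ∀ {α β α' β'} (k l), ValidEnds A B X α β → ValidEnds A B X α' β' → k ≠ l →
    α k = α' k → β l = β' l → E α β α' β'
  memA : ∀ {k c}, GA k c → c ∈ A k
  memB : ∀ {k c}, GB k c → c ∈ B k
  freeA : ∀ {k c}, GA k c → ∀ y, X k c y
  freeB : ∀ {k c}, GB k c → ∀ x, X k x c
  fixA : ∀ {α β α' β' k}, ValidEnds A B X α β → ValidEnds A B X α' β' → GA k (α k) →
    α k = α' k → E α β α' β'
  fixB : ∀ {α β α' β' k}, ValidEnds A B X α β → ValidEnds A B X α' β' → GB k (β k) →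
    β k = β' k → E α β α' β'
  slide : ∀ {α β α' β' k r c c' x y}, ValidEnds A B X α β → ValidEnds A B X α' β' → GA k c →
    GB k c' → r ≠ k → α r = α' r → β r = β' r → X k x y → (α k = x ∨ α k = c) →
    (α' k = x ∨ α' k = c) → (β k = y ∨ β k = c') → (β' k = y ∨ β' k = c') → E α β α' β'
  cases : ∀ k, ((∃ c, GA k c) ∧ ∃ c', GB k c') ∨ ∀ x y, X k x y ↔ x ≠ y

/-- The function on `Fin 3` with value `a` at `k`, `b` at `i` and `d` elsewhere. -/
def triple (k i : Fin 3) (a b d : C) : Fin 3 → C := fun x => if x = k then a else if x = i then b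
  else d

theorem fin_three_cases {k i j : Fin 3} (hki : k ≠ i) (hkj : k ≠ j) (hij : i ≠ j) (x : Fin 3) :
    x = k ∨ x = i ∨ x = j := by omega

theorem exists_other_two : ∀ k : Fin 3, ∃ i j : Fin 3, k ≠ i ∧ k ≠ j ∧ i ≠ j := by decide

theorem exists_other : ∀ k l : Fin 3, ∃ m : Fin 3, k ≠ m ∧ l ≠ m := by decide

/-- Translates between families over `Fin 3` and six named colours, with a distinguished path `k`
first. -/
theorem validEnds_triple {A B : Fin 3 → Finset C} {X : Fin 3 → C → C → Prop} {k i j : Fin 3}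
    (hki : k ≠ i) (hkj : k ≠ j) (hij : i ≠ j) {a₁ a₂ a₃ b₁ b₂ b₃ : C} :
    ValidEnds A B X (triple k i a₁ a₂ a₃) (triple k i b₁ b₂ b₃) ↔
      EndLists.Valid ⟨A k, A i, A j, B k, B i, B j, X k, X i, X j⟩ a₁ a₂ a₃ b₁ b₂ b₃ := by
  have hk : ∀ a b d : C, triple k i a b d k = a := fun a b d => by simp [triple]
  have hi : ∀ a b d : C, triple k i a b d i = b := fun a b d => by simp [triple, hki.symm]
  have hj : ∀ a b d : C, triple k i a b d j = d := fun a b d => by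
    simp [triple, hkj.symm, hij.symm]
  constructor
  · rintro ⟨h1, h2, h3, h4, h5⟩
    refine ⟨⟨?_, ?_, ?_, ?_, ?_, ?_⟩, ⟨?_, ?_, ?_, ?_, ?_, ?_⟩, ?_, ?_, ?_⟩
    · simpa [hk] using h1 k
    · simpa [hi] using h1 i
    · simpa [hj] using h1 j
    · simpa [hk, hi] using h3 k i hki
    · simpa [hk, hj] using h3 k j hkj
    · simpa [hi, hj] using h3 i j hij
    · simpa [hk] using h2 k
    · simpa [hi] using h2 i
    · simpa [hj] using h2 j
    · simpa [hk, hi] using h4 k i hki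
    · simpa [hk, hj] using h4 k j hkj
    · simpa [hi, hj] using h4 i j hij
    · simpa [hk] using h5 k
    · simpa [hi] using h5 i
    · simpa [hj] using h5 j
  · rintro ⟨⟨h1, h2, h3, h4, h5, h6⟩, ⟨g1, g2, g3, g4, g5, g6⟩, x1, x2, x3⟩
    refine ⟨fun x => ?_, fun x => ?_, fun x y hxy => ?_, fun x y hxy => ?_, fun x => ?_⟩
    · rcases fin_three_cases hki hkj hij x with rfl | rfl | rfl <;> simpa [hk, hi, hj]
    · rcases fin_three_cases hki hkj hij x with rfl | rfl | rfl <;> simpa [hk, hi, hj]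
    · rcases fin_three_cases hki hkj hij x with rfl | rfl | rfl <;>
        rcases fin_three_cases hki hkj hij y with rfl | rfl | rfl <;>
        first | exact absurd rfl hxy | simpa [hk, hi, hj] | (simp only [hk, hi, hj]; exact Ne.symm ‹_›)
    · rcases fin_three_cases hki hkj hij x with rfl | rfl | rfl <;>
        rcases fin_three_cases hki hkj hij y with rfl | rfl | rfl <;>
        first | exact absurd rfl hxy | simpa [hk, hi, hj] | (simp only [hk, hi, hj]; exact Ne.symm ‹_›)
    · rcases fin_three_cases hki hkj hij x with rfl | rfl | rfl <;> simpa [hk, hi, hj]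

theorem eq_triple {k i j : Fin 3} (hki : k ≠ i) (hkj : k ≠ j) (hij : i ≠ j) (α : Fin 3 → C) :
    α = triple k i (α k) (α i) (α j) := by
  funext x
  rcases fin_three_cases hki hkj hij x with rfl | rfl | rfl
  · simp [triple]
  · simp [triple, hki.symm]
  · simp [triple, hkj.symm, hij.symm]

theorem exists_two_mem {A : Finset C} (hA : A.card = 3) (c : C) :
    ∃ u u', u ≠ u' ∧ u ∈ A ∧ u' ∈ A ∧ u ≠ c ∧ u' ≠ c := by
  obtain ⟨u, hu, huc, -⟩ := exists_third_mem hA c c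
  obtain ⟨u', hu', huc', hne⟩ := exists_third_mem hA c u
  exact ⟨u, u', hne.symm, hu, hu', huc, huc'⟩

theorem mem_iff_of_card_three {A : Finset C} (hA : A.card = 3) {a b d : C} (ha : a ∈ A)
    (hb : b ∈ A) (hd : d ∈ A) (hab : a ≠ b) (had : a ≠ d) (hbd : b ≠ d) (x : C) :
    x ∈ A ↔ x = a ∨ x = b ∨ x = d := by
  classical
  have h1 : ({a, b, d} : Finset C) ⊆ A := by
    intro y hy
    simp only [Finset.mem_insert, Finset.mem_singleton] at hy
    rcases hy with rfl | rfl | rfl <;> assumption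
  have h2 : ({a, b, d} : Finset C).card = 3 := Finset.card_eq_three.2 ⟨a, b, d, hab, had, hbd, rfl⟩
  have := Finset.eq_of_subset_of_card_le h1 (by omega)
  rw [← this]
  simp

/-- Two 2-element lists at each end of two disjoint paths whose ends are joined: if there is no
common extension, then the paths exclude complementary perfect matchings. -/
theorem exclusion_of_no_extension {A A' B B' : Finset C} {X X' : C → C → Prop} {c c' : C}
    (hA : A.card = 3) (hA' : A'.card = 3) (hB : B.card = 3) (hB' : B'.card = 3)
    (hX : IsMatching X) (hX' : IsMatching X')
    (h : ∀ x y z w, x ∈ A → y ∈ A' → z ∈ B → w ∈ B' → x ≠ c → y ≠ c → z ≠ c' → w ≠ c' → x ≠ y →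
      z ≠ w → X x z → X' y w → False) :
    ∃ s t p q, s ≠ t ∧ p ≠ q ∧ (s ≠ c ∧ t ≠ c ∧ p ≠ c' ∧ q ≠ c') ∧
      (s ∈ A ∧ t ∈ A ∧ s ∈ A' ∧ t ∈ A') ∧ (p ∈ B ∧ q ∈ B ∧ p ∈ B' ∧ q ∈ B') ∧
      ¬ X s p ∧ ¬ X t q ∧ ¬ X' s q ∧ ¬ X' t p := by
  have choose : ∀ {D : Finset C} {Y : C → Prop}, D.card = 3 → (∀ x x', ¬ Y x → ¬ Y x' → x = x') →
      ∀ z, ∃ y ∈ D, y ≠ z ∧ Y y := by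
    intro D Y hD hY z
    obtain ⟨y, h1, h2, h3⟩ := exists_ne_mem_of_card hD hY z
    exact ⟨y, h2, h1, h3⟩
  -- A colour `u` outside `A'` can never clash with a colour of `A'`, so the other three colours can
  -- be chosen greedily, each path forbidding at most one option.
  have sA : ∀ u ∈ A, u ≠ c → u ∈ A' := by
    intro u hu huc
    by_contra hu'
    obtain ⟨z, hz, hzc, hX1⟩ := choose hB (fun _ _ => hX.1 u _ _) c'
    obtain ⟨w, hw, hwc, hwz⟩ := exists_third_mem hB' c' z
    obtain ⟨y, hy, hyc, hX2⟩ := choose hA' (fun _ _ => hX'.2 _ _ w) c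
    exact h u y z w hu hy hz hw huc hyc hzc hwc (fun e => hu' (e ▸ hy)) hwz.symm hX1 hX2
  have sA' : ∀ u ∈ A', u ≠ c → u ∈ A := by
    intro u hu huc
    by_contra hu'
    obtain ⟨z, hz, hzc, hX1⟩ := choose hB' (fun _ _ => hX'.1 u _ _) c'
    obtain ⟨w, hw, hwc, hwz⟩ := exists_third_mem hB c' z
    obtain ⟨y, hy, hyc, hX2⟩ := choose hA (fun _ _ => hX.2 _ _ w) c
    exact h y u w z hy hu hw hz hyc huc hwc hzc (fun e => hu' (e ▸ hy)) hwz hX2 hX1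
  have sB : ∀ u ∈ B, u ≠ c' → u ∈ B' := by
    intro u hu huc
    by_contra hu'
    obtain ⟨z, hz, hzc, hX1⟩ := choose hA (fun _ _ => hX.2 _ _ u) c
    obtain ⟨w, hw, hwc, hwz⟩ := exists_third_mem hA' c z
    obtain ⟨y, hy, hyc, hX2⟩ := choose hB' (fun _ _ => hX'.1 w _ _) c'
    exact h z w u y hz hw hu hy hzc hwc huc hyc hwz.symm (fun e => hu' (e ▸ hy)) hX1 hX2
  obtain ⟨s, t, hst, hs, ht, hsc, htc⟩ := exists_two_mem hA c
  obtain ⟨p, q, hpq, hp, hq, hpc, hqc⟩ := exists_two_mem hB c'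
  have hs' := sA s hs hsc
  have ht' := sA t ht htc
  have hp' := sB p hp hpc
  have hq' := sB q hq hqc
  have e1 := h s t p q hs ht' hp hq' hsc htc hpc hqc hst hpq
  have e2 := h s t q p hs ht' hq hp' hsc htc hqc hpc hst hpq.symm
  have e3 := h t s p q ht hs' hp hq' htc hsc hpc hqc hst.symm hpq
  have e4 := h t s q p ht hs' hq hp' htc hsc hqc hpc hst.symm hpq.symm
  -- All four ways to distribute `s`, `t` and `p`, `q` fail. As each path forbids only a matching,
  -- one path forbids one perfect matching and the other its complement.
  by_cases hx : X s p
  · have k1 : ¬ X' t q := e1 hx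
    have k2 : X' s q := by_contra fun h0 => hst (hX'.2 _ _ _ h0 k1)
    have k3 : X' t p := by_contra fun h0 => hpq (hX'.1 _ _ _ h0 k1)
    have k4 : ¬ X s q := fun h0 => e2 h0 k3
    have k5 : ¬ X t p := fun h0 => e3 h0 k2
    have k6 : X t q := by_contra fun h0 => hpq (hX.1 _ _ _ k5 h0)
    exact ⟨s, t, q, p, hst, hpq.symm, ⟨hsc, htc, hqc, hpc⟩, ⟨hs, ht, hs', ht'⟩,
      ⟨hq, hp, hq', hp'⟩, k4, k5, e4 k6, k1⟩
  · have k1 : X s q := by_contra fun h0 => hpq (hX.1 _ _ _ hx h0)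
    have k2 : X t p := by_contra fun h0 => hst (hX.2 _ _ _ hx h0)
    have k3 : ¬ X' t p := e2 k1
    have k4 : ¬ X' s q := e3 k2
    have k5 : X' s p := by_contra fun h0 => hpq (hX'.1 _ _ _ h0 k4)
    exact ⟨s, t, p, q, hst, hpq, ⟨hsc, htc, hpc, hqc⟩, ⟨hs, ht, hs', ht'⟩,
      ⟨hp, hq, hp', hq'⟩, hx, fun h0 => e4 h0 k5, k4, k3⟩

/-- If one of the lists lacked `c` or `c'`, it would have a third admissible colour. The path
already excludes the relevant opposite colour once, so this third colour would give an extension. -/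
theorem mem_of_exclusion {A A' B B' : Finset C} {X X' : C → C → Prop} {c c' s t p q : C}
    (hA : A.card = 3) (hA' : A'.card = 3) (hB : B.card = 3) (hB' : B'.card = 3)
    (hX : IsMatching X) (hX' : IsMatching X')
    (h : ∀ x y z w, x ∈ A → y ∈ A' → z ∈ B → w ∈ B' → x ≠ c → y ≠ c → z ≠ c' → w ≠ c' → x ≠ y →
      z ≠ w → X x z → X' y w → False)
    (hst : s ≠ t) (hpq : p ≠ q) (hne : s ≠ c ∧ t ≠ c ∧ p ≠ c' ∧ q ≠ c')
    (hs : s ∈ A ∧ t ∈ A ∧ s ∈ A' ∧ t ∈ A') (hp : p ∈ B ∧ q ∈ B ∧ p ∈ B' ∧ q ∈ B')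
    (h1 : ¬ X s p) (h3 : ¬ X' s q) (h4 : ¬ X' t p) :
    c ∈ A ∧ c ∈ A' ∧ c' ∈ B ∧ c' ∈ B' := by
  obtain ⟨hsA, htA, hsA', htA'⟩ := hs
  obtain ⟨hpB, hqB, hpB', hqB'⟩ := hp
  obtain ⟨hsc, htc, hpc, hqc⟩ := hne
  have k1 : X' t q := by_contra fun h0 => hpq (hX'.1 _ _ _ h4 h0)
  have k2 : X t p := by_contra fun h0 => hst (hX.2 _ _ _ h1 h0)
  refine ⟨?_, ?_, ?_, ?_⟩ <;> by_contra hc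
  · obtain ⟨u, hu, hus, hut⟩ := exists_third_mem hA s t
    exact h u t p q hu htA' hpB hqB' (fun e => hc (e ▸ hu)) htc hpc hqc hut hpq
      (by_contra fun h0 => hus (hX.2 _ _ _ h0 h1)) k1
  · obtain ⟨u, hu, hus, hut⟩ := exists_third_mem hA' s t
    exact h t u p q htA hu hpB hqB' htc (fun e => hc (e ▸ hu)) hpc hqc hut.symm hpq k2
      (by_contra fun h0 => hus (hX'.2 _ _ _ h0 h3))
  · obtain ⟨u, hu, hup, huq⟩ := exists_third_mem hB p q
    exact h s t u q hsA htA' hu hqB' hsc htc (fun e => hc (e ▸ hu)) hqc hst huq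
      (by_contra fun h0 => hup (hX.1 _ _ _ h0 h1)) k1
  · obtain ⟨u, hu, hup, huq⟩ := exists_third_mem hB' p q
    exact h t s p u htA hsA' hpB hu htc hsc hpc (fun e => hc (e ▸ hu)) hst.symm hup.symm k2
      (by_contra fun h0 => huq (hX'.1 _ _ _ h0 h3))

namespace PrismRelation

variable {A B : Fin 3 → Finset C} {X : Fin 3 → C → C → Prop} {GA GB : Fin 3 → C → Prop}
  {E : (Fin 3 → C) → (Fin 3 → C) → (Fin 3 → C) → (Fin 3 → C) → Prop}

/-- `Linked k l c c'`: colourings with colour `c` at the first end of path `k` are equivalent to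
those with colour `c'` at the last end of path `l`. -/
def Linked (A B : Fin 3 → Finset C) (X : Fin 3 → C → C → Prop)
    (E : (Fin 3 → C) → (Fin 3 → C) → (Fin 3 → C) → (Fin 3 → C) → Prop) (k l : Fin 3) (c c' : C) :
    Prop :=
  ∃ α β α' β', ValidEnds A B X α β ∧ ValidEnds A B X α' β' ∧ α k = c ∧ β' l = c' ∧ E α β α' β'

/-- Otherwise the end colours equivalent to the given ones form a stuck class, contrary to
`StuckPrism.elim`. -/
theorem reaches (h : PrismRelation A B X GA GB E) {k : Fin 3} {c c' : C} (hc : GA k c)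
    (hc' : GB k c') {α β : Fin 3 → C} (hv : ValidEnds A B X α β) :
    ∃ α' β', ValidEnds A B X α' β' ∧ (α' k = c ∨ β' k = c') ∧ E α β α' β' := by
  by_contra hcon
  push Not at hcon
  obtain ⟨i, j, hki, hkj, hij⟩ : ∃ i j : Fin 3, k ≠ i ∧ k ≠ j ∧ i ≠ j :=
    exists_other_two k
  have hk : ∀ a b d : C, triple k i a b d k = a := fun a b d => by simp [triple]
  have hi : ∀ a b d : C, triple k i a b d i = b := fun a b d => by simp [triple, hki.symm]
  have hj : ∀ a b d : C, triple k i a b d j = d := fun a b d => by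
    simp [triple, hkj.symm, hij.symm]
  let P : C → C → C → C → C → C → Prop := fun a₁ a₂ a₃ b₁ b₂ b₃ =>
    ValidEnds A B X (triple k i a₁ a₂ a₃) (triple k i b₁ b₂ b₃) ∧
      E α β (triple k i a₁ a₂ a₃) (triple k i b₁ b₂ b₃)
  have hP : StuckPrism ⟨A k, A i, A j, B k, B i, B j, X k, X i, X j⟩ P c c' := by
    refine ⟨h.cardA k, h.cardA i, h.cardA j, h.cardB k, h.cardB i, h.cardB j, h.matching k,
      h.matching i, h.matching j, h.memA hc, h.memB hc', h.freeA hc, h.freeB hc', ?_, ?_, ?_, ?_,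
      ?_, ?_⟩
    · exact fun hp => (validEnds_triple hki hkj hij).1 hp.1
    · intro a₁ a₂ a₃ b₁ b₂ b₃ x₁ x₂ x₃ y₁ y₂ y₃ hp hv' hs
      have hv' := (validEnds_triple hki hkj hij).2 hv'
      refine ⟨hv', h.trans hp.1 hp.2 ?_⟩
      rcases hs with ⟨h1, h2 | h2⟩ | ⟨h1, h2 | h2⟩ | ⟨h1, h2 | h2⟩
      · exact h.cross k i hp.1 hv' hki (by simpa [hk]) (by simpa [hi])
      · exact h.cross k j hp.1 hv' hkj (by simpa [hk]) (by simpa [hj])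
      · exact h.cross i k hp.1 hv' hki.symm (by simpa [hi]) (by simpa [hk])
      · exact h.cross i j hp.1 hv' hij (by simpa [hi]) (by simpa [hj])
      · exact h.cross j k hp.1 hv' hkj.symm (by simpa [hj]) (by simpa [hk])
      · exact h.cross j i hp.1 hv' hij.symm (by simpa [hj]) (by simpa [hi])
    · intro a₁ a₂ a₃ b₁ b₂ b₃ hp hac
      exact hcon _ _ hp.1 (Or.inl (by simpa [hk])) hp.2
    · intro a₁ a₂ a₃ b₁ b₂ b₃ hp hac
      exact hcon _ _ hp.1 (Or.inr (by simpa [hk])) hp.2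
    · intro a₁ a₂ a₃ b₁ b₂ b₃ x₃ y₃ hp hv'
      have hv' := (validEnds_triple hki hkj hij).2 hv'
      refine hcon _ _ hv' (Or.inl (by simp [hk])) (h.trans hp.1 hp.2 ?_)
      exact h.slide hp.1 hv' hc hc' hki.symm (by simp [hi]) (by simp [hi])
        (by simpa [hk] using hp.1.2.2.2.2 k) (Or.inl rfl) (Or.inr (by simp [hk]))
        (Or.inl rfl) (Or.inr (by simp [hk]))
    · intro a₁ a₂ a₃ b₁ b₂ b₃ x₃ y₃ hp hv'
      have hv' := (validEnds_triple hki hkj hij).2 hv'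
      refine hcon _ _ hv' (Or.inl (by simp [hk])) (h.trans hp.1 hp.2 ?_)
      exact h.slide hp.1 hv' hc hc' hkj.symm (by simp [hj]) (by simp [hj])
        (by simpa [hk] using hp.1.2.2.2.2 k) (Or.inl rfl) (Or.inr (by simp [hk]))
        (Or.inl rfl) (Or.inr (by simp [hk]))
  have hv0 : ValidEnds A B X (triple k i (α k) (α i) (α j)) (triple k i (β k) (β i) (β j)) := by
    rw [← eq_triple hki hkj hij, ← eq_triple hki hkj hij]
    exact hv
  refine hP.elim (a₁ := α k) (a₂ := α i) (a₃ := α j) (b₁ := β k) (b₂ := β i) (b₃ := β j) ⟨hv0, ?_⟩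
  rw [← eq_triple hki hkj hij, ← eq_triple hki hkj hij]
  exact h.cross k i hv hv hki rfl rfl

/-- One colouring can use both colours: paths `k` and `l` impose no condition, so only the third
path `m` has to be respected. -/
theorem linked_cross (h : PrismRelation A B X GA GB E) {k l : Fin 3} (hkl : k ≠ l) {c c' : C}
    (hc : GA k c) (hc' : GB l c') : Linked A B X E k l c c' := by
  obtain ⟨m, hkm, hlm⟩ : ∃ m : Fin 3, k ≠ m ∧ l ≠ m := exists_other k l
  obtain ⟨x, hx, hxc, -⟩ := exists_third_mem (h.cardA m) c c
  obtain ⟨y, hyc, hy, hxy⟩ := exists_ne_mem_of_card (h.cardB m)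
    (fun _ _ => (h.matching m).1 x _ _) c'
  obtain ⟨u, hu, huc, hux⟩ := exists_third_mem (h.cardA l) c x
  obtain ⟨w, hw, hwc, hwy⟩ := exists_third_mem (h.cardB k) c' y
  have hv : ValidEnds A B X (triple k l c u x) (triple k l w c' y) :=
    (validEnds_triple hkl hkm hlm).2 ⟨⟨h.memA hc, hu, hx, huc.symm, hxc.symm, hux⟩,
      ⟨hw, h.memB hc', hy, hwc, hwy, hyc.symm⟩, h.freeA hc _, h.freeB hc' _, hxy⟩
  exact ⟨_, _, _, _, hv, hv, by simp [triple], by simp [triple, hkl.symm],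
    h.cross k l hv hv hkl rfl rfl⟩

/-- All colourings with a given free colour at a given end are equivalent, so links can be
concatenated at a common free colour. -/
theorem Linked.of_chain (h : PrismRelation A B X GA GB E) {k l k' l' : Fin 3} {c c' d d' : C}
    (hc : GA k' c) (hc' : GB l c') (h1 : Linked A B X E k l d c') (h2 : Linked A B X E k' l c c')
    (h3 : Linked A B X E k' l' c d') : Linked A B X E k l' d d' := by
  obtain ⟨α, β, α', β', hv, hv', e1, e2, e⟩ := h1
  obtain ⟨γ, δ, γ', δ', gv, gv', f1, f2, f⟩ := h2
  obtain ⟨ε, ζ, ε', ζ', ev, ev', g1, g2, g⟩ := h3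
  refine ⟨α, β, ε', ζ', hv, ev', e1, g2, ?_⟩
  have s1 : E α' β' γ' δ' := h.fixB (k := l) hv' gv' (e2 ▸ hc') (e2.trans f2.symm)
  have s2 : E γ δ ε ζ := h.fixA (k := k') gv ev (f1 ▸ hc) (f1.trans g1.symm)
  exact h.trans hv' e (h.trans gv' s1 (h.trans gv (h.symm f) (h.trans ev s2 g)))

/-- A colouring with `c` and `c'` at the two ends of path `k` would itself be a link. Without one,
the other two paths have no common extension avoiding `c` and `c'`. -/
theorem exclusion (h : PrismRelation A B X GA GB E) {k i j : Fin 3} (hki : k ≠ i) (hkj : k ≠ j)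
    (hij : i ≠ j) {c c' : C} (hc : GA k c) (hc' : GB k c') (hn : ¬ Linked A B X E k k c c') :
    ∃ s t p q, s ≠ t ∧ p ≠ q ∧ (s ≠ c ∧ t ≠ c ∧ p ≠ c' ∧ q ≠ c') ∧
      (s ∈ A i ∧ t ∈ A i ∧ s ∈ A j ∧ t ∈ A j) ∧ (p ∈ B i ∧ q ∈ B i ∧ p ∈ B j ∧ q ∈ B j) ∧
      (¬ X i s p ∧ ¬ X i t q ∧ ¬ X j s q ∧ ¬ X j t p) ∧ c ∈ A i ∧ c ∈ A j ∧ c' ∈ B i ∧ c' ∈ B j := by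
  suffices key : ∀ x y z w, x ∈ A i → y ∈ A j → z ∈ B i → w ∈ B j → x ≠ c → y ≠ c → z ≠ c' →
      w ≠ c' → x ≠ y → z ≠ w → X i x z → X j y w → False by
    obtain ⟨s, t, p, q, e1, e2, e3, e4, e5, e6⟩ := exclusion_of_no_extension (h.cardA i)
      (h.cardA j) (h.cardB i) (h.cardB j) (h.matching i) (h.matching j) key
    exact ⟨s, t, p, q, e1, e2, e3, e4, e5, e6, mem_of_exclusion (h.cardA i)
      (h.cardA j) (h.cardB i) (h.cardB j) (h.matching i) (h.matching j) key e1 e2 e3 e4 e5 e6.1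
      e6.2.2.1 e6.2.2.2⟩
  intro x y z w hx hy hz hw hxc hyc hzc hwc hxy hzw h1 h2
  have hv : ValidEnds A B X (triple k i c x y) (triple k i c' z w) :=
    (validEnds_triple hki hkj hij).2 ⟨⟨h.memA hc, hx, hy, hxc.symm, hyc.symm, hxy⟩,
      ⟨h.memB hc', hz, hw, hzc.symm, hwc.symm, hzw⟩, h.freeA hc _, h1, h2⟩
  exact hn ⟨_, _, _, _, hv, hv, by simp [triple], by simp [triple], h.cross k i hv hv hki rfl rfl⟩

/-- A path that excludes two disjoint pairs of end colours has only one unrestricted colour. -/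
theorem unrestricted_eq (h : PrismRelation A B X GA GB E) {i : Fin 3} {c c' s t p q d d' : C}
    (hst : s ≠ t) (hpq : p ≠ q) (hne : s ≠ c ∧ t ≠ c ∧ p ≠ c' ∧ q ≠ c') (hs : s ∈ A i)
    (ht : t ∈ A i) (hp : p ∈ B i) (hq : q ∈ B i) (hsp : ¬ X i s p) (htq : ¬ X i t q)
    (hcA : c ∈ A i) (hcB : c' ∈ B i) (hd : GA i d) (hd' : GB i d') : d = c ∧ d' = c' := by
  have h1 := (mem_iff_of_card_three (h.cardA i) hs ht hcA hst hne.1 hne.2.1 d).1 (h.memA hd)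
  have h2 := (mem_iff_of_card_three (h.cardB i) hp hq hcB hpq hne.2.2.1 hne.2.2.2 d').1 (h.memB hd')
  constructor
  · rcases h1 with rfl | rfl | rfl
    · exact absurd (h.freeA hd p) hsp
    · exact absurd (h.freeA hd q) htq
    · rfl
  · rcases h2 with rfl | rfl | rfl
    · exact absurd (h.freeB hd' s) hsp
    · exact absurd (h.freeB hd' t) htq
    · rfl

/-- The unrestricted colours of path `i` must be `c` and `c'`. If path `j` is long as well, the same
holds for it, and the chain through the first end of `i` and the last end of `j` links path `k` to
itself. If path `j` is an edge, the chain runs through both ends of path `i` instead, and those have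
to be linked by a slide. -/
theorem false_of_exclusion (h : PrismRelation A B X GA GB E) {k i j : Fin 3} (hki : k ≠ i)
    (hkj : k ≠ j) (hij : i ≠ j) {c c' : C} (hc : GA k c) (hc' : GB k c')
    (hn : ¬ Linked A B X E k k c c') {s t p q : C} (hst : s ≠ t) (hpq : p ≠ q)
    (hne : s ≠ c ∧ t ≠ c ∧ p ≠ c' ∧ q ≠ c') (hs : s ∈ A i ∧ t ∈ A i ∧ s ∈ A j ∧ t ∈ A j)
    (hp : p ∈ B i ∧ q ∈ B i ∧ p ∈ B j ∧ q ∈ B j)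
    (hX : ¬ X i s p ∧ ¬ X i t q ∧ ¬ X j s q ∧ ¬ X j t p)
    (hcm : c ∈ A i ∧ c ∈ A j ∧ c' ∈ B i ∧ c' ∈ B j) {d d' : C} (hd : GA i d) (hd' : GB i d') :
    False := by
  obtain ⟨rfl, rfl⟩ := h.unrestricted_eq hst hpq hne hs.1 hs.2.1 hp.1 hp.2.1 hX.1 hX.2.1
    hcm.1 hcm.2.2.1 hd hd'
  rcases h.cases j with ⟨⟨e, he⟩, e', he'⟩ | hj
  · obtain ⟨rfl, rfl⟩ := h.unrestricted_eq hst hpq.symm ⟨hne.1, hne.2.1, hne.2.2.2, hne.2.2.1⟩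
      hs.2.2.1 hs.2.2.2 hp.2.2.2 hp.2.2.1 hX.2.2.1 hX.2.2.2 hcm.2.1 hcm.2.2.2 he he'
    exact hn (Linked.of_chain h hd he' (h.linked_cross hkj hc he') (h.linked_cross hij hd he')
      (h.linked_cross hki.symm hd hc'))
  · have hsq : s = q := by
      by_contra hcon
      exact hX.2.2.1 ((hj s q).2 hcon)
    have htp : t = p := by
      by_contra hcon
      exact hX.2.2.2 ((hj t p).2 hcon)
    subst hsq htp
    refine hn (Linked.of_chain h hd hd' (h.linked_cross hki hc hd') ?_
      (h.linked_cross hki.symm hd hc'))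
    -- The exclusion statement for path `i` in place of `k` shows that path `k` forbids the pair
    -- `t`, `s`.
    by_contra hni
    obtain ⟨s', t', p', q', hst', hpq', hne', hs', hp', hX', hcm'⟩ :=
      h.exclusion hki.symm hij hkj hd hd' hni
    have hsq' : s' = q' := by
      by_contra hcon
      exact hX'.2.2.1 ((hj s' q').2 hcon)
    have htp' : t' = p' := by
      by_contra hcon
      exact hX'.2.2.2 ((hj t' p').2 hcon)
    subst hsq' htp'
    have m1 := (mem_iff_of_card_three (h.cardA j) hs.2.2.1 hs.2.2.2 hcm.2.1 hst hne.1 hne.2.1 s').1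
      hs'.2.2.1
    have m2 := (mem_iff_of_card_three (h.cardA j) hs.2.2.1 hs.2.2.2 hcm.2.1 hst hne.1 hne.2.1 t').1
      hs'.2.2.2
    have hts : ¬ X k t s ∧ t ∈ A k ∧ t ∈ B k := by
      rcases m1 with rfl | rfl | rfl
      · rcases m2 with rfl | rfl | rfl
        · exact absurd rfl hst'
        · exact ⟨hX'.2.1, hs'.2.1, hp'.1⟩
        · exact absurd rfl hne'.2.1
      · rcases m2 with rfl | rfl | rfl
        · exact ⟨hX'.1, hs'.1, hp'.2.1⟩
        · exact absurd rfl hst'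
        · exact absurd rfl hne'.2.1
      · exact absurd rfl hne'.1
    have htt : X k t t := by_contra fun h0 => hst ((h.matching k).1 _ _ _ hts.1 h0)
    have hss : X i s s := by_contra fun h0 => hst ((h.matching i).1 _ _ _ h0 hX.1)
    have hi : ∀ a b d : C, triple k i a b d i = b := fun a b d => by simp [triple, hki.symm]
    -- The colourings `v1` and `v2` agree on path `k` and differ by a slide on path `i`: its first
    -- end carries `d` in `v1`, its last end carries `d'` in `v2`.
    have v1 : ValidEnds A B X (triple k i t d s) (triple k i t s d') :=
      (validEnds_triple hki hkj hij).2 ⟨⟨hts.2.1, hcm.1, hs.2.2.1, hne.2.1, hst.symm, hne.1.symm⟩,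
        ⟨hts.2.2, hp.2.1, hcm.2.2.2, hst.symm, hne.2.2.1, hne.2.2.2⟩, htt, h.freeA hd _,
        (hj _ _).2 hne.2.2.2⟩
    have v2 : ValidEnds A B X (triple k i t s d) (triple k i t d' s) :=
      (validEnds_triple hki hkj hij).2 ⟨⟨hts.2.1, hs.1, hcm.2.1, hst.symm, hne.2.1, hne.1⟩,
        ⟨hts.2.2, hcm.2.2.1, hp.2.2.2, hne.2.2.1, hst.symm, hne.2.2.2.symm⟩, htt, h.freeB hd' _,
        (hj _ _).2 hne.1.symm⟩
    exact hni ⟨_, _, _, _, v1, v2, hi _ _ _, hi _ _ _, h.slide v1 v2 hd hd' hki (by simp [triple])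
      (by simp [triple]) hss (Or.inr (hi _ _ _)) (Or.inl (hi _ _ _)) (Or.inl (hi _ _ _))
      (Or.inr (hi _ _ _))⟩

/-- Failing this, the two other paths forbid complementary perfect matchings. Two single edges
forbid only equal pairs and cannot do so, hence one of these paths is longer and
`false_of_exclusion` applies. -/
theorem linked_self (h : PrismRelation A B X GA GB E) {k : Fin 3} {c c' : C} (hc : GA k c)
    (hc' : GB k c') : Linked A B X E k k c c' := by
  by_contra hn
  obtain ⟨i, j, hki, hkj, hij⟩ := exists_other_two k
  obtain ⟨s, t, p, q, hst, hpq, hne, hs, hp, hX, hcm⟩ := h.exclusion hki hkj hij hc hc' hn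
  rcases h.cases i with ⟨⟨d, hd⟩, d', hd'⟩ | hi
  · exact h.false_of_exclusion hki hkj hij hc hc' hn hst hpq hne hs hp hX hcm hd hd'
  rcases h.cases j with ⟨⟨d, hd⟩, d', hd'⟩ | hj
  · exact h.false_of_exclusion hkj hki hij.symm hc hc' hn hst hpq.symm
      ⟨hne.1, hne.2.1, hne.2.2.2, hne.2.2.1⟩ ⟨hs.2.2.1, hs.2.2.2, hs.1, hs.2.1⟩
      ⟨hp.2.2.2, hp.2.2.1, hp.2.1, hp.1⟩ ⟨hX.2.2.1, hX.2.2.2, hX.1, hX.2.1⟩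
      ⟨hcm.2.1, hcm.1, hcm.2.2.2, hcm.2.2.1⟩ hd hd'
  · have h1 : s = p := by
      by_contra hcon
      exact hX.1 ((hi _ _).2 hcon)
    have h2 : s = q := by
      by_contra hcon
      exact hX.2.2.1 ((hj _ _).2 hcon)
    exact hpq (h1.symm.trans h2)

/-- All end colours of a prism with a path of length at least two are equivalent. -/
theorem all_equiv (h : PrismRelation A B X GA GB E) {k : Fin 3} {c c' : C} (hc : GA k c)
    (hc' : GB k c') {α β α' β' : Fin 3 → C} (hv : ValidEnds A B X α β)
    (hv' : ValidEnds A B X α' β') : E α β α' β' := by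
  obtain ⟨γ, δ, γ', δ', gv, gv', g1, g2, g⟩ := h.linked_self hc hc'
  -- Every colouring reaches one of two free colours, each of which determines a single class, and
  -- the link identifies the two classes.
  have key : ∀ {α β}, ValidEnds A B X α β → E α β γ δ := by
    intro α β hv
    obtain ⟨ε, ζ, ev, e1 | e1, e⟩ := h.reaches hc hc' hv
    · exact h.trans ev e (h.fixA (k := k) ev gv (e1 ▸ hc) (e1.trans g1.symm))
    · exact h.trans ev e (h.trans gv' (h.fixB (k := k) ev gv' (e1 ▸ hc') (e1.trans g2.symm))
        (h.symm g))
  exact h.trans gv (key hv) (h.symm (key hv'))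

end PrismRelation

end PrismRelation

/-- Colourings that agree outside of a set inducing disjoint paths are equivalent. -/
theorem kempeEquiv_of_path {V C : Type*} [Finite V] {G : SimpleGraph V} {L : V → Finset C}
    (hd : ∀ v, (G.neighborSet v).ncard ≤ (L v).card) {φ ψ : V → C} (hφ : IsProperList G L φ)
    (hψ : IsProperList G L ψ) (F : Set V) (hag : ∀ v, v ∉ F → φ v = ψ v) (r : V → ℕ)
    (hinj : ∀ u ∈ F, ∀ v ∈ F, r u = r v → u = v)
    (hadj : ∀ u ∈ F, ∀ v ∈ F, G.Adj u v → r v ≤ r u + 1) : KempeEquiv G L φ ψ := by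
  refine kempeEquiv_of_forest hd hφ hψ F hag r ?_
  intro v hv u hu u' hu' h h' hr hr'
  have h1 := hadj v hv u hu h
  have h2 := hadj v hv u' hu' h'
  have h3 : r v ≠ r u := fun e => h.ne (hinj _ hv _ hu e)
  have h4 : r v ≠ r u' := fun e => h'.ne (hinj _ hv _ hu' e)
  exact hinj _ hu _ hu' (by omega)

/-! ### Lists and colourings of path systems. -/

section PathSystem

variable {C : Type*} {n : Fin 3 → ℕ} {lab : Fin 3 → Bool → Bool}

/-- The list of vertex `s` of path `i`. -/
def listAt (L : (Σ i, Fin (n i)) → Finset C) (i : Fin 3) (s : ℕ) : Finset C :=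
  if h : s < n i then L ⟨i, ⟨s, h⟩⟩ else ∅

theorem listAt_of_lt {L : (Σ i, Fin (n i)) → Finset C} {i : Fin 3} {s : ℕ} (h : s < n i) :
    listAt L i s = L ⟨i, ⟨s, h⟩⟩ := dif_pos h

theorem ncard_neighborSet_interior {i : Fin 3} {s : ℕ} (hs : 0 < s) (h : s + 1 < n i) :
    ((pathSystem n lab).neighborSet ⟨i, ⟨s, by omega⟩⟩).ncard = 2 := by
  rw [Set.ncard_eq_two]
  refine ⟨⟨i, ⟨s - 1, by omega⟩⟩, ⟨i, ⟨s + 1, h⟩⟩, ?_, ?_⟩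
  · rw [ne_eq, sigma_fin_eq_iff]
    simp only
    omega
  · ext ⟨j, t, ht⟩
    simp only [SimpleGraph.mem_neighborSet, pathSystem_adj, Set.mem_insert_iff,
      Set.mem_singleton_iff, sigma_fin_eq_iff]
    constructor
    · rintro (⟨h1, h2⟩ | ⟨h1, h2⟩)
      · omega
      · omega
    · rintro (⟨h1, h2⟩ | ⟨h1, h2⟩)
      · exact Or.inl ⟨h1.symm, by omega⟩
      · exact Or.inl ⟨h1.symm, by omega⟩

theorem card_listAt_interior {L : (Σ i, Fin (n i)) → Finset C}
    (hL : ∀ v, (L v).card = ((pathSystem n lab).neighborSet v).ncard) (i : Fin 3) (s : ℕ)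
    (hs : 0 < s) (h : s < n i - 1) : (listAt L i s).card = 2 := by
  rw [listAt_of_lt (by omega), hL, ncard_neighborSet_interior hs (by omega)]

theorem pathExt_of_isProperList {L : (Σ i, Fin (n i)) → Finset C} {φ : (Σ i, Fin (n i)) → C}
    (hφ : IsProperList (pathSystem n lab) L φ) (i : Fin 3) (h : 0 < n i) :
    PathExt (listAt L i) (n i - 1) (φ ⟨i, ⟨0, h⟩⟩) (φ ⟨i, ⟨n i - 1, by omega⟩⟩) := by
  -- The second branch is a default beyond the end of the path and is never inspected.
  refine ⟨fun s => if hs : s < n i then φ ⟨i, ⟨s, hs⟩⟩ else φ ⟨i, ⟨0, h⟩⟩, ?_, ?_, ?_, ?_⟩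
  · simp [h]
  · exact dif_pos (by omega)
  · intro s _ hs
    have hs' : s < n i := by omega
    simp only [hs', dif_pos, listAt]
    exact hφ.1 _
  · intro s hs
    simp only [show s < n i by omega, show s + 1 < n i by omega, dif_pos]
    refine hφ.2 _ _ (pathSystem_adj.2 (Or.inl ⟨rfl, Or.inl rfl⟩))

/-- The position of the first (`false`) or last (`true`) vertex of a path with `m` vertices. -/
def endPos (m : ℕ) : Bool → ℕ
  | false => 0
  | true => m - 1

theorem isProperList_of_fun {L : (Σ i, Fin (n i)) → Finset C} (f : Fin 3 → ℕ → C)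
    (hmem : ∀ i, ∀ s < n i, f i s ∈ listAt L i s)
    (hstep : ∀ i s, s + 1 < n i → f i s ≠ f i (s + 1))
    (hend : ∀ i j b b', 0 < n i → 0 < n j → lab i b = lab j b' →
      ¬ (i = j ∧ endPos (n i) b = endPos (n j) b') →
      f i (endPos (n i) b) ≠ f j (endPos (n j) b')) :
    IsProperList (pathSystem n lab) L (fun p => f p.1 p.2) := by
  refine ⟨?_, ?_⟩
  · rintro ⟨i, s, hs⟩
    have := hmem i s hs
    rwa [listAt_of_lt hs] at this
  · rintro ⟨i, s, hs⟩ ⟨j, t, ht⟩ h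
    rw [pathSystem_adj] at h
    simp only at h ⊢
    rcases h with ⟨rfl, rfl | rfl⟩ | ⟨h1, ⟨rfl, rfl, h4⟩ | ⟨rfl, h3, h4⟩ | ⟨h2, rfl, h4⟩ |
      ⟨h2, h3, h4⟩⟩
    · exact hstep i s ht
    · exact (hstep i t hs).symm
    · exact hend i j false false hs ht h4 h1
    · have := hend i j false true hs (by omega) h4 (by simp only [endPos]; omega)
      simp only [endPos] at this
      rwa [show n j - 1 = t by omega] at this
    · have := hend i j true false (by omega) ht h4 (by simp only [endPos]; omega)
      simp only [endPos] at this
      rwa [show n i - 1 = s by omega] at this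
    · have := hend i j true true (by omega) (by omega) h4 (by simp only [endPos]; omega)
      simp only [endPos] at this
      rwa [show n j - 1 = t by omega, show n i - 1 = s by omega] at this

end PathSystem

/-! ### Prisms -/

section Theta

variable {C : Type*} {n : Fin 3 → ℕ}

/-- All first vertices are joined to each other, and so are all last vertices. -/
def thetaLab : Fin 3 → Bool → Bool := fun _ b => b

theorem theta_adj {p q : Σ i, Fin (n i)} : (pathSystem n thetaLab).Adj p q ↔
    (p.1 = q.1 ∧ ((p.2 : ℕ) + 1 = q.2 ∨ (q.2 : ℕ) + 1 = p.2)) ∨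
    (p.1 ≠ q.1 ∧ (((p.2 : ℕ) = 0 ∧ (q.2 : ℕ) = 0) ∨
      ((p.2 : ℕ) + 1 = n p.1 ∧ (q.2 : ℕ) + 1 = n q.1))) := by
  obtain ⟨i, s, hs⟩ := p
  obtain ⟨j, t, ht⟩ := q
  rw [pathSystem_adj]
  simp only [thetaLab, Bool.false_eq_true, Bool.true_eq_false, and_false, and_true, false_or]
  by_cases hij : i = j
  · subst hij
    simp only [true_and, ne_eq, not_true_eq_false, false_and, or_false]
    omega
  · simp only [hij, false_and, not_false_eq_true, true_and, ne_eq]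

theorem ncard_neighborSet_theta_first {i : Fin 3} (h : 2 ≤ n i) (hn : ∀ i, 0 < n i) :
    ((pathSystem n thetaLab).neighborSet ⟨i, ⟨0, hn i⟩⟩).ncard = 3 := by
  obtain ⟨j, k, hij, hik, hjk⟩ := exists_other_two i
  rw [Set.ncard_eq_three]
  refine ⟨⟨i, ⟨1, h⟩⟩, ⟨j, ⟨0, hn j⟩⟩, ⟨k, ⟨0, hn k⟩⟩, ?_, ?_, ?_, ?_⟩
  · rw [ne_eq, sigma_fin_eq_iff]
    simp
  · rw [ne_eq, sigma_fin_eq_iff]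
    simp
  · rw [ne_eq, sigma_fin_eq_iff]
    simp [hjk]
  · ext ⟨l, t, ht⟩
    simp only [SimpleGraph.mem_neighborSet, theta_adj, Set.mem_insert_iff,
      Set.mem_singleton_iff, sigma_fin_eq_iff]
    rcases fin_three_cases hij hik hjk l with rfl | rfl | rfl
    · simp [hij, hik]
      omega
    · simp [hij, hij.symm, hjk]
      omega
    · simp [hik, hik.symm, hjk.symm]
      omega

theorem ncard_neighborSet_theta_last {i : Fin 3} (h : 2 ≤ n i) (hn : ∀ i, 0 < n i) :
    ((pathSystem n thetaLab).neighborSet ⟨i, ⟨n i - 1, by omega⟩⟩).ncard = 3 := by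
  obtain ⟨j, k, hij, hik, hjk⟩ := exists_other_two i
  have hj := hn j
  have hk := hn k
  rw [Set.ncard_eq_three]
  refine ⟨⟨i, ⟨n i - 2, by omega⟩⟩, ⟨j, ⟨n j - 1, by omega⟩⟩, ⟨k, ⟨n k - 1, by omega⟩⟩,
    ?_, ?_, ?_, ?_⟩
  · rw [ne_eq, sigma_fin_eq_iff]
    simp [hij]
  · rw [ne_eq, sigma_fin_eq_iff]
    simp [hik]
  · rw [ne_eq, sigma_fin_eq_iff]
    simp [hjk]
  · ext ⟨l, t, ht⟩
    simp only [SimpleGraph.mem_neighborSet, theta_adj, Set.mem_insert_iff,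
      Set.mem_singleton_iff, sigma_fin_eq_iff]
    rcases fin_three_cases hij hik hjk l with rfl | rfl | rfl
    · simp [hij, hik]
      omega
    · simp [hij, hij.symm, hjk]
      omega
    · simp [hik, hik.symm, hjk.symm]
      omega

variable {L : (Σ i, Fin (n i)) → Finset C}

/-- Extensions to the interiors of the three paths. -/
theorem exists_isProperList_of_pathFuns (hn : ∀ i, 2 ≤ n i) (α β : Fin 3 → C) (f : Fin 3 → ℕ → C)
    (hα : ∀ i, α i ∈ listAt L i 0) (hβ : ∀ i, β i ∈ listAt L i (n i - 1))
    (hα' : ∀ i j, i ≠ j → α i ≠ α j) (hβ' : ∀ i j, i ≠ j → β i ≠ β j)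
    (hf0 : ∀ i, f i 0 = α i) (hf1 : ∀ i, f i (n i - 1) = β i)
    (hf : ∀ i s, 0 < s → s < n i - 1 → f i s ∈ listAt L i s)
    (hstep : ∀ i, ∀ s < n i - 1, f i s ≠ f i (s + 1)) :
    IsProperList (pathSystem n thetaLab) L (fun p => f p.1 p.2) := by
  refine isProperList_of_fun f (fun i s hs => ?_) (fun i s hs => hstep i s (by omega)) ?_
  · have := hn i
    rcases Nat.eq_zero_or_pos s with rfl | h0
    · rw [hf0]
      exact hα i
    · by_cases h1 : s = n i - 1
      · subst h1
        rw [hf1]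
        exact hβ i
      · exact hf i s h0 (by omega)
  · rintro i j b b' - - rfl hne
    have hij : i ≠ j := by
      rintro rfl
      exact hne ⟨rfl, rfl⟩
    cases b
    · simp only [thetaLab, endPos, hf0]
      exact hα' i j hij
    · simp only [thetaLab, endPos, hf1]
      exact hβ' i j hij

end Theta

section Theta

variable {C : Type*} {n : Fin 3 → ℕ} {L : (Σ i, Fin (n i)) → Finset C}

/-- Case distinction on the positions of the vertices of a path system. -/
theorem sigma_fin_forall {p : (Σ i, Fin (n i)) → Prop} :
    (∀ v, p v) ↔ ∀ (i : Fin 3) (s : ℕ) (h : s < n i), p ⟨i, ⟨s, h⟩⟩ :=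
  ⟨fun h i s hs => h _, fun h ⟨i, ⟨s, hs⟩⟩ => h i s hs⟩

/-- The end colours of a colouring of a prism. -/
def HasEnds (hn : ∀ i, 2 ≤ n i) (φ : (Σ i, Fin (n i)) → C) (α β : Fin 3 → C) : Prop :=
  ∀ i, φ ⟨i, ⟨0, by have := hn i; omega⟩⟩ = α i ∧
    φ ⟨i, ⟨n i - 1, by have := hn i; omega⟩⟩ = β i

theorem hasEnds_eq_last {hn : ∀ i, 2 ≤ n i} {φ : (Σ i, Fin (n i)) → C} {α β : Fin 3 → C}
    (h : HasEnds hn φ α β) {i : Fin 3} {s : ℕ} (hs : s < n i) (h0 : s + 1 = n i) :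
    φ ⟨i, ⟨s, hs⟩⟩ = β i := by
  obtain rfl : s = n i - 1 := by omega
  exact (h i).2

/-- End colours are equivalent if all colourings with these end colours are. -/
def EndEquiv (L : (Σ i, Fin (n i)) → Finset C) (hn : ∀ i, 2 ≤ n i) (α β α' β' : Fin 3 → C) : Prop :=
  ∀ φ ψ, IsProperList (pathSystem n thetaLab) L φ → IsProperList (pathSystem n thetaLab) L ψ →
    HasEnds hn φ α β → HasEnds hn ψ α' β' → KempeEquiv (pathSystem n thetaLab) L φ ψ

/-- Deleting the first vertex of path `k` and the last vertex of path `l` leaves an induced path.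
The ranks traverse it: `l` backwards, `m` forwards, `k` backwards. -/
theorem theta_cross (hn : ∀ i, 2 ≤ n i)
    (hL : ∀ v, (L v).card = ((pathSystem n thetaLab).neighborSet v).ncard)
    {φ ψ : (Σ i, Fin (n i)) → C} (hφ : IsProperList (pathSystem n thetaLab) L φ)
    (hψ : IsProperList (pathSystem n thetaLab) L ψ) {α β α' β' : Fin 3 → C}
    (h1 : HasEnds hn φ α β) (h2 : HasEnds hn ψ α' β') {k l : Fin 3} (hkl : k ≠ l)
    (hk : α k = α' k) (hl : β l = β' l) : KempeEquiv (pathSystem n thetaLab) L φ ψ := by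
  obtain ⟨m, hkm, hlm⟩ := exists_other k l
  have hnk := hn k
  have hnl := hn l
  have hnm := hn m
  refine kempeEquiv_of_path (fun v => (hL v).ge) hφ hψ
    {p | ¬ (p.1 = k ∧ (p.2 : ℕ) = 0) ∧ ¬ (p.1 = l ∧ (p.2 : ℕ) + 1 = n l)} ?_
    (fun p => if p.1 = l then n l - p.2 else if p.1 = m then n l + 1 + p.2
      else n l + n m + (n k - p.2)) ?_ ?_
  · rw [sigma_fin_forall]
    intro i s hs hF
    simp only [Set.mem_ofPred_eq] at hF
    by_cases h : i = k ∧ s = 0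
    · obtain ⟨rfl, rfl⟩ := h
      rw [(h1 i).1, (h2 i).1, hk]
    · have : i = l ∧ s + 1 = n l := by tauto
      obtain ⟨rfl, h'⟩ := this
      rw [hasEnds_eq_last h1 hs h', hasEnds_eq_last h2 hs h', hl]
  · rintro ⟨i, s, hs⟩ hu ⟨j, t, ht⟩ hv h
    rw [sigma_fin_eq_iff]
    simp only [Set.mem_ofPred_eq] at hu hv h ⊢
    rcases fin_three_cases hkl hkm hlm i with rfl | rfl | rfl <;>
    rcases fin_three_cases hkl hkm hlm j with rfl | rfl | rfl <;>
    simp [hkl, hkm, hlm, hkl.symm, hkm.symm, hlm.symm] at hu hv h ⊢ <;> omega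
  · rintro ⟨i, s, hs⟩ hu ⟨j, t, ht⟩ hv h
    rw [theta_adj] at h
    simp only [Set.mem_ofPred_eq] at hu hv h ⊢
    rcases fin_three_cases hkl hkm hlm i with rfl | rfl | rfl <;>
    rcases fin_three_cases hkl hkm hlm j with rfl | rfl | rfl <;>
    simp [hkl, hkm, hlm, hkl.symm, hkm.symm, hlm.symm] at hu hv h ⊢ <;> omega

/-- The second vertex of path `k` has a spare colour. From it, the ranks grow along `k` to the last
clique and then back along the other paths. These may consist of one vertex, as is needed for
theta-graphs with adjacent branch vertices. -/
theorem theta_fixFirst (hn : ∀ i, 0 < n i)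
    (hL : ∀ v, (L v).card = ((pathSystem n thetaLab).neighborSet v).ncard)
    {φ ψ : (Σ i, Fin (n i)) → C}
    (hφ : IsProperList (pathSystem n thetaLab) L φ)
    (hψ : IsProperList (pathSystem n thetaLab) L ψ) {k : Fin 3}
    (hnk : 2 ≤ n k) (hk : φ ⟨k, ⟨0, hn k⟩⟩ = ψ ⟨k, ⟨0, hn k⟩⟩)
    (hg : φ ⟨k, ⟨0, hn k⟩⟩ ∉ listAt L k 1) : KempeEquiv (pathSystem n thetaLab) L φ ψ := by
  obtain ⟨l, m, hkl, hkm, hlm⟩ := exists_other_two k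
  refine kempeEquiv_of_spare (fun v => (hL v).ge) hφ hψ
    {p | ¬ (p.1 = k ∧ (p.2 : ℕ) = 0)} ?_
    (fun p => if p.1 = k then (p.2 : ℕ) else n k + (n p.1 - p.2)) ?_
  · rw [sigma_fin_forall]
    intro i s hs hF
    simp only [Set.mem_ofPred_eq, not_not] at hF
    obtain ⟨rfl, rfl⟩ := hF
    exact hk
  · rintro ⟨i, s, hs⟩ hF
    simp only [Set.mem_ofPred_eq] at hF
    by_cases hik : i = k
    · subst hik
      by_cases hs1 : s = 1
      · subst hs1
        refine Or.inl ⟨⟨i, ⟨0, by omega⟩⟩, ?_, by simp, ?_⟩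
        · simp [theta_adj]
        · rw [listAt_of_lt hs] at hg
          exact hg
      · have hs0 : s ≠ 0 := fun h => hF ⟨rfl, h⟩
        refine Or.inr ⟨⟨i, ⟨s - 1, by omega⟩⟩, ?_, ?_, ?_⟩
        · simp
          omega
        · simp [theta_adj]
          omega
        · simp
          omega
    · by_cases hs1 : s + 1 = n i
      · refine Or.inr ⟨⟨k, ⟨n k - 1, by omega⟩⟩, ?_, ?_, ?_⟩
        · simp
          omega
        · simp [theta_adj, hik]
          omega
        · simp [hik]
          omega
      · refine Or.inr ⟨⟨i, ⟨s + 1, by omega⟩⟩, ?_, ?_, ?_⟩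
        · simp
        · simp [theta_adj]
        · simp [hik]
          omega

theorem theta_fixLast (hn : ∀ i, 0 < n i)
    (hL : ∀ v, (L v).card = ((pathSystem n thetaLab).neighborSet v).ncard)
    {φ ψ : (Σ i, Fin (n i)) → C}
    (hφ : IsProperList (pathSystem n thetaLab) L φ)
    (hψ : IsProperList (pathSystem n thetaLab) L ψ) {k : Fin 3}
    (hnk : 2 ≤ n k) (hk : φ ⟨k, ⟨n k - 1, by omega⟩⟩ = ψ ⟨k, ⟨n k - 1, by omega⟩⟩)
    (hg : φ ⟨k, ⟨n k - 1, by omega⟩⟩ ∉ listAt L k (n k - 2)) : KempeEquiv (pathSystem n thetaLab) L φ ψ := by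
  refine kempeEquiv_of_spare (fun v => (hL v).ge) hφ hψ
    {p | ¬ (p.1 = k ∧ (p.2 : ℕ) + 1 = n k)} ?_
    (fun p => if p.1 = k then n k - p.2 else n k + 1 + p.2) ?_
  · rw [sigma_fin_forall]
    intro i s hs hF
    simp only [Set.mem_ofPred_eq, not_not] at hF
    obtain ⟨rfl, h0⟩ := hF
    obtain rfl : s = n i - 1 := by omega
    exact hk
  · rintro ⟨i, s, hs⟩ hF
    simp only [Set.mem_ofPred_eq] at hF
    by_cases hik : i = k
    · subst hik
      by_cases hs1 : s = n i - 2
      · subst hs1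
        refine Or.inl ⟨⟨i, ⟨n i - 1, by omega⟩⟩, ?_, ?_, ?_⟩
        · simp [theta_adj]
          omega
        · simp
          omega
        · rw [listAt_of_lt hs] at hg
          exact hg
      · have hs0 : s + 1 ≠ n i := fun h => hF ⟨rfl, h⟩
        refine Or.inr ⟨⟨i, ⟨s + 1, by omega⟩⟩, ?_, ?_, ?_⟩
        · simp
          omega
        · simp [theta_adj]
        · simp
          omega
    · by_cases hs1 : s = 0
      · refine Or.inr ⟨⟨k, ⟨0, by omega⟩⟩, ?_, ?_, ?_⟩
        · simp
          omega
        · simp [theta_adj, hik, hs1]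
        · simp [hik]
          omega
      · refine Or.inr ⟨⟨i, ⟨s - 1, by omega⟩⟩, ?_, ?_, ?_⟩
        · simp [hik]
        · simp [theta_adj]
          omega
        · simp [hik]
          omega

/-- Valid end colours come from a colouring with prescribed colours in the interiors. -/
theorem exists_hasEnds_of_pathFuns (hn : ∀ i, 2 ≤ n i) (α β : Fin 3 → C) (f : Fin 3 → ℕ → C)
    {X : Fin 3 → C → C → Prop}
    (hv : ValidEnds (fun i => listAt L i 0) (fun i => listAt L i (n i - 1)) X α β)
    (hf0 : ∀ i, f i 0 = α i) (hf1 : ∀ i, f i (n i - 1) = β i)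
    (hf : ∀ i s, 0 < s → s < n i - 1 → f i s ∈ listAt L i s)
    (hstep : ∀ i, ∀ s < n i - 1, f i s ≠ f i (s + 1)) :
    IsProperList (pathSystem n thetaLab) L (fun p => f p.1 p.2) ∧
      HasEnds hn (fun p => f p.1 p.2) α β :=
  ⟨exists_isProperList_of_pathFuns hn α β f hv.1 hv.2.1 hv.2.2.1 hv.2.2.2.1 hf0 hf1 hf hstep,
    fun i => ⟨hf0 i, hf1 i⟩⟩

theorem exists_hasEnds (hn : ∀ i, 2 ≤ n i) {α β : Fin 3 → C}
    (hv : ValidEnds (fun i => listAt L i 0) (fun i => listAt L i (n i - 1))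
      (fun i => PathExt (listAt L i) (n i - 1)) α β) :
    ∃ φ, IsProperList (pathSystem n thetaLab) L φ ∧ HasEnds hn φ α β := by
  choose f h1 h2 h3 h4 using hv.2.2.2.2
  exact ⟨_, exists_hasEnds_of_pathFuns hn α β f hv h1 h2 h3 h4⟩

theorem validEnds_of_isProperList (hn : ∀ i, 2 ≤ n i) {φ : (Σ i, Fin (n i)) → C}
    (hφ : IsProperList (pathSystem n thetaLab) L φ) : ∃ α β,
    ValidEnds (fun i => listAt L i 0) (fun i => listAt L i (n i - 1))
      (fun i => PathExt (listAt L i) (n i - 1)) α β ∧ HasEnds hn φ α β := by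
  have hn' : ∀ i, 0 < n i := fun i => by have := hn i; omega
  refine ⟨fun i => φ ⟨i, ⟨0, hn' i⟩⟩, fun i => φ ⟨i, ⟨n i - 1, by have := hn' i; omega⟩⟩,
    ⟨?_, ?_, ?_, ?_, fun i => pathExt_of_isProperList hφ i (hn' i)⟩, fun i => ⟨rfl, rfl⟩⟩
  · intro i
    simp only [listAt_of_lt (hn' i)]
    exact hφ.1 _
  · intro i
    have := hn' i
    simp only [listAt_of_lt (show n i - 1 < n i by omega)]
    exact hφ.1 _
  · intro i j hij
    exact hφ.2 _ _ (by simp [theta_adj, hij])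
  · intro i j hij
    have := hn' i
    have := hn' j
    exact hφ.2 _ _ (by simp [theta_adj, hij]; omega)

/-- Path `r` and the interior of path `k` can be coloured identically in both colourings, because
`c` and `c'` do not occur in the lists next to the ends of `k`. -/
theorem theta_slide (hn : ∀ i, 2 ≤ n i)
    (hL : ∀ v, (L v).card = ((pathSystem n thetaLab).neighborSet v).ncard)
    {α β α' β' : Fin 3 → C} {k r : Fin 3} {c c' x y : C} (hk : 3 ≤ n k)
    (hv : ValidEnds (fun i => listAt L i 0) (fun i => listAt L i (n i - 1))
      (fun i => PathExt (listAt L i) (n i - 1)) α β)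
    (hv' : ValidEnds (fun i => listAt L i 0) (fun i => listAt L i (n i - 1))
      (fun i => PathExt (listAt L i) (n i - 1)) α' β')
    (hc : c ∉ listAt L k 1) (hc' : c' ∉ listAt L k (n k - 2)) (hrk : r ≠ k)
    (hα : α r = α' r) (hβ : β r = β' r) (hX : PathExt (listAt L k) (n k - 1) x y)
    (h1 : α k = x ∨ α k = c) (h2 : α' k = x ∨ α' k = c) (h3 : β k = y ∨ β k = c')
    (h4 : β' k = y ∨ β' k = c') :
    ∃ φ ψ, IsProperList (pathSystem n thetaLab) L φ ∧ IsProperList (pathSystem n thetaLab) L ψ ∧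
      HasEnds hn φ α β ∧ HasEnds hn ψ α' β' ∧ KempeEquiv (pathSystem n thetaLab) L φ ψ := by
  obtain ⟨m, hrm, hkm⟩ := exists_other r k
  obtain ⟨g, g0, g1, gm, gs⟩ := hX
  choose f f0 f1 fm fs using hv.2.2.2.2
  choose f' f0' f1' fm' fs' using hv'.2.2.2.2
  -- The interior colours come from an extension of `x`, `y`; either end may be replaced by its free
  -- colour.
  let w : C → C → ℕ → C := fun a b s => if s = 0 then a else if s = n k - 1 then b else g s
  have w0 : ∀ a b, w a b 0 = a := fun a b => by simp [w]
  have w1 : ∀ a b, w a b (n k - 1) = b := fun a b => by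
    simp only [w, if_true]
    rw [if_neg (by omega)]
  have wm : ∀ a b s, 0 < s → s < n k - 1 → w a b s = g s := fun a b s hs hs' => by
    simp only [w]
    rw [if_neg (by omega), if_neg (by omega)]
  have ws : ∀ a b, (a = x ∨ a = c) → (b = y ∨ b = c') → ∀ s < n k - 1, w a b s ≠ w a b (s + 1) := by
    intro a b ha hb s hs
    rcases Nat.eq_zero_or_pos s with rfl | hs0
    · rw [w0, wm _ _ _ (by omega) (by omega)]
      rcases ha with rfl | rfl
      · rw [← g0]
        exact gs 0 hs
      · intro h
        exact hc (h ▸ gm 1 (by omega) (by omega))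
    · rw [wm _ _ _ hs0 (by omega)]
      by_cases hs1 : s + 1 = n k - 1
      · rw [hs1, w1]
        rcases hb with rfl | rfl
        · rw [← g1, ← hs1]
          exact gs s hs
        · intro h
          refine hc' (h ▸ ?_)
          rw [show n k - 2 = s by omega]
          exact gm s hs0 (by omega)
      · rw [wm _ _ _ (by omega) (by omega)]
        exact gs s hs
  let u : Fin 3 → ℕ → C := fun i => if i = k then w (α k) (β k) else f i
  let u' : Fin 3 → ℕ → C := fun i => if i = k then w (α' k) (β' k) else if i = r then f r else f' i
  have uk : u k = w (α k) (β k) := by simp [u]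
  have uk' : u' k = w (α' k) (β' k) := by simp [u']
  have ur : u r = f r := by simp [u, hrk]
  have ur' : u' r = f r := by simp [u', hrk]
  have um : u m = f m := by simp [u, hkm.symm]
  have um' : u' m = f' m := by simp [u', hkm.symm, hrm.symm]
  have ht := fin_three_cases hrk.symm hkm hrm
  obtain ⟨hφ, eφ⟩ := exists_hasEnds_of_pathFuns hn α β u hv
    (fun i => by rcases ht i with rfl | rfl | rfl <;> simp [uk, ur, um, w0, f0])
    (fun i => by rcases ht i with rfl | rfl | rfl <;> simp [uk, ur, um, w1, f1])
    (fun i s hs hs' => by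
      rcases ht i with rfl | rfl | rfl
      · rw [uk, wm _ _ _ hs hs']
        exact gm s hs hs'
      · rw [ur]
        exact fm _ s hs hs'
      · rw [um]
        exact fm _ s hs hs')
    (fun i s hs => by
      rcases ht i with rfl | rfl | rfl
      · rw [uk]
        exact ws _ _ h1 h3 s hs
      · rw [ur]
        exact fs _ s hs
      · rw [um]
        exact fs _ s hs)
  obtain ⟨hψ, eψ⟩ := exists_hasEnds_of_pathFuns hn α' β' u' hv'
    (fun i => by rcases ht i with rfl | rfl | rfl <;> simp [uk', ur', um', w0, f0, f0', hα])
    (fun i => by rcases ht i with rfl | rfl | rfl <;> simp [uk', ur', um', w1, f1, f1', hβ])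
    (fun i s hs hs' => by
      rcases ht i with rfl | rfl | rfl
      · rw [uk', wm _ _ _ hs hs']
        exact gm s hs hs'
      · rw [ur']
        exact fm _ s hs hs'
      · rw [um']
        exact fm' _ s hs hs')
    (fun i s hs => by
      rcases ht i with rfl | rfl | rfl
      · rw [uk']
        exact ws _ _ h2 h4 s hs
      · rw [ur']
        exact fs _ s hs
      · rw [um']
        exact fs' _ s hs)
  refine ⟨_, _, hφ, hψ, eφ, eψ, ?_⟩
  have hnm := hn m
  -- What varies is an induced path: the first vertex of `k`, all of `m`, the last vertex of `k`.
  refine kempeEquiv_of_path (fun v => (hL v).ge) hφ hψ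
    {p | (p.1 = k ∧ ((p.2 : ℕ) = 0 ∨ (p.2 : ℕ) + 1 = n k)) ∨ p.1 = m} ?_
    (fun p => if p.1 = k then (if (p.2 : ℕ) = 0 then 0 else n m + 1) else 1 + p.2) ?_ ?_
  · rw [sigma_fin_forall]
    intro i s hs hF
    simp only [Set.mem_ofPred_eq] at hF
    rcases ht i with rfl | rfl | rfl
    · simp only [uk, uk']
      rw [wm _ _ _ (by omega) (by omega), wm _ _ _ (by omega) (by omega)]
    · simp only [ur, ur']
    · exact absurd (Or.inr rfl) hF
  · rintro ⟨i, s, hs⟩ hu ⟨j, t, ht'⟩ hv h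
    rw [sigma_fin_eq_iff]
    simp only [Set.mem_ofPred_eq] at hu hv h ⊢
    rcases ht i with rfl | rfl | rfl <;>
    rcases ht j with rfl | rfl | rfl <;>
    simp [hrk, hkm, hrm, hrk.symm, hkm.symm, hrm.symm] at hu hv h ⊢ <;> (try split_ifs at h) <;> omega
  · rintro ⟨i, s, hs⟩ hu ⟨j, t, ht'⟩ hv h
    rw [theta_adj] at h
    simp only [Set.mem_ofPred_eq] at hu hv h ⊢
    rcases ht i with rfl | rfl | rfl <;>
    rcases ht j with rfl | rfl | rfl <;>
    simp [hrk, hkm, hrm, hrk.symm, hkm.symm, hrm.symm] at hu hv h ⊢ <;> (try split_ifs) <;> omega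

/-- End lists have three colours and interior lists two, so every path with an interior vertex has
free colours at both ends, and `EndEquiv` is a `PrismRelation`. -/
theorem theta_swappable (hn : ∀ i, 2 ≤ n i)
    (hL : ∀ v, (L v).card = ((pathSystem n thetaLab).neighborSet v).ncard)
    {k : Fin 3} (hk : 3 ≤ n k) : Swappable (pathSystem n thetaLab) L := by
  have hn' : ∀ i, 0 < n i := fun i => by have := hn i; omega
  have c0 : ∀ i, (listAt L i 0).card = 3 := fun i => by
    rw [listAt_of_lt (hn' i), hL, ncard_neighborSet_theta_first (hn i) hn']
  have c1 : ∀ i, (listAt L i (n i - 1)).card = 3 := fun i => by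
    rw [listAt_of_lt (by have := hn' i; omega), hL, ncard_neighborSet_theta_last (hn i) hn']
  have c2 := card_listAt_interior hL
  have hR : PrismRelation (fun i => listAt L i 0) (fun i => listAt L i (n i - 1))
      (fun i => PathExt (listAt L i) (n i - 1))
      (fun k c => 3 ≤ n k ∧ c ∈ listAt L k 0 ∧ c ∉ listAt L k 1)
      (fun k c => 3 ≤ n k ∧ c ∈ listAt L k (n k - 1) ∧ c ∉ listAt L k (n k - 2))
      (EndEquiv L hn) := by
    refine ⟨c0, c1, ?_, ?_, ?_, ?_, fun h => h.2.1, fun h => h.2.1, ?_, ?_, ?_, ?_, ?_, ?_⟩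
    · intro i
      have := hn i
      exact ⟨fun a b b' h h' => eq_of_not_pathExt (by omega) (c2 i) h h',
        fun a a' b h h' => eq_of_not_pathExt' (by omega) (c2 i) h h'⟩
    · intro α β α' β' h φ ψ hφ hψ h1 h2
      exact (h ψ φ hψ hφ h2 h1).symm
    · intro α β α' β' α'' β'' hv h h' φ ψ hφ hψ h1 h2
      obtain ⟨χ, hχ, h3⟩ := exists_hasEnds hn hv
      exact (h φ χ hφ hχ h1 h3).trans (h' χ ψ hχ hψ h3 h2)
    · intro α β α' β' k l _ _ hkl e1 e2 φ ψ hφ hψ h1 h2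
      exact theta_cross hn hL hφ hψ h1 h2 hkl e1 e2
    · rintro k c ⟨hk, -, h⟩ y
      exact pathExt_of_notMem (by omega) (c2 k) h y
    · rintro k c ⟨hk, -, h⟩ y
      exact pathExt_of_notMem' (by omega) (c2 k) h y
    · rintro α β α' β' k _ _ ⟨-, -, hg⟩ e φ ψ hφ hψ h1 h2
      exact theta_fixFirst hn' hL hφ hψ (hn k) ((h1 k).1.trans (e.trans (h2 k).1.symm))
        ((h1 k).1 ▸ hg)
    · rintro α β α' β' k _ _ ⟨-, -, hg⟩ e φ ψ hφ hψ h1 h2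
      exact theta_fixLast hn' hL hφ hψ (hn k) ((h1 k).2.trans (e.trans (h2 k).2.symm))
        ((h1 k).2 ▸ hg)
    · rintro α β α' β' k r c c' x y hv hv' ⟨hk, -, hc⟩ ⟨-, -, hc'⟩ hrk e1 e2 hX h1 h2 h3 h4 φ ψ
        hφ hψ g1 g2
      obtain ⟨φ', ψ', p1, p2, p3, p4, p5⟩ :=
        theta_slide hn hL hk hv hv' hc hc' hrk e1 e2 hX h1 h2 h3 h4
      -- The slide concerns specially chosen interiors; by `theta_cross` the interiors do not
      -- matter.
      exact ((theta_cross hn hL hφ p1 g1 p3 hrk rfl rfl).trans p5).trans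
        (theta_cross hn hL p2 hψ p4 g2 hrk rfl rfl)
    · intro k
      by_cases hk : 3 ≤ n k
      · left
        have h2 := c2 k 1 (by omega) (by omega)
        have h3 := c2 k (n k - 2) (by omega) (by omega)
        obtain ⟨c, hc, hc'⟩ := Finset.exists_mem_notMem_of_card_lt_card
          (show (listAt L k 1).card < (listAt L k 0).card by rw [c0, h2]; omega)
        obtain ⟨d, hd, hd'⟩ := Finset.exists_mem_notMem_of_card_lt_card
          (show (listAt L k (n k - 2)).card < (listAt L k (n k - 1)).card by rw [c1, h3]; omega)
        exact ⟨⟨c, hk, hc, hc'⟩, d, hk, hd, hd'⟩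
      · right
        intro x y
        have := hn k
        simp only [show n k - 1 = 1 by omega]
        exact pathExt_one
  intro φ ψ hφ hψ
  obtain ⟨α, β, hv, he⟩ := validEnds_of_isProperList hn hφ
  obtain ⟨α', β', hv', he'⟩ := validEnds_of_isProperList hn hψ
  rcases hR.cases k with ⟨⟨c, hc⟩, c', hc'⟩ | h
  · exact hR.all_equiv hc hc' hv hv' φ ψ hφ hψ he he'
  · have h2 := c2 k 1 (by omega) (by omega)
    obtain ⟨c, hc, hc'⟩ := Finset.exists_mem_notMem_of_card_lt_card
      (show (listAt L k 1).card < (listAt L k 0).card by rw [c0, h2]; omega)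
    exact absurd (pathExt_of_notMem (by omega) (c2 k) hc' c) (fun h' => ((h c c).1 h') rfl)

end Theta

/-! ### Local flips -/

section Flip

variable {V C : Type*} {G : SimpleGraph V} {L : V → Finset C}

open Classical in
/-- Interchange the colours `a` and `b` on the set `S`, all of whose vertices have these colours. -/
noncomputable def flipOn (S : Set V) (a b : C) (φ : V → C) : V → C :=
  fun v => if v ∈ S then if φ v = a then b else a else φ v

theorem flipOn_of_notMem {S : Set V} {a b : C} {φ : V → C} {v : V} (h : v ∉ S) :
    flipOn S a b φ v = φ v := by simp [flipOn, h]

theorem flipOn_of_eq_left {S : Set V} {a b : C} {φ : V → C} {v : V} (h : v ∈ S) (h' : φ v = a) :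
    flipOn S a b φ v = b := by simp [flipOn, h, h']

theorem flipOn_of_eq_right {S : Set V} {a b : C} {φ : V → C} {v : V} (h : v ∈ S) (h' : φ v = b) :
    flipOn S a b φ v = a := by
  simp only [flipOn, h, h', if_true]
  split_ifs with hab
  · exact h'.symm.trans hab
  · rfl

theorem kempeEquiv_flipOn {S : Set V} {a b : C} {φ : V → C} (hφ : IsProperList G L φ)
    (h : ∀ v ∈ S, (φ v = a ∧ b ∈ L v ∧ ∀ u ∉ S, G.Adj v u → φ u ≠ b) ∨
      (φ v = b ∧ a ∈ L v ∧ ∀ u ∉ S, G.Adj v u → φ u ≠ a)) :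
    KempeEquiv G L φ (flipOn S a b φ) := by
  refine MultiSwap.kempeEquiv ⟨hφ, ⟨fun v => ?_, fun u v huv => ?_⟩, a, b, fun v => ?_⟩
  · by_cases hv : v ∈ S
    · rcases h v hv with ⟨h1, h2, -⟩ | ⟨h1, h2, -⟩
      · rwa [flipOn_of_eq_left hv h1]
      · rwa [flipOn_of_eq_right hv h1]
    · rw [flipOn_of_notMem hv]
      exact hφ.1 v
  · have key : ∀ u v, u ∈ S → v ∉ S → G.Adj u v → flipOn S a b φ u ≠ φ v := by
      intro u v hu hv huv
      rcases h u hu with ⟨h1, -, h2⟩ | ⟨h1, -, h2⟩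
      · rw [flipOn_of_eq_left hu h1]
        exact (h2 v hv huv).symm
      · rw [flipOn_of_eq_right hu h1]
        exact (h2 v hv huv).symm
    by_cases hu : u ∈ S <;> by_cases hv : v ∈ S
    · have hne := hφ.2 u v huv
      rcases h u hu with ⟨h1, -⟩ | ⟨h1, -⟩ <;> rcases h v hv with ⟨h2, -⟩ | ⟨h2, -⟩
      · exact absurd (h1.trans h2.symm) hne
      · rw [flipOn_of_eq_left hu h1, flipOn_of_eq_right hv h2]
        exact fun e => hne (h1.trans (e.symm.trans h2.symm))
      · rw [flipOn_of_eq_right hu h1, flipOn_of_eq_left hv h2]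
        exact fun e => hne (h1.trans (e.symm.trans h2.symm))
      · exact absurd (h1.trans h2.symm) hne
    · rw [flipOn_of_notMem hv]
      exact key u v hu hv huv
    · rw [flipOn_of_notMem hu]
      exact (key v u hv hu huv.symm).symm
    · rw [flipOn_of_notMem hu, flipOn_of_notMem hv]
      exact hφ.2 u v huv
  · by_cases hv : v ∈ S
    · rcases h v hv with ⟨h1, -⟩ | ⟨h1, -⟩
      · exact Or.inr (Or.inl ⟨h1, flipOn_of_eq_left hv h1⟩)
      · exact Or.inr (Or.inr ⟨h1, flipOn_of_eq_right hv h1⟩)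
    · exact Or.inl (flipOn_of_notMem hv).symm

/-- In a triangle `v`, `x false`, `x true`, where the colour `c i` does not occur in the lists of
the other neighbours of `x i`, either `v` has one of these colours, or one of them can be used. -/
theorem exists_eq_apex {φ : V → C} (hφ : IsProperList G L φ) {v : V} {x : Bool → V} {c : Bool → C}
    (hmem : ∀ i, c i ∈ L (x i))
    (hnbr : ∀ i u, G.Adj (x i) u → u = v ∨ u = x (!i) ∨ c i ∉ L u) :
    (∃ i, c i = φ v) ∨ ∃ ψ, KempeEquiv G L φ ψ ∧ ∃ i, ψ (x i) = c i := by
  by_contra hcon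
  push Not at hcon
  obtain ⟨h1, h2⟩ := hcon
  have h3 : ∀ i, c i = φ (x (!i)) := by
    intro i
    by_contra h3
    refine h2 _ (kempeEquiv_flipOn (S := {x i}) (a := φ (x i)) (b := c i) hφ ?_) i
      (flipOn_of_eq_left rfl rfl)
    rintro _ rfl
    refine Or.inl ⟨rfl, hmem i, fun u _ hu he => ?_⟩
    rcases hnbr i u hu with rfl | rfl | h
    · exact h1 i he.symm
    · exact h3 he.symm
    · exact h (he ▸ hφ.1 u)
  -- Each of the two vertices holds the free colour of the other, so exchanging their colours
  -- succeeds.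
  refine h2 _ (kempeEquiv_flipOn (S := {x false, x true}) (a := φ (x false)) (b := φ (x true)) hφ ?_)
    false ((flipOn_of_eq_left (by simp) rfl).trans (h3 false).symm)
  have key : ∀ i, ∀ u ∉ ({x false, x true} : Set V), G.Adj (x i) u → φ u ≠ c i := by
    intro i u hu hadj he
    rcases hnbr i u hadj with rfl | rfl | h
    · exact h1 i he.symm
    · cases i <;> simp at hu
    · exact h (he ▸ hφ.1 u)
  rintro _ (rfl | rfl)
  · refine Or.inl ⟨rfl, ?_, ?_⟩
    · have := hmem false
      rwa [h3 false] at this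
    · have := key false
      rwa [h3 false] at this
  · refine Or.inr ⟨rfl, ?_, ?_⟩
    · have := hmem true
      rwa [h3 true] at this
    · have := key true
      rwa [h3 true] at this

/-- A vertex `v` in two triangles, whose other vertices have colours `c i`, `d j` that are not
in the lists of their neighbours outside of the triangles. -/
structure Hub (G : SimpleGraph V) (L : V → Finset C) (v : V) (x y : Bool → V) (c d : Bool → C) :
    Prop where
  nbr : ∀ u, G.Adj v u → (∃ i, u = x i) ∨ ∃ j, u = y j
  adjx : ∀ i, G.Adj v (x i)
  adjy : ∀ j, G.Adj v (y j)
  adjxx : ∀ i, G.Adj (x i) (x (!i))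
  adjyy : ∀ j, G.Adj (y j) (y (!j))
  ne : ∀ i j, x i ≠ y j
  memx : ∀ i, c i ∈ L (x i)
  memy : ∀ j, d j ∈ L (y j)
  nbrx : ∀ i u, G.Adj (x i) u → u = v ∨ u = x (!i) ∨ c i ∉ L u
  nbry : ∀ j u, G.Adj (y j) u → u = v ∨ u = y (!j) ∨ d j ∉ L u

namespace Hub

variable {v : V} {x y : Bool → V} {c d : Bool → C}

theorem swap (h : Hub G L v x y c d) : Hub G L v y x d c :=
  ⟨fun u hu => (h.nbr u hu).symm, h.adjy, h.adjx, h.adjyy, h.adjxx, fun i j => (h.ne j i).symm,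
    h.memy, h.memx, h.nbry, h.nbrx⟩

/-- Apart from `v`, nothing prevents `x i` from taking the colour of `v`. -/
theorem ne_of_notMem (h : Hub G L v x y c d) {φ : V → C} (hφ : IsProperList G L φ) {i : Bool}
    (hi : c i = φ v) {S : Set V} (hv : v ∈ S) : ∀ u ∉ S, G.Adj (x i) u → φ u ≠ φ v := by
  intro u hu hadj he
  rcases h.nbrx i u hadj with rfl | rfl | hn
  · exact hu hv
  · exact hφ.2 _ _ (h.adjx (!i)) he.symm
  · exact hn (hi ▸ he ▸ hφ.1 u)

/-- Otherwise `v` and `x i` could exchange colours, with `y j` joining in if it has the colour of `x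
i`, and `x i` would obtain `c i`. -/
theorem eq_of_mem (h : Hub G L v x y c d) {φ : V → C} (hφ : IsProperList G L φ)
    (hs : ∀ ψ, KempeEquiv G L φ ψ → ∀ i, ψ (x i) ≠ c i) {i j : Bool} (hi : c i = φ v)
    (hj : d j = φ v) (hmem : φ (x i) ∈ L v) : φ (x i) = φ (y (!j)) := by
  by_contra hne
  have hx : ∀ u, G.Adj v u → u ≠ x i → u ≠ y j → φ u ≠ φ (x i) := by
    intro u hu h1 h2 he
    rcases h.nbr u hu with ⟨k, rfl⟩ | ⟨k, rfl⟩
    · by_cases hk : k = i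
      · exact h1 (hk ▸ rfl)
      · rw [Bool.eq_not_of_ne hk] at he
        exact hφ.2 _ _ (h.adjxx i) he.symm
    · by_cases hk : k = j
      · exact h2 (hk ▸ rfl)
      · rw [Bool.eq_not_of_ne hk] at he
        exact hne he.symm
  by_cases hy : φ (y j) = φ (x i)
  · refine hs _ (kempeEquiv_flipOn (S := {v, x i, y j}) (a := φ v) (b := φ (x i)) hφ ?_) i
      ((flipOn_of_eq_right (by simp) rfl).trans hi.symm)
    rintro u (rfl | rfl | rfl)
    · refine Or.inl ⟨rfl, hmem, fun w hw hadj => hx w hadj ?_ ?_⟩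
      · rintro rfl
        simp at hw
      · rintro rfl
        simp at hw
    · exact Or.inr ⟨rfl, hi ▸ h.memx i, h.ne_of_notMem hφ hi (by simp)⟩
    · exact Or.inr ⟨hy, hj ▸ h.memy j, h.swap.ne_of_notMem hφ hj (by simp)⟩
  · refine hs _ (kempeEquiv_flipOn (S := {v, x i}) (a := φ v) (b := φ (x i)) hφ ?_) i
      ((flipOn_of_eq_right (by simp) rfl).trans hi.symm)
    rintro u (rfl | rfl)
    · refine Or.inl ⟨rfl, hmem, fun w hw hadj => ?_⟩
      by_cases hwy : w = y j
      · rwa [hwy]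
      · exact hx w hadj (by rintro rfl; simp at hw) hwy
    · exact Or.inr ⟨rfl, hi ▸ h.memx i, h.ne_of_notMem hφ hi (by simp)⟩

/-- If no neighbour had the colour `z`, then `v` could move to `z` and leave `c i` to `x i`. -/
theorem exists_used (h : Hub G L v x y c d) {φ : V → C} (hφ : IsProperList G L φ)
    (hs : ∀ ψ, KempeEquiv G L φ ψ → ∀ i, ψ (x i) ≠ c i) {i : Bool} (hi : c i = φ v) {z : C}
    (hz : z ∈ L v) (hzv : z ≠ φ v) : ∃ u, G.Adj v u ∧ φ u = z := by
  by_contra hcon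
  push Not at hcon
  have h1 : KempeEquiv G L φ (flipOn {v} (φ v) z φ) := by
    refine kempeEquiv_flipOn hφ ?_
    rintro u rfl
    exact Or.inl ⟨rfl, hz, fun w _ hw => hcon w hw⟩
  have hψ := h1.isProperList hφ
  have hv : flipOn {v} (φ v) z φ v = z := flipOn_of_eq_left rfl rfl
  have hne : ∀ u, u ≠ v → flipOn {v} (φ v) z φ u = φ u := fun u hu =>
    flipOn_of_notMem hu
  refine hs _ (h1.trans (kempeEquiv_flipOn (S := {x i}) (a := φ (x i)) (b := c i) hψ ?_)) i
    (flipOn_of_eq_left rfl (hne _ (h.adjx i).ne'))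
  rintro _ rfl
  refine Or.inl ⟨hne _ (h.adjx i).ne', h.memx i, fun u _ hadj => ?_⟩
  by_cases huv : u = v
  · rw [huv, hv, hi]
    exact hzv
  · rw [hne u huv, hi]
    exact h.ne_of_notMem hφ hi (S := {v}) rfl u huv hadj

/-- In a stuck colouring the colour of `v` is free at some `x i` and at some `y j`. All other
colours of `L v` occur around `v`, and by `eq_of_mem` already on `x (!i)` or `y (!j)`. So `L v`
would have at most three colours. -/
theorem exists_kempeEquiv (h : Hub G L v x y c d) (hL : 4 ≤ (L v).card) {φ : V → C}
    (hφ : IsProperList G L φ) :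
    ∃ ψ, KempeEquiv G L φ ψ ∧ ((∃ i, ψ (x i) = c i) ∨ ∃ j, ψ (y j) = d j) := by
  classical
  by_contra hcon
  push Not at hcon
  have hs1 := fun ψ hψ => (hcon ψ hψ).1
  have hs2 := fun ψ hψ => (hcon ψ hψ).2
  obtain ⟨i, hi⟩ : ∃ i, c i = φ v := (exists_eq_apex hφ h.memx h.nbrx).resolve_right
    fun ⟨ψ, hψ, i, hi⟩ => hs1 ψ hψ i hi
  obtain ⟨j, hj⟩ : ∃ j, d j = φ v := (exists_eq_apex hφ h.memy h.nbry).resolve_right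
    fun ⟨ψ, hψ, j, hj⟩ => hs2 ψ hψ j hj
  have hsub : L v ⊆ {φ v, φ (x (!i)), φ (y (!j))} := by
    intro z hz
    simp only [Finset.mem_insert, Finset.mem_singleton]
    by_cases hzv : z = φ v
    · exact Or.inl hzv
    obtain ⟨u, hu, rfl⟩ := h.exists_used hφ hs1 hi hz hzv
    rcases h.nbr u hu with ⟨k, rfl⟩ | ⟨k, rfl⟩
    · by_cases hk : k = i
      · subst hk
        exact Or.inr (Or.inr (h.eq_of_mem hφ hs1 hi hj hz))
      · rw [Bool.eq_not_of_ne hk]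
        exact Or.inr (Or.inl rfl)
    · by_cases hk : k = j
      · subst hk
        exact Or.inr (Or.inl (h.swap.eq_of_mem hφ hs2 hj hi hz))
      · rw [Bool.eq_not_of_ne hk]
        exact Or.inr (Or.inr rfl)
  have := (Finset.card_le_card hsub).trans Finset.card_le_three
  omega

end Hub

/-- In a clique of four vertices, each having two colours that are in no list of a neighbour
outside of the clique, one of these colours can be used. -/
theorem exists_kempeEquiv_of_clique {φ : V → C} (hφ : IsProperList G L φ) {K : Fin 4 → V}
    (hadj : ∀ i j, i ≠ j → G.Adj (K i) (K j)) {U : Fin 4 → Finset C}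
    (hcard : ∀ i, 2 ≤ (U i).card) (hmem : ∀ i, U i ⊆ L (K i))
    (hnbr : ∀ i u, G.Adj (K i) u → (∃ j, u = K j) ∨ ∀ c ∈ U i, c ∉ L u) :
    ∃ ψ, KempeEquiv G L φ ψ ∧ ∃ i, ψ (K i) ∈ U i := by
  classical
  by_contra hcon
  push Not at hcon
  have h0 := hcon φ (KempeEquiv.refl φ)
  have h1 : ∀ i, ∀ c ∈ U i, ∃ j, φ (K j) = c := by
    intro i c hc
    by_contra hno
    push Not at hno
    refine hcon _ (kempeEquiv_flipOn (S := {K i}) (a := φ (K i)) (b := c) hφ ?_) i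
      ((flipOn_of_eq_left rfl rfl).symm ▸ hc)
    rintro _ rfl
    refine Or.inl ⟨rfl, hmem i hc, fun u _ hu he => ?_⟩
    rcases hnbr i u hu with ⟨j, rfl⟩ | h
    · exact hno j he
    · exact h c hc (he ▸ hφ.1 u)
  -- Two vertices holding a free colour of each other could exchange their colours.
  have h2 : ∀ i j, i ≠ j → φ (K j) ∈ U i → φ (K i) ∈ U j → False := by
    intro i j hij hi hj
    have key : ∀ i j, i ≠ j → φ (K j) ∈ U i → ∀ u, u ≠ K j → G.Adj (K i) u → φ u ≠ φ (K j) := by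
      intro i j _ hi u huj hu he
      rcases hnbr i u hu with ⟨l, rfl⟩ | h
      · have hlj : l ≠ j := by
          rintro rfl
          exact huj rfl
        exact hφ.2 _ _ (hadj l j hlj) he
      · exact h _ hi (he ▸ hφ.1 u)
    refine hcon _ (kempeEquiv_flipOn (S := {K i, K j}) (a := φ (K i)) (b := φ (K j)) hφ ?_) i
      (by rw [flipOn_of_eq_left (by simp) rfl]; exact hi)
    rintro _ (rfl | rfl)
    · exact Or.inl ⟨rfl, hmem i hi, fun u hu => key i j hij hi u (by rintro rfl; simp at hu)⟩
    · exact Or.inr ⟨rfl, hmem j hj, fun u hu => key j i hij.symm hj u (by rintro rfl; simp at hu)⟩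
  -- Draw an arc from `i` to `j` if the colour of `K j` is free at `K i`. Four out-degrees of at
  -- least 2 give eight arcs, but there are six pairs with at most one arc each.
  have h3 : ∀ i, 2 ≤ (Finset.univ.filter (fun j => φ (K j) ∈ U i)).card := by
    intro i
    refine (hcard i).trans ((Finset.card_le_card ?_).trans
      (Finset.card_image_le (f := fun j => φ (K j))))
    intro c hc
    obtain ⟨j, rfl⟩ := h1 i c hc
    simp only [Finset.mem_image, Finset.mem_filter, Finset.mem_univ, true_and]
    exact ⟨j, hc, rfl⟩
  simp only [Finset.card_filter, Fin.sum_univ_four] at h3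
  have h4 : ∀ i, (if φ (K i) ∈ U i then 1 else 0) = 0 := fun i => if_neg (h0 i)
  have h5 : ∀ i j, i ≠ j →
      (if φ (K j) ∈ U i then 1 else 0) + (if φ (K i) ∈ U j then 1 else 0) ≤ 1 := by
    intro i j hij
    split_ifs with h h'
    · exact (h2 i j hij h h').elim
    all_goals omega
  have := h3 0
  have := h3 1
  have := h3 2
  have := h3 3
  have := h4 0
  have := h4 1
  have := h4 2
  have := h4 3
  have := h5 0 1 (by decide)
  have := h5 0 2 (by decide)
  have := h5 0 3 (by decide)
  have := h5 1 2 (by decide)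
  have := h5 1 3 (by decide)
  have := h5 2 3 (by decide)
  omega

end Flip

theorem four_le_ncard {V : Type*} [Finite V] {s : Set V} {a b c d : V} (ha : a ∈ s) (hb : b ∈ s)
    (hc : c ∈ s) (hd : d ∈ s) (hab : a ≠ b) (hac : a ≠ c) (had : a ≠ d) (hbc : b ≠ c) (hbd : b ≠ d)
    (hcd : c ≠ d) : 4 ≤ s.ncard := by
  classical
  have h : (({a, b, c, d} : Finset V) : Set V) ⊆ s := by
    intro x hx
    simp only [Finset.coe_insert, Finset.coe_singleton, Set.mem_insert_iff,
      Set.mem_singleton_iff] at hx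
    rcases hx with rfl | rfl | rfl | rfl <;> assumption
  have h1 := Set.ncard_le_ncard h
  rw [Set.ncard_coe_finset] at h1
  have : ({a, b, c, d} : Finset V).card = 4 := by
    rw [Finset.card_insert_of_notMem (by simp [hab, hac, had]),
      Finset.card_eq_three.2 ⟨b, c, d, hbc, hbd, hcd, rfl⟩]
  omega

theorem exists_mem_ne_ne {C : Type*} {A : Finset C} (hA : 3 ≤ A.card) (x y : C) :
    ∃ u ∈ A, u ≠ x ∧ u ≠ y := by
  classical
  obtain ⟨u, hu, hu'⟩ := Finset.exists_mem_notMem_of_card_lt_card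
    (show ({x, y} : Finset C).card < A.card from
      (Finset.card_le_two.trans_lt (by omega)))
  simp only [Finset.mem_insert, Finset.mem_singleton, not_or] at hu'
  exact ⟨u, hu, hu'⟩

theorem exists_mem_ne_ne_ne {C : Type*} {A : Finset C} (hA : 4 ≤ A.card) (x y z : C) :
    ∃ u ∈ A, u ≠ x ∧ u ≠ y ∧ u ≠ z := by
  classical
  obtain ⟨u, hu, hu'⟩ := Finset.exists_mem_notMem_of_card_lt_card
    (show ({x, y, z} : Finset C).card < A.card from
      (Finset.card_le_three.trans_lt (by omega)))
  simp only [Finset.mem_insert, Finset.mem_singleton, not_or] at hu'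
  exact ⟨u, hu, hu'⟩

/-! ### Line graphs of theta-graphs whose branch vertices are adjacent. -/

section Bowtie

variable {C : Type*} {n : Fin 3 → ℕ} {L : (Σ i, Fin (n i)) → Finset C}

/-- The function on `Bool` with value `a` at `b` and `a'` at `!b`. -/
def boolPair (b : Bool) (a a' : C) : Bool → C := fun k => if k = b then a else a'

@[simp] theorem boolPair_self (b : Bool) (a a' : C) : boolPair b a a' b = a := by simp [boolPair]

@[simp] theorem boolPair_not (b : Bool) (a a' : C) : boolPair b a a' (!b) = a' := by
  simp [boolPair]

@[simp] theorem boolPair_false_true (a a' : C) : boolPair false a a' true = a' := rfl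

theorem bool_forall_iff (b : Bool) {p : Bool → Prop} : (∀ k, p k) ↔ p b ∧ p (!b) := by
  cases b <;> simp [Bool.forall_bool, and_comm]

/-- A path with one vertex `l` and two further paths `w false`, `w true`. -/
structure IsBowtie (n : Fin 3 → ℕ) (l : Fin 3) (w : Bool → Fin 3) : Prop where
  one : n l = 1
  three_le : ∀ b, 3 ≤ n (w b)
  ne : ∀ b, w b ≠ l
  ne' : ∀ b, w b ≠ w (!b)
  cover : ∀ k, k = l ∨ ∃ b, k = w b

namespace IsBowtie

variable {l : Fin 3} {w : Bool → Fin 3}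

theorem pos (h : IsBowtie n l w) (k : Fin 3) : 0 < n k := by
  rcases h.cover k with rfl | ⟨b, rfl⟩
  · have := h.one
    omega
  · have := h.three_le b
    omega

/-- The first vertices of the two long paths. -/
def fst (h : IsBowtie n l w) (b : Bool) : Σ i, Fin (n i) := ⟨w b, ⟨0, h.pos _⟩⟩

/-- The last vertices of the two long paths. -/
def lst (h : IsBowtie n l w) (b : Bool) : Σ i, Fin (n i) :=
  ⟨w b, ⟨n (w b) - 1, by have := h.pos (w b); omega⟩⟩

/-- The central vertex. -/
def mid (h : IsBowtie n l w) : Σ i, Fin (n i) := ⟨l, ⟨0, h.pos _⟩⟩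

theorem exists_coloring (h : IsBowtie n l w) {γ : C} {α β : Bool → C} (hγ : γ ∈ L h.mid)
    (hα : ∀ b, α b ∈ L (h.fst b)) (hβ : ∀ b, β b ∈ L (h.lst b)) (h1 : ∀ b, γ ≠ α b)
    (h2 : ∀ b, γ ≠ β b) (h3 : ∀ b, α b ≠ α (!b)) (h4 : ∀ b, β b ≠ β (!b))
    (hX : ∀ b, PathExt (listAt L (w b)) (n (w b) - 1) (α b) (β b)) :
    ∃ φ, IsProperList (pathSystem n thetaLab) L φ ∧ (∀ b, φ (h.fst b) = α b) ∧
      ∀ b, φ (h.lst b) = β b := by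
  choose g g0 g1 gm gs using hX
  let F : Fin 3 → ℕ → C := fun k => if k = l then fun _ => γ else
    if k = w false then g false else g true
  have Fl : F l = fun _ => γ := by simp [F]
  have Fw : ∀ b, F (w b) = g b := by
    intro b
    have := h.ne b
    have h' := h.ne' true
    cases b
    · simp [F, this]
    · simp only [Bool.not_true] at h'
      simp [F, this, h']
  refine ⟨fun p => F p.1 p.2, isProperList_of_fun F ?_ ?_ ?_, ?_, ?_⟩
  · intro k s hs
    rcases h.cover k with rfl | ⟨b, rfl⟩
    · obtain rfl : s = 0 := by
        have := h.one
        omega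
      rw [Fl, listAt_of_lt hs]
      exact hγ
    · rw [Fw]
      by_cases h0 : s = 0
      · subst h0
        rw [g0, listAt_of_lt hs]
        exact hα b
      by_cases h' : s = n (w b) - 1
      · subst h'
        rw [g1, listAt_of_lt hs]
        exact hβ b
      · exact gm b s (by omega) (by omega)
  · intro k s hs
    rcases h.cover k with rfl | ⟨b, rfl⟩
    · have := h.one
      omega
    · rw [Fw]
      exact gs b s (by omega)
  · have e0 : ∀ b e, F (w b) (endPos (n (w b)) e) = if e then β b else α b := by
      intro b e
      cases e
      · simp [endPos, Fw, g0]
      · simp [endPos, Fw, g1]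
    rintro k k' e e' - - rfl hne
    have hkk : k ≠ k' := by
      rintro rfl
      exact hne ⟨rfl, rfl⟩
    rcases h.cover k with rfl | ⟨b, rfl⟩ <;> rcases h.cover k' with rfl | ⟨b', rfl⟩
    · exact absurd rfl hkk
    · rw [e0, Fl]
      cases e
      · simpa [thetaLab] using h1 b'
      · simpa [thetaLab] using h2 b'
    · rw [e0, Fl]
      cases e
      · simpa using (h1 b).symm
      · simpa using (h2 b).symm
    · rw [e0, e0]
      have : b' ≠ b := by
        rintro rfl
        exact hkk rfl
      rw [Bool.eq_not_of_ne this]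
      cases e
      · simpa [thetaLab] using h3 b
      · simpa [thetaLab] using h4 b
  · intro b
    simp [fst, Fw, g0]
  · intro b
    simp [lst, Fw, g1]

section Colors

theorem card_mid (h : IsBowtie n l w)
    (hL : ∀ v, (L v).card = ((pathSystem n thetaLab).neighborSet v).ncard) :
    4 ≤ (L h.mid).card := by
  rw [hL]
  have h1 := h.three_le false
  have h2 := h.three_le true
  have h3 := h.ne false
  have h4 := h.ne true
  have h5 := h.ne' false
  have h6 := h.ne' true
  have h7 := h.one
  simp only [Bool.not_false, Bool.not_true] at h5 h6
  refine four_le_ncard (a := h.fst false) (b := h.lst false) (c := h.fst true) (d := h.lst true)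
    ?_ ?_ ?_ ?_ ?_ ?_ ?_ ?_ ?_ ?_
  · simp [mid, fst, theta_adj, h3.symm]
  · simp [mid, lst, theta_adj, h3.symm]
    omega
  · simp [mid, fst, theta_adj, h4.symm]
  · simp [mid, lst, theta_adj, h4.symm]
    omega
  · rw [ne_eq, sigma_fin_eq_iff]
    simp [fst, lst]
    omega
  all_goals
    rw [ne_eq, sigma_fin_eq_iff]
    simp [fst, lst, h5]
    try omega

theorem card_fst (h : IsBowtie n l w)
    (hL : ∀ v, (L v).card = ((pathSystem n thetaLab).neighborSet v).ncard) (b : Bool) :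
    (L (h.fst b)).card = 3 := by
  rw [hL]
  exact ncard_neighborSet_theta_first (by have := h.three_le b; omega) h.pos

theorem card_lst (h : IsBowtie n l w)
    (hL : ∀ v, (L v).card = ((pathSystem n thetaLab).neighborSet v).ncard) (b : Bool) :
    (L (h.lst b)).card = 3 := by
  rw [hL]
  exact ncard_neighborSet_theta_last (by have := h.three_le b; omega) h.pos

/-- `c b`, `d b` are unrestricted colours at the first and last vertices of path `w b`. -/
structure Free (h : IsBowtie n l w) (L : (Σ i, Fin (n i)) → Finset C) (c d : Bool → C) :
    Prop where
  memc : ∀ b, c b ∈ L (h.fst b)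
  memd : ∀ b, d b ∈ L (h.lst b)
  notc : ∀ b, c b ∉ listAt L (w b) 1
  notd : ∀ b, d b ∉ listAt L (w b) (n (w b) - 2)

theorem exists_free (h : IsBowtie n l w)
    (hL : ∀ v, (L v).card = ((pathSystem n thetaLab).neighborSet v).ncard) :
    ∃ c d, h.Free L c d := by
  have h1 : ∀ b, ∃ c ∈ L (h.fst b), c ∉ listAt L (w b) 1 := fun b => by
    have := h.three_le b
    refine Finset.exists_mem_notMem_of_card_lt_card ?_
    rw [h.card_fst hL, card_listAt_interior hL _ _ (by omega) (by omega)]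
    omega
  have h2 : ∀ b, ∃ c ∈ L (h.lst b), c ∉ listAt L (w b) (n (w b) - 2) := fun b => by
    have := h.three_le b
    refine Finset.exists_mem_notMem_of_card_lt_card ?_
    rw [h.card_lst hL, card_listAt_interior hL _ _ (by omega) (by omega)]
    omega
  choose c hc hc' using h1
  choose d hd hd' using h2
  exact ⟨c, d, hc, hd, hc', hd'⟩

/-- The one-vertex path lies in the triangle of first vertices as well as in that of last vertices.
-/
theorem hub (h : IsBowtie n l w) {c d : Bool → C} (hf : h.Free L c d) :
    Hub (pathSystem n thetaLab) L h.mid h.fst h.lst c d := by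
  have h1 := h.one
  refine ⟨?_, ?_, ?_, ?_, ?_, ?_, hf.memc, hf.memd, ?_, ?_⟩
  · rintro ⟨k, s, hs⟩ hadj
    rcases h.cover k with rfl | ⟨b, rfl⟩
    · simp [mid, theta_adj] at hadj
      omega
    · have := h.ne b
      simp [mid, theta_adj, this.symm] at hadj
      rcases hadj with rfl | hadj
      · exact Or.inl ⟨b, rfl⟩
      · right
        refine ⟨b, ?_⟩
        rw [sigma_fin_eq_iff]
        simp [lst]
        omega
  · intro b
    simp [mid, fst, theta_adj, (h.ne b).symm]
  · intro b
    have := h.three_le b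
    simp [mid, lst, theta_adj, (h.ne b).symm]
    omega
  · intro b
    simp [fst, theta_adj, h.ne' b]
  · intro b
    have := h.three_le b
    have := h.three_le !b
    simp [lst, theta_adj, h.ne' b]
    omega
  · intro b b'
    have := h.three_le b
    have := h.three_le b'
    rw [ne_eq, sigma_fin_eq_iff]
    simp [fst, lst]
    omega
  · rintro b ⟨k, s, hs⟩ hadj
    have hb := h.three_le b
    simp only [fst, theta_adj] at hadj
    rcases hadj with ⟨rfl, hadj⟩ | ⟨hk, hadj⟩
    · obtain rfl : s = 1 := by omega
      have := hf.notc b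
      rw [listAt_of_lt hs] at this
      exact Or.inr (Or.inr this)
    · obtain rfl : s = 0 := by omega
      rcases h.cover k with rfl | ⟨b', rfl⟩
      · exact Or.inl rfl
      · have : b' ≠ b := by
          rintro rfl
          exact hk rfl
        obtain rfl := Bool.eq_not_of_ne this
        exact Or.inr (Or.inl rfl)
  · rintro b ⟨k, s, hs⟩ hadj
    have hb := h.three_le b
    simp only [lst, theta_adj] at hadj
    rcases hadj with ⟨rfl, hadj⟩ | ⟨hk, hadj⟩
    · obtain rfl : s = n (w b) - 2 := by omega
      have := hf.notd b
      rw [listAt_of_lt hs] at this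
      exact Or.inr (Or.inr this)
    · obtain rfl : s = n k - 1 := by omega
      rcases h.cover k with rfl | ⟨b', rfl⟩
      · left
        rw [sigma_fin_eq_iff]
        simp [mid, h1]
      · have : b' ≠ b := by
          rintro rfl
          exact hk rfl
        obtain rfl := Bool.eq_not_of_ne this
        exact Or.inr (Or.inl rfl)

theorem pathExt_fst (h : IsBowtie n l w)
    (hL : ∀ v, (L v).card = ((pathSystem n thetaLab).neighborSet v).ncard) {c d : Bool → C}
    (hf : h.Free L c d) (b : Bool) (y : C) :
    PathExt (listAt L (w b)) (n (w b) - 1) (c b) y :=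
  pathExt_of_notMem (by have := h.three_le b; omega) (card_listAt_interior hL (w b)) (hf.notc b) y

theorem pathExt_lst (h : IsBowtie n l w)
    (hL : ∀ v, (L v).card = ((pathSystem n thetaLab).neighborSet v).ncard) {c d : Bool → C}
    (hf : h.Free L c d) (b : Bool) (x : C) :
    PathExt (listAt L (w b)) (n (w b) - 1) x (d b) :=
  pathExt_of_notMem' (by have := h.three_le b; omega) (card_listAt_interior hL (w b)) (hf.notd b) x

/-- Each long path carries a free colour at one end, so only the two triangles impose conditions.
The central vertex belongs to both and is coloured before the remaining ends. -/
theorem exists_coloring_cross (h : IsBowtie n l w)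
    (hL : ∀ v, (L v).card = ((pathSystem n thetaLab).neighborSet v).ncard) {c d : Bool → C}
    (hf : h.Free L c d) (b : Bool) : ∃ φ, IsProperList (pathSystem n thetaLab) L φ ∧
      φ (h.fst b) = c b ∧ φ (h.lst !b) = d !b := by
  obtain ⟨γ, hγ, g1, g2⟩ := exists_mem_ne_ne ((h.card_mid hL).trans' (by omega)) (c b) (d !b)
  obtain ⟨u, hu, u1, u2⟩ := exists_mem_ne_ne (h.card_fst hL (!b)).ge (c b) γ
  obtain ⟨z, hz, z1, z2⟩ := exists_mem_ne_ne (h.card_lst hL b).ge (d !b) γ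
  obtain ⟨φ, hφ, h1, h2⟩ := h.exists_coloring (L := L) (γ := γ) (α := boolPair b (c b) u)
    (β := boolPair b z (d !b)) hγ
    ((bool_forall_iff b).2 ⟨by simpa using hf.memc b, by simpa using hu⟩)
    ((bool_forall_iff b).2 ⟨by simpa using hz, by simpa using hf.memd !b⟩)
    ((bool_forall_iff b).2 ⟨by simpa using g1, by simpa using u2.symm⟩)
    ((bool_forall_iff b).2 ⟨by simpa using z2.symm, by simpa using g2⟩)
    ((bool_forall_iff b).2 ⟨by simpa using u1.symm, by simpa using u1⟩)
    ((bool_forall_iff b).2 ⟨by simpa using z1, by simpa using z1.symm⟩)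
    ((bool_forall_iff b).2 ⟨by simpa using h.pathExt_fst hL hf b z,
      by simpa using h.pathExt_lst hL hf (!b) u⟩)
  exact ⟨φ, hφ, by simp [h1], by simp [h2]⟩

/-- If this failed, two colours `γ`, `γ'` of the centre other than the free ones would lie in both
end lists of the other path, and that path would forbid the pairs `(γ, γ)` and `(γ', γ')`. By parity
it would then have an odd number of edges, but it has an odd number of vertices. -/
theorem exists_coloring_aligned (h : IsBowtie n l w)
    (hL : ∀ v, (L v).card = ((pathSystem n thetaLab).neighborSet v).ncard) {c d : Bool → C}
    (hf : h.Free L c d) (hodd : Odd (n (w true))) : ∃ φ, IsProperList (pathSystem n thetaLab) L φ ∧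
      φ (h.fst false) = c false ∧ φ (h.lst false) = d false := by
  by_contra hcon
  have hpos : 0 < n (w true) - 1 := by have := h.three_le true; omega
  have key : ∀ γ ∈ L h.mid, γ ≠ c false → γ ≠ d false → ∀ u ∈ L (h.fst true), u ≠ c false → u ≠ γ →
      ∀ z ∈ L (h.lst true), z ≠ d false → z ≠ γ →
      ¬ PathExt (listAt L (w true)) (n (w true) - 1) u z := by
    intro γ hγ g1 g2 u hu u1 u2 z hz z1 z2 hX
    obtain ⟨φ, hφ, h1, h2⟩ := h.exists_coloring (L := L) (γ := γ)
      (α := boolPair false (c false) u) (β := boolPair false (d false) z) hγ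
      ((bool_forall_iff false).2 ⟨by simpa using hf.memc false, by simpa using hu⟩)
      ((bool_forall_iff false).2 ⟨by simpa using hf.memd false, by simpa using hz⟩)
      ((bool_forall_iff false).2 ⟨by simpa using g1, by simpa using u2.symm⟩)
      ((bool_forall_iff false).2 ⟨by simpa using g2, by simpa using z2.symm⟩)
      ((bool_forall_iff false).2 ⟨by simpa using u1.symm, by simpa using u1⟩)
      ((bool_forall_iff false).2 ⟨by simpa using z1.symm, by simpa using z1⟩)
      ((bool_forall_iff false).2 ⟨by simpa using h.pathExt_fst hL hf false _, by simpa using hX⟩)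
    exact hcon ⟨φ, hφ, by simp [h1], by simp [h2]⟩
  have hu : ∀ γ ∈ L h.mid, γ ≠ c false → γ ≠ d false → γ ∈ L (h.fst true) := by
    intro γ hγ g1 g2
    by_contra hn
    obtain ⟨z, hz, z1, z2⟩ := exists_mem_ne_ne (h.card_lst hL true).ge (d false) γ
    obtain ⟨u, u', huu, hu, hu', u1, u1'⟩ := exists_two_mem (h.card_fst hL true) (c false)
    exact huu (eq_of_not_pathExt' hpos (card_listAt_interior hL _)
      (key γ hγ g1 g2 u hu u1 (fun e => hn (e ▸ hu)) z hz z1 z2)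
      (key γ hγ g1 g2 u' hu' u1' (fun e => hn (e ▸ hu')) z hz z1 z2))
  have hz : ∀ γ ∈ L h.mid, γ ≠ c false → γ ≠ d false → γ ∈ L (h.lst true) := by
    intro γ hγ g1 g2
    by_contra hn
    obtain ⟨z, hz, z1, z2⟩ := exists_mem_ne_ne (h.card_fst hL true).ge (c false) γ
    obtain ⟨u, u', huu, hu, hu', u1, u1'⟩ := exists_two_mem (h.card_lst hL true) (d false)
    exact huu (eq_of_not_pathExt hpos (card_listAt_interior hL _)
      (key γ hγ g1 g2 z hz z1 z2 u hu u1 (fun e => hn (e ▸ hu)))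
      (key γ hγ g1 g2 z hz z1 z2 u' hu' u1' (fun e => hn (e ▸ hu'))))
  obtain ⟨γ, hγ, g1, g2⟩ :=
    exists_mem_ne_ne ((h.card_mid hL).trans' (by omega)) (c false) (d false)
  obtain ⟨γ', hγ', g1', g2', hne⟩ :=
    exists_mem_ne_ne_ne (h.card_mid hL) (c false) (d false) γ
  have k1 := key γ' hγ' g1' g2' γ (hu γ hγ g1 g2) g1 hne.symm γ (hz γ hγ g1 g2) g2 hne.symm
  have k2 := key γ hγ g1 g2 γ' (hu γ' hγ' g1' g2') g1' hne γ' (hz γ' hγ' g1' g2') g2' hne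
  have := (not_pathExt_parity hpos (card_listAt_interior hL _) hne.symm k1 k2 (Or.inl rfl)).1 rfl
  rcases this with ⟨a, ha⟩
  rcases hodd with ⟨b, hb⟩
  omega

/-- The hub leads every colouring to one of four free colours. The two crossing colourings pair
these up, and the aligned colouring joins the pairs. -/
theorem swappable (h : IsBowtie n l w)
    (hL : ∀ v, (L v).card = ((pathSystem n thetaLab).neighborSet v).ncard)
    (hodd : Odd (n (w true))) : Swappable (pathSystem n thetaLab) L := by
  obtain ⟨c, d, hf⟩ := h.exists_free hL
  have hn : ∀ b, 2 ≤ n (w b) := fun b => by have := h.three_le b; omega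
  have fixc : ∀ b φ ψ, IsProperList (pathSystem n thetaLab) L φ →
      IsProperList (pathSystem n thetaLab) L ψ → φ (h.fst b) = c b → ψ (h.fst b) = c b →
      KempeEquiv (pathSystem n thetaLab) L φ ψ := fun b φ ψ hφ hψ h1 h2 =>
    theta_fixFirst h.pos hL hφ hψ (hn b) (h1.trans h2.symm) (h1.symm ▸ hf.notc b)
  have fixd : ∀ b φ ψ, IsProperList (pathSystem n thetaLab) L φ →
      IsProperList (pathSystem n thetaLab) L ψ → φ (h.lst b) = d b → ψ (h.lst b) = d b →
      KempeEquiv (pathSystem n thetaLab) L φ ψ := fun b φ ψ hφ hψ h1 h2 =>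
    theta_fixLast h.pos hL hφ hψ (hn b) (h1.trans h2.symm) (h1.symm ▸ hf.notd b)
  obtain ⟨φ₀, p0, c0, d0⟩ := h.exists_coloring_cross hL hf false
  obtain ⟨φ₁, p1, c1, d1⟩ := h.exists_coloring_cross hL hf true
  simp only [Bool.not_false, Bool.not_true] at d0 d1
  have link : KempeEquiv (pathSystem n thetaLab) L φ₁ φ₀ := by
    obtain ⟨χ, hχ, h1, h2⟩ := h.exists_coloring_aligned hL hf hodd
    exact (fixd _ _ _ p1 hχ d1 h2).trans (fixc _ _ _ hχ p0 h1 c0)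
  have key : ∀ φ, IsProperList (pathSystem n thetaLab) L φ →
      KempeEquiv (pathSystem n thetaLab) L φ φ₀ := by
    intro φ hφ
    obtain ⟨ψ, e, ⟨i, hi⟩ | ⟨i, hi⟩⟩ := (h.hub hf).exists_kempeEquiv (h.card_mid hL) hφ
    · have hψ := e.isProperList hφ
      cases i
      · exact e.trans (fixc _ _ _ hψ p0 hi c0)
      · exact e.trans ((fixc _ _ _ hψ p1 hi c1).trans link)
    · have hψ := e.isProperList hφ
      cases i
      · exact e.trans ((fixd _ _ _ hψ p1 hi d1).trans link)
      · exact e.trans (fixd _ _ _ hψ p0 hi d0)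
  exact fun φ ψ hφ hψ => (key φ hφ).trans (key ψ hψ).symm

end Colors

end IsBowtie

end Bowtie

/-! ### Barbells -/

section Ends

variable {C : Type*} {n : Fin 3 → ℕ} {lab : Fin 3 → Bool → Bool} {L : (Σ i, Fin (n i)) → Finset C}

theorem three_le_ncard {V : Type*} [Finite V] {s : Set V} {a b c : V} (ha : a ∈ s) (hb : b ∈ s)
    (hc : c ∈ s) (hab : a ≠ b) (hac : a ≠ c) (hbc : b ≠ c) : 3 ≤ s.ncard := by
  classical
  have h : (({a, b, c} : Finset V) : Set V) ⊆ s := by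
    intro x hx
    simp only [Finset.coe_insert, Finset.coe_singleton, Set.mem_insert_iff,
      Set.mem_singleton_iff] at hx
    rcases hx with rfl | rfl | rfl <;> assumption
  have h1 := Set.ncard_le_ncard h
  rw [Set.ncard_coe_finset, Finset.card_eq_three.2 ⟨a, b, c, hab, hac, hbc, rfl⟩] at h1
  exact h1

theorem fin_three_eq (i : Fin 3) : i = 0 ∨ i = 1 ∨ i = 2 := by omega

/-- The neighbour on its path of the first (`false`) or last (`true`) vertex of a path with `m`
vertices. -/
def nextPos (m : ℕ) : Bool → ℕ
  | false => 1
  | true => m - 2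

/-- The distance of vertex `s` from the first (`false`) or last (`true`) vertex of a path with `m`
vertices. -/
def endDist (m s : ℕ) : Bool → ℕ
  | false => s
  | true => m - 1 - s

theorem endPos_lt {m : ℕ} (h : 0 < m) (b : Bool) : endPos m b < m := by
  cases b <;> simp only [endPos] <;> omega

/-- The first (`false`) or last (`true`) vertex of path `i`. -/
def endVertex (i : Fin 3) (h : 0 < n i) (b : Bool) : Σ i, Fin (n i) :=
  ⟨i, ⟨endPos (n i) b, endPos_lt h b⟩⟩

theorem pathExt_of_free (hL : ∀ v, (L v).card = ((pathSystem n lab).neighborSet v).ncard)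
    {i : Fin 3} (hi : 3 ≤ n i) {b : Bool} {α : Bool → C}
    (h : α b ∉ listAt L i (nextPos (n i) b)) :
    PathExt (listAt L i) (n i - 1) (α false) (α true) := by
  cases b
  · exact pathExt_of_notMem (by omega) (card_listAt_interior hL i) h _
  · exact pathExt_of_notMem' (by omega) (card_listAt_interior hL i) h _

theorem pathExt_endVertex {φ : (Σ i, Fin (n i)) → C} (hφ : IsProperList (pathSystem n lab) L φ)
    (i : Fin 3) (h : 0 < n i) : PathExt (listAt L i) (n i - 1) (φ (endVertex i h false))
      (φ (endVertex i h true)) := pathExt_of_isProperList hφ i h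

theorem card_listAt_nextPos (hL : ∀ v, (L v).card = ((pathSystem n lab).neighborSet v).ncard)
    {i : Fin 3} (hi : 3 ≤ n i) (b : Bool) : (listAt L i (nextPos (n i) b)).card = 2 := by
  cases b <;> exact card_listAt_interior hL i _ (by simp only [nextPos]; omega)
    (by simp only [nextPos]; omega)

end Ends

section Barbell

variable {C : Type*} {n : Fin 3 → ℕ} {L : (Σ i, Fin (n i)) → Finset C}

/-- Both ends of path `0` are joined to the first end of path `1`, and both ends of path `2` are
joined to the last end of path `1`. -/
def barbellLab : Fin 3 → Bool → Bool := fun i b => if i = 0 then false else if i = 1 then b else true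

theorem barbellLab_zero (b : Bool) : barbellLab 0 b = false := rfl

theorem barbellLab_one (b : Bool) : barbellLab 1 b = b := rfl

theorem barbellLab_two (b : Bool) : barbellLab 2 b = true := rfl

theorem barbell_adj {i j : Fin 3} {s t : ℕ} {hs : s < n i} {ht : t < n j} :
    (pathSystem n barbellLab).Adj ⟨i, ⟨s, hs⟩⟩ ⟨j, ⟨t, ht⟩⟩ ↔
      (i = j ∧ (s + 1 = t ∨ t + 1 = s)) ∨
      (i = j ∧ i ≠ 1 ∧ s ≠ t ∧ (s = 0 ∨ s + 1 = n i) ∧ (t = 0 ∨ t + 1 = n i)) ∨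
      (i = 0 ∧ j = 1 ∧ (s = 0 ∨ s + 1 = n 0) ∧ t = 0) ∨
      (i = 1 ∧ j = 0 ∧ (t = 0 ∨ t + 1 = n 0) ∧ s = 0) ∨
      (i = 2 ∧ j = 1 ∧ (s = 0 ∨ s + 1 = n 2) ∧ t + 1 = n 1) ∨
      (i = 1 ∧ j = 2 ∧ (t = 0 ∨ t + 1 = n 2) ∧ s + 1 = n 1) := by
  rw [pathSystem_adj]
  rcases fin_three_eq i with rfl | rfl | rfl <;> rcases fin_three_eq j with rfl | rfl | rfl <;>
    simp [barbellLab] <;> omega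

/-- Next to the fixed end, the vertex along path `0` has a spare colour. The ranks run from it along
path `0`, through the handle and along path `2`. The mirror image is `barbell_fix_two`. -/
theorem barbell_fix_zero (hn0 : 3 ≤ n 0) (hn1 : 0 < n 1) (hn2 : 3 ≤ n 2)
    (hL : ∀ v, (L v).card = ((pathSystem n barbellLab).neighborSet v).ncard)
    {φ ψ : (Σ i, Fin (n i)) → C} (hφ : IsProperList (pathSystem n barbellLab) L φ)
    (hψ : IsProperList (pathSystem n barbellLab) L ψ) {b : Bool}
    (h : φ (endVertex 0 (by omega) b) = ψ (endVertex 0 (by omega) b))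
    (hg : φ (endVertex 0 (by omega) b) ∉ listAt L 0 (nextPos (n 0) b)) :
    KempeEquiv (pathSystem n barbellLab) L φ ψ := by
  refine kempeEquiv_of_spare (fun v => (hL v).ge) hφ hψ
    {p | ¬ (p.1 = 0 ∧ (p.2 : ℕ) = endPos (n 0) b)} ?_
    (fun p => if p.1 = 0 then endDist (n 0) p.2 b else if p.1 = 1 then n 0 + p.2
      else n 0 + n 1 + p.2) ?_
  · rw [sigma_fin_forall]
    intro i s hs hF
    simp only [Set.mem_ofPred_eq, not_not] at hF
    obtain ⟨rfl, rfl⟩ := hF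
    exact h
  · rintro ⟨i, s, hs⟩ hF
    simp only [Set.mem_ofPred_eq] at hF
    rcases fin_three_eq i with rfl | rfl | rfl
    · have hF : s ≠ endPos (n 0) b := fun h => hF ⟨rfl, h⟩
      by_cases hs1 : s = nextPos (n 0) b
      · subst hs1
        refine Or.inl ⟨endVertex 0 (by omega) b, ?_, by simp [endVertex], ?_⟩
        · cases b <;> simp [endVertex, barbell_adj, nextPos, endPos]
          omega
        · rwa [listAt_of_lt hs] at hg
      · right
        cases b
        · simp only [endPos, nextPos] at hF hs1
          refine ⟨⟨0, ⟨s - 1, by omega⟩⟩, ?_, ?_, ?_⟩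
          · simp [endPos]
            omega
          · simp [barbell_adj]
            omega
          · simp [endDist]
            omega
        · simp only [endPos, nextPos] at hF hs1
          refine ⟨⟨0, ⟨s + 1, by omega⟩⟩, ?_, ?_, ?_⟩
          · simp [endPos]
            omega
          · simp [barbell_adj]
          · simp [endDist]
            omega
    · right
      by_cases hs0 : s = 0
      · subst hs0
        refine ⟨endVertex 0 (by omega) (!b), ?_, ?_, ?_⟩
        · cases b <;> simp [endVertex, endPos] <;> omega
        · cases b <;> simp [endVertex, barbell_adj, endPos]
          omega
        · cases b <;> simp [endVertex, endDist, endPos] <;> omega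
      · refine ⟨⟨1, ⟨s - 1, by omega⟩⟩, ?_, ?_, ?_⟩
        · simp
        · simp [barbell_adj]
          omega
        · simp
          omega
    · right
      by_cases hs0 : s = 0
      · subst hs0
        refine ⟨⟨1, ⟨n 1 - 1, by omega⟩⟩, ?_, ?_, ?_⟩
        · simp
        · simp [barbell_adj]
          omega
        · simp
          omega
      · refine ⟨⟨2, ⟨s - 1, by omega⟩⟩, ?_, ?_, ?_⟩
        · simp
        · simp [barbell_adj]
          omega
        · simp
          omega

theorem barbell_fix_two (hn0 : 3 ≤ n 0) (hn1 : 0 < n 1) (hn2 : 3 ≤ n 2)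
    (hL : ∀ v, (L v).card = ((pathSystem n barbellLab).neighborSet v).ncard)
    {φ ψ : (Σ i, Fin (n i)) → C} (hφ : IsProperList (pathSystem n barbellLab) L φ)
    (hψ : IsProperList (pathSystem n barbellLab) L ψ) {b : Bool}
    (h : φ (endVertex 2 (by omega) b) = ψ (endVertex 2 (by omega) b))
    (hg : φ (endVertex 2 (by omega) b) ∉ listAt L 2 (nextPos (n 2) b)) :
    KempeEquiv (pathSystem n barbellLab) L φ ψ := by
  refine kempeEquiv_of_spare (fun v => (hL v).ge) hφ hψ
    {p | ¬ (p.1 = 2 ∧ (p.2 : ℕ) = endPos (n 2) b)} ?_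
    (fun p => if p.1 = 2 then endDist (n 2) p.2 b else if p.1 = 1 then n 2 + (n 1 - p.2)
      else n 2 + n 1 + 1 + p.2) ?_
  · rw [sigma_fin_forall]
    intro i s hs hF
    simp only [Set.mem_ofPred_eq, not_not] at hF
    obtain ⟨rfl, rfl⟩ := hF
    exact h
  · rintro ⟨i, s, hs⟩ hF
    simp only [Set.mem_ofPred_eq] at hF
    rcases fin_three_eq i with rfl | rfl | rfl
    · right
      by_cases hs0 : s = 0
      · subst hs0
        refine ⟨⟨1, ⟨0, by omega⟩⟩, ?_, ?_, ?_⟩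
        · simp
        · simp [barbell_adj]
        · simp
      · refine ⟨⟨0, ⟨s - 1, by omega⟩⟩, ?_, ?_, ?_⟩
        · simp
        · simp [barbell_adj]
          omega
        · simp
          omega
    · right
      by_cases hs0 : s + 1 = n 1
      · refine ⟨endVertex 2 (by omega) (!b), ?_, ?_, ?_⟩
        · cases b <;> simp [endVertex, endPos] <;> omega
        · cases b <;> simp [endVertex, barbell_adj, endPos] <;> omega
        · cases b <;> simp [endVertex, endDist, endPos] <;> omega
      · refine ⟨⟨1, ⟨s + 1, by omega⟩⟩, ?_, ?_, ?_⟩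
        · simp
        · simp [barbell_adj]
        · simp
          omega
    · have hF : s ≠ endPos (n 2) b := fun h => hF ⟨rfl, h⟩
      by_cases hs1 : s = nextPos (n 2) b
      · subst hs1
        refine Or.inl ⟨endVertex 2 (by omega) b, ?_, by simp [endVertex], ?_⟩
        · cases b <;> simp [endVertex, barbell_adj, nextPos, endPos]
          omega
        · rwa [listAt_of_lt hs] at hg
      · right
        cases b
        · simp only [endPos, nextPos] at hF hs1
          refine ⟨⟨2, ⟨s - 1, by omega⟩⟩, ?_, ?_, ?_⟩
          · simp [endPos]
            omega
          · simp [barbell_adj]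
            omega
          · simp [endDist]
            omega
        · simp only [endPos, nextPos] at hF hs1
          refine ⟨⟨2, ⟨s + 1, by omega⟩⟩, ?_, ?_, ?_⟩
          · simp [endPos]
            omega
          · simp [barbell_adj]
          · simp [endDist]
            omega

/-- Deleting one end of path `0` and one end of path `2` leaves an induced path through the handle.
-/
theorem barbell_forest (hn0 : 3 ≤ n 0) (hn1 : 0 < n 1) (hn2 : 3 ≤ n 2)
    (hL : ∀ v, (L v).card = ((pathSystem n barbellLab).neighborSet v).ncard)
    {φ ψ : (Σ i, Fin (n i)) → C} (hφ : IsProperList (pathSystem n barbellLab) L φ)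
    (hψ : IsProperList (pathSystem n barbellLab) L ψ) {b b' : Bool}
    (h : φ (endVertex 0 (by omega) b) = ψ (endVertex 0 (by omega) b))
    (h' : φ (endVertex 2 (by omega) b') = ψ (endVertex 2 (by omega) b')) :
    KempeEquiv (pathSystem n barbellLab) L φ ψ := by
  refine kempeEquiv_of_path (fun v => (hL v).ge) hφ hψ
    {p | ¬ (p.1 = 0 ∧ (p.2 : ℕ) = endPos (n 0) b) ∧ ¬ (p.1 = 2 ∧ (p.2 : ℕ) = endPos (n 2) b')} ?_
    (fun p => if p.1 = 0 then endDist (n 0) p.2 b else if p.1 = 1 then n 0 + p.2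
      else n 0 + n 1 + (n 2 - 1 - endDist (n 2) p.2 b')) ?_ ?_
  · rw [sigma_fin_forall]
    intro i s hs hF
    simp only [Set.mem_ofPred_eq] at hF
    by_cases hF' : i = 0 ∧ s = endPos (n 0) b
    · obtain ⟨rfl, rfl⟩ := hF'
      exact h
    · obtain ⟨rfl, rfl⟩ : i = 2 ∧ s = endPos (n 2) b' := by tauto
      exact h'
  · rintro ⟨i, s, hs⟩ hu ⟨j, t, ht⟩ hv hr
    rw [sigma_fin_eq_iff]
    simp only [Set.mem_ofPred_eq] at hu hv hr ⊢
    rcases fin_three_eq i with rfl | rfl | rfl <;> rcases fin_three_eq j with rfl | rfl | rfl <;>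
      cases b <;> cases b' <;> simp [endPos, endDist] at hu hv hr ⊢ <;> omega
  · rintro ⟨i, s, hs⟩ hu ⟨j, t, ht⟩ hv hr
    rw [barbell_adj] at hr
    simp only [Set.mem_ofPred_eq] at hu hv hr ⊢
    rcases fin_three_eq i with rfl | rfl | rfl <;> rcases fin_three_eq j with rfl | rfl | rfl <;>
      cases b <;> cases b' <;> simp [endPos, endDist] at hu hv hr ⊢ <;> omega

/-- Extensions to the interiors of the three paths of a barbell. -/
theorem barbell_exists_coloring (hn0 : 3 ≤ n 0) (hn1 : 0 < n 1) (hn2 : 3 ≤ n 2) {α ζ : Bool → C}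
    {e f : C} (hα : ∀ b, α b ∈ L (endVertex 0 (by omega) b))
    (hζ : ∀ b, ζ b ∈ L (endVertex 2 (by omega) b)) (he : e ∈ L (endVertex 1 hn1 false))
    (hf : f ∈ L (endVertex 1 hn1 true)) (h1 : ∀ b, e ≠ α b) (h2 : ∀ b, f ≠ ζ b)
    (h3 : α false ≠ α true) (h4 : ζ false ≠ ζ true)
    (x0 : PathExt (listAt L 0) (n 0 - 1) (α false) (α true))
    (x1 : PathExt (listAt L 1) (n 1 - 1) e f)
    (x2 : PathExt (listAt L 2) (n 2 - 1) (ζ false) (ζ true)) :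
    ∃ φ, IsProperList (pathSystem n barbellLab) L φ ∧ (∀ b, φ (endVertex 0 (by omega) b) = α b) ∧
      ∀ b, φ (endVertex 2 (by omega) b) = ζ b := by
  obtain ⟨g, a0, a1, am, as⟩ := x0
  obtain ⟨g', b0, b1, bm, bs⟩ := x1
  obtain ⟨g'', c0, c1, cm, cs⟩ := x2
  let F : Fin 3 → ℕ → C := fun i => if i = 0 then g else if i = 1 then g' else g''
  have F0 : F 0 = g := rfl
  have F1 : F 1 = g' := rfl
  have F2 : F 2 = g'' := rfl
  have e0 : ∀ b, F 0 (endPos (n 0) b) = α b := fun b => by cases b <;> simpa [F0, endPos]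
  have e1 : ∀ b, F 1 (endPos (n 1) b) = if b then f else e := fun b => by
    cases b <;> simpa [F1, endPos]
  have e2 : ∀ b, F 2 (endPos (n 2) b) = ζ b := fun b => by cases b <;> simpa [F2, endPos]
  refine ⟨fun p => F p.1 p.2, isProperList_of_fun F ?_ ?_ ?_, e0, e2⟩
  · have key : ∀ i s, ∀ h : s < n i, (∀ s, 0 < s → s < n i - 1 → F i s ∈ listAt L i s) →
        (∀ b, F i (endPos (n i) b) ∈ L (endVertex i (by omega) b)) → F i s ∈ listAt L i s := by
      intro i s hs h1 h2
      by_cases h0 : s = 0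
      · subst h0
        rw [listAt_of_lt hs]
        exact h2 false
      by_cases h' : s = n i - 1
      · subst h'
        rw [listAt_of_lt hs]
        exact h2 true
      · exact h1 s (by omega) (by omega)
    intro i s hs
    refine key i s hs ?_ ?_
    · rcases fin_three_eq i with rfl | rfl | rfl
      · exact am
      · exact bm
      · exact cm
    · rcases fin_three_eq i with rfl | rfl | rfl
      · intro b
        rw [e0]
        exact hα b
      · intro b
        rw [e1]
        cases b
        · exact he
        · exact hf
      · intro b
        rw [e2]
        exact hζ b
  · intro i s hs
    rcases fin_three_eq i with rfl | rfl | rfl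
    · exact as s (by omega)
    · exact bs s (by omega)
    · exact cs s (by omega)
  · intro i j b b' _ _ hl hne
    have h1' := h1 b
    have h1'' := h1 b'
    have h2' := h2 b
    have h2'' := h2 b'
    rcases fin_three_eq i with rfl | rfl | rfl <;> rcases fin_three_eq j with rfl | rfl | rfl <;>
      simp only [e0, e1, e2] <;> cases b <;> cases b' <;>
      simp_all [barbellLab, Ne.symm h1', Ne.symm h1'', Ne.symm h2', Ne.symm h2'', h3.symm, h4.symm]

theorem barbell_card_ends (hn0 : 3 ≤ n 0) (hn1 : 0 < n 1) (hn2 : 3 ≤ n 2)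
    (hL : ∀ v, (L v).card = ((pathSystem n barbellLab).neighborSet v).ncard) (b : Bool) :
    3 ≤ (L (endVertex 0 (by omega) b)).card ∧ 3 ≤ (L (endVertex 2 (by omega) b)).card := by
  rw [hL, hL]
  constructor
  · refine three_le_ncard (a := endVertex 0 (by omega) (!b))
      (b := ⟨0, ⟨nextPos (n 0) b, by cases b <;> simp only [nextPos] <;> omega⟩⟩)
      (c := endVertex 1 hn1 false) ?_ ?_ ?_ ?_ ?_ ?_
    all_goals
      cases b <;> simp [endVertex, endPos, nextPos, barbell_adj] <;>
      (try omega)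
  · refine three_le_ncard (a := endVertex 2 (by omega) (!b))
      (b := ⟨2, ⟨nextPos (n 2) b, by cases b <;> simp only [nextPos] <;> omega⟩⟩)
      (c := endVertex 1 hn1 true) ?_ ?_ ?_ ?_ ?_ ?_
    all_goals
      cases b <;> simp [endVertex, endPos, nextPos, barbell_adj] <;>
      (try omega)

theorem barbell_card_handle (hn0 : 3 ≤ n 0) (hn1 : 2 ≤ n 1) (hn2 : 3 ≤ n 2)
    (hL : ∀ v, (L v).card = ((pathSystem n barbellLab).neighborSet v).ncard) (b : Bool) :
    3 ≤ (L (endVertex 1 (by omega) b)).card := by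
  rw [hL]
  cases b
  · refine three_le_ncard (a := endVertex 0 (by omega) false) (b := endVertex 0 (by omega) true)
      (c := ⟨1, ⟨1, hn1⟩⟩) ?_ ?_ ?_ ?_ ?_ ?_
    all_goals
      simp [endVertex, endPos, barbell_adj] <;>
      (try omega)
  · refine three_le_ncard (a := endVertex 2 (by omega) false) (b := endVertex 2 (by omega) true)
      (c := ⟨1, ⟨n 1 - 2, by omega⟩⟩) ?_ ?_ ?_ ?_ ?_ ?_
    all_goals
      simp [endVertex, endPos, barbell_adj] <;>
      (try omega)

theorem barbell_card_hub (hn0 : 3 ≤ n 0) (hn1 : n 1 = 1) (hn2 : 3 ≤ n 2)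
    (hL : ∀ v, (L v).card = ((pathSystem n barbellLab).neighborSet v).ncard) (b : Bool) :
    4 ≤ (L (endVertex 1 (by omega) b)).card := by
  rw [hL]
  refine four_le_ncard (a := endVertex 0 (by omega) false) (b := endVertex 0 (by omega) true)
    (c := endVertex 2 (by omega) false) (d := endVertex 2 (by omega) true) ?_ ?_ ?_ ?_ ?_ ?_ ?_ ?_
      ?_ ?_
  all_goals
    cases b <;> simp [endVertex, endPos, barbell_adj] <;>
    (try omega)

end Barbell

section Barbell

variable {C : Type*} {n : Fin 3 → ℕ} {L : (Σ i, Fin (n i)) → Finset C}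

theorem exists_mem_ne_pair {A : Finset C} (hA : 3 ≤ A.card) (x : C) :
    ∃ u u', u ≠ u' ∧ u ∈ A ∧ u' ∈ A ∧ u ≠ x ∧ u' ≠ x := by
  obtain ⟨u, hu, h1, -⟩ := exists_mem_ne_ne hA x x
  obtain ⟨u', hu', h2, h3⟩ := exists_mem_ne_ne hA x u
  exact ⟨u, u', h3.symm, hu, hu', h1, h2⟩

/-- The colours `c b`, `d b` at the ends of paths `0` and `2` are unrestricted along these paths. -/
structure FreeEnds (L : (Σ i, Fin (n i)) → Finset C) (h0 : 0 < n 0) (h2 : 0 < n 2)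
    (c d : Bool → C) : Prop where
  memc : ∀ b, c b ∈ L (endVertex 0 h0 b)
  memd : ∀ b, d b ∈ L (endVertex 2 h2 b)
  notc : ∀ b, c b ∉ listAt L 0 (nextPos (n 0) b)
  notd : ∀ b, d b ∉ listAt L 2 (nextPos (n 2) b)

theorem barbell_exists_free (hn0 : 3 ≤ n 0) (hn1 : 0 < n 1) (hn2 : 3 ≤ n 2)
    (hL : ∀ v, (L v).card = ((pathSystem n barbellLab).neighborSet v).ncard) :
    ∃ c d, FreeEnds L (by omega) (by omega) c d := by
  have h1 : ∀ b, ∃ c ∈ L (endVertex 0 (by omega) b), c ∉ listAt L 0 (nextPos (n 0) b) := fun b =>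
    Finset.exists_mem_notMem_of_card_lt_card (by
      rw [card_listAt_nextPos hL hn0]
      exact (barbell_card_ends hn0 hn1 hn2 hL b).1)
  have h2 : ∀ b, ∃ c ∈ L (endVertex 2 (by omega) b), c ∉ listAt L 2 (nextPos (n 2) b) := fun b =>
    Finset.exists_mem_notMem_of_card_lt_card (by
      rw [card_listAt_nextPos hL hn2]
      exact (barbell_card_ends hn0 hn1 hn2 hL b).2)
  choose c hc hc' using h1
  choose d hd hd' using h2
  exact ⟨c, d, hc, hd, hc', hd'⟩

/-- A handle with one vertex has enough colours to avoid both `c` and `d`. In a longer one there are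
two choices for `e`, and at most one of them excludes `f`. -/
theorem barbell_exists_handle (hn0 : 3 ≤ n 0) (hn1 : 0 < n 1) (hn2 : 3 ≤ n 2)
    (hL : ∀ v, (L v).card = ((pathSystem n barbellLab).neighborSet v).ncard) (c d : C) :
    ∃ e ∈ L (endVertex 1 hn1 false), ∃ f ∈ L (endVertex 1 hn1 true), e ≠ c ∧ f ≠ d ∧
      PathExt (listAt L 1) (n 1 - 1) e f := by
  by_cases h1 : n 1 = 1
  · obtain ⟨e, he, h2, h3⟩ := exists_mem_ne_ne ((barbell_card_hub hn0 h1 hn2 hL false).trans'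
      (by omega)) c d
    refine ⟨e, he, e, ?_, h2, h3, fun _ => e, rfl, rfl, fun s _ _ => by omega,
      fun s _ => by omega⟩
    rwa [show endVertex 1 hn1 true = endVertex 1 hn1 false by
      simp [endVertex, endPos, h1]]
  · obtain ⟨e, e', hne, he, he', h2, h3⟩ := exists_mem_ne_pair
      (barbell_card_handle hn0 (by omega) hn2 hL false) c
    obtain ⟨f, hf, h4, -⟩ := exists_mem_ne_ne
      (barbell_card_handle hn0 (by omega) hn2 hL true) d d
    by_cases hX : PathExt (listAt L 1) (n 1 - 1) e f
    · exact ⟨e, he, f, hf, h2, h4, hX⟩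
    · refine ⟨e', he', f, hf, h3, h4, ?_⟩
      by_contra hX'
      exact hne (eq_of_not_pathExt' (by omega) (card_listAt_interior hL 1) hX hX')

theorem barbell_exists_coloring_free (hn0 : 3 ≤ n 0) (hn1 : 0 < n 1) (hn2 : 3 ≤ n 2)
    (hL : ∀ v, (L v).card = ((pathSystem n barbellLab).neighborSet v).ncard) {c d : Bool → C}
    (hf : FreeEnds L (by omega) (by omega) c d) (b b' : Bool) :
    ∃ φ, IsProperList (pathSystem n barbellLab) L φ ∧ φ (endVertex 0 (by omega) b) = c b ∧
      φ (endVertex 2 (by omega) b') = d b' := by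
  obtain ⟨e, he, f, hf', h1, h2, hX⟩ := barbell_exists_handle hn0 hn1 hn2 hL (c b) (d b')
  obtain ⟨u, hu, u1, u2⟩ := exists_mem_ne_ne (barbell_card_ends hn0 hn1 hn2 hL (!b)).1 (c b) e
  obtain ⟨z, hz, z1, z2⟩ := exists_mem_ne_ne (barbell_card_ends hn0 hn1 hn2 hL (!b')).2 (d b') f
  have key : ∀ (b : Bool) (p q : C), q ≠ p → boolPair b p q false ≠ boolPair b p q true := by
    intro b p q h
    cases b
    · simpa [boolPair] using h.symm
    · simpa [boolPair] using h
  obtain ⟨φ, hφ, g1, g2⟩ := barbell_exists_coloring hn0 hn1 hn2 (L := L)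
    (α := boolPair b (c b) u) (ζ := boolPair b' (d b') z)
    ((bool_forall_iff b).2 ⟨by simpa using hf.memc b, by simpa using hu⟩)
    ((bool_forall_iff b').2 ⟨by simpa using hf.memd b', by simpa using hz⟩) he hf'
    ((bool_forall_iff b).2 ⟨by simpa using h1, by simpa using u2.symm⟩)
    ((bool_forall_iff b').2 ⟨by simpa using h2, by simpa using z2.symm⟩)
    (key _ _ _ u1) (key _ _ _ z1)
    (pathExt_of_free hL hn0 (b := b) (by simpa using hf.notc b)) hX
    (pathExt_of_free hL hn2 (b := b') (by simpa using hf.notd b'))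
  exact ⟨φ, hφ, by simp [g1], by simp [g2]⟩

theorem FreeEnds.nbr_zero (hn0 : 3 ≤ n 0) (hn1 : 0 < n 1) {h2 : 0 < n 2} {c d : Bool → C}
    (hf : FreeEnds L (by omega) h2 c d) (i : Bool) (u)
    (hadj : (pathSystem n barbellLab).Adj (endVertex 0 (by omega) i) u) :
    u = endVertex 1 hn1 false ∨ u = endVertex 0 (by omega) (!i) ∨ c i ∉ L u := by
  obtain ⟨k, s, hs⟩ := u
  simp only [endVertex, barbell_adj] at hadj
  by_cases hs1 : k = 0 ∧ s = nextPos (n 0) i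
  · obtain ⟨rfl, rfl⟩ := hs1
    have := hf.notc i
    rw [listAt_of_lt hs] at this
    exact Or.inr (Or.inr this)
  · rcases fin_three_eq k with rfl | rfl | rfl
    · right
      left
      rw [sigma_fin_eq_iff]
      cases i <;> simp [endPos, nextPos, endVertex] at hs1 hadj ⊢ <;> omega
    · left
      rw [sigma_fin_eq_iff]
      cases i <;> simp [endPos, endVertex] at hadj ⊢ <;> omega
    · simp at hadj

theorem FreeEnds.nbr_two (hn1 : 0 < n 1) (hn2 : 3 ≤ n 2) {h0 : 0 < n 0} {c d : Bool → C}
    (hf : FreeEnds L h0 (by omega) c d) (i : Bool) (u)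
    (hadj : (pathSystem n barbellLab).Adj (endVertex 2 (by omega) i) u) :
    u = endVertex 1 hn1 true ∨ u = endVertex 2 (by omega) (!i) ∨ d i ∉ L u := by
  obtain ⟨k, s, hs⟩ := u
  simp only [endVertex, barbell_adj] at hadj
  by_cases hs1 : k = 2 ∧ s = nextPos (n 2) i
  · obtain ⟨rfl, rfl⟩ := hs1
    have := hf.notd i
    rw [listAt_of_lt hs] at this
    exact Or.inr (Or.inr this)
  · rcases fin_three_eq k with rfl | rfl | rfl
    · simp at hadj
    · left
      rw [sigma_fin_eq_iff]
      cases i <;> simp [endPos, endVertex] at hadj ⊢ <;> omega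
    · right
      left
      rw [sigma_fin_eq_iff]
      cases i <;> simp [endPos, nextPos, endVertex] at hs1 hadj ⊢ <;> omega

/-- If the handle has at least two vertices, then one of the unrestricted colours can be used. -/
theorem barbell_exists_kempeEquiv (hn0 : 3 ≤ n 0) (hn1 : 2 ≤ n 1) (hn2 : 3 ≤ n 2)
    (hL : ∀ v, (L v).card = ((pathSystem n barbellLab).neighborSet v).ncard) {c d : Bool → C}
    (hf : FreeEnds L (by omega) (by omega) c d) {φ : (Σ i, Fin (n i)) → C}
    (hφ : IsProperList (pathSystem n barbellLab) L φ) :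
    ∃ ψ, KempeEquiv (pathSystem n barbellLab) L φ ψ ∧
      ((∃ b, ψ (endVertex 0 (by omega) b) = c b) ∨ ∃ b, ψ (endVertex 2 (by omega) b) = d b) := by
  by_contra hcon
  push Not at hcon
  have hs1 := fun ψ hψ => (hcon ψ hψ).1
  have hs2 := fun ψ hψ => (hcon ψ hψ).2
  set x : Bool → Σ i, Fin (n i) := endVertex 0 (by omega) with hx
  set z : Bool → Σ i, Fin (n i) := endVertex 2 (by omega) with hz
  set v := endVertex (n := n) 1 (by omega) false with hv
  set w := endVertex (n := n) 1 (by omega) true with hw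
  obtain ⟨i, hi⟩ : ∃ i, c i = φ v := by
    exact (exists_eq_apex (x := x) hφ hf.memc (hf.nbr_zero hn0 (by omega))).resolve_right
      fun ⟨ψ, hψ, i, hi⟩ => hs1 ψ hψ i hi
  obtain ⟨j, hj⟩ : ∃ j, d j = φ w := by
    exact (exists_eq_apex (x := z) hφ hf.memd (hf.nbr_two (by omega) hn2)).resolve_right
      fun ⟨ψ, hψ, i, hi⟩ => hs2 ψ hψ i hi
  have avx : ∀ b, (pathSystem n barbellLab).Adj v (x b) := by
    intro b
    cases b <;> simp [hv, hx, endVertex, barbell_adj, endPos]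
    omega
  have awz : ∀ b, (pathSystem n barbellLab).Adj w (z b) := by
    intro b
    cases b <;> simp [hw, hz, endVertex, barbell_adj, endPos] <;> omega
  have axx : (pathSystem n barbellLab).Adj (x false) (x true) := by
    simp [hx, endVertex, barbell_adj, endPos]
    omega
  have azz : (pathSystem n barbellLab).Adj (z false) (z true) := by
    simp [hz, endVertex, barbell_adj, endPos]
    omega
  have x0 := pathExt_endVertex hφ 0 (by omega)
  have x1 := pathExt_endVertex hφ 1 (by omega)
  have x2 := pathExt_endVertex hφ 2 (by omega)
  have key : ∀ (b : Bool) (p q : C), q ≠ p → boolPair b p q false ≠ boolPair b p q true := by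
    intro b p q h
    cases b
    · simpa [boolPair] using h.symm
    · simpa [boolPair] using h
  -- By `barbell_forest`, a colouring that shares with `φ` a colour at an end of each of the paths
  -- `0` and `2` is equivalent to `φ`, so it uses no free colour.
  have stuck : ∀ (e f : C) (α ζ : Bool → C), (∀ b, α b ∈ L (x b)) → (∀ b, ζ b ∈ L (z b)) →
      e ∈ L v → f ∈ L w → (∀ b, e ≠ α b) → (∀ b, f ≠ ζ b) → α false ≠ α true →
      ζ false ≠ ζ true → PathExt (listAt L 0) (n 0 - 1) (α false) (α true) →
      PathExt (listAt L 1) (n 1 - 1) e f → PathExt (listAt L 2) (n 2 - 1) (ζ false) (ζ true) →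
      (∃ b, φ (x b) = α b) → (∃ b, φ (z b) = ζ b) → (∀ b, α b ≠ c b) ∧ ∀ b, ζ b ≠ d b := by
    rintro e f α ζ a1 a2 a3 a4 a5 a6 a7 a8 a9 b1 b2 ⟨b, hb⟩ ⟨b', hb'⟩
    obtain ⟨ψ, hψ, g1, g2⟩ := barbell_exists_coloring hn0 (by omega) hn2 a1 a2 a3 a4 a5 a6 a7 a8 a9
      b1 b2
    have := barbell_forest hn0 (by omega) hn2 hL hφ hψ (hb.trans (g1 b).symm)
      (hb'.trans (g2 b').symm)
    exact ⟨fun k hk => hs1 ψ this k ((g1 k).trans hk), fun k hk => hs2 ψ this k ((g2 k).trans hk)⟩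
  -- To pass `c i` from `v` to `x i`, the vertex `v` needs a new colour `m` that also differs from
  -- that of `x (!i)`. As this never succeeds, `m` must be excluded by the colour of `w` along the
  -- handle.
  obtain ⟨m, hm, m1, m2, m3⟩ : ∃ m ∈ L v, m ≠ φ v ∧ m ≠ φ (x (!i)) ∧
      ¬ PathExt (listAt L 1) (n 1 - 1) m (φ w) := by
    have hp : ∀ p ∈ L v, p ≠ φ v → p ≠ φ (x (!i)) → ¬ PathExt (listAt L 1) (n 1 - 1) p (φ w) := by
      intro p hp p1 p2 hX
      refine (stuck p (φ w) (boolPair i (c i) (φ (x (!i)))) (fun b => φ (z b))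
        ((bool_forall_iff i).2 ⟨by simpa using hf.memc i, by simpa using hφ.1 _⟩)
        (fun b => hφ.1 _) hp (hφ.1 _)
        ((bool_forall_iff i).2 ⟨by simpa [hi] using p1, by simpa using p2⟩)
        (fun b => hφ.2 _ _ (awz b)) (key _ _ _ (hi ▸ (hφ.2 _ _ (avx (!i))).symm))
        (hφ.2 _ _ azz) (pathExt_of_free hL hn0 (b := i) (by simpa using hf.notc i)) hX x2
        ⟨!i, by simp⟩ ⟨true, rfl⟩).1 i (by simp)
    obtain ⟨m, m', hne, hm, hm', h1, h2⟩ :=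
      exists_mem_ne_pair (barbell_card_handle hn0 hn1 hn2 hL false) (φ v)
    by_cases h3 : m = φ (x (!i))
    · have h4 : m' ≠ φ (x (!i)) := fun h => hne (h3.trans h.symm)
      exact ⟨m', hm', h2, h4, hp m' hm' h2 h4⟩
    · exact ⟨m, hm, h1, h3, hp m hm h1 h3⟩
  obtain ⟨m', hm', k1, k2, k3⟩ : ∃ m ∈ L w, m ≠ φ w ∧ m ≠ φ (z (!j)) ∧
      ¬ PathExt (listAt L 1) (n 1 - 1) (φ v) m := by
    have hp : ∀ p ∈ L w, p ≠ φ w → p ≠ φ (z (!j)) → ¬ PathExt (listAt L 1) (n 1 - 1) (φ v) p := by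
      intro p hp p1 p2 hX
      refine (stuck (φ v) p (fun b => φ (x b)) (boolPair j (d j) (φ (z (!j))))
        (fun b => hφ.1 _)
        ((bool_forall_iff j).2 ⟨by simpa using hf.memd j, by simpa using hφ.1 _⟩)
        (hφ.1 _) hp (fun b => hφ.2 _ _ (avx b))
        ((bool_forall_iff j).2 ⟨by simpa [hj] using p1, by simpa using p2⟩)
        (hφ.2 _ _ axx) (key _ _ _ (hj ▸ (hφ.2 _ _ (awz (!j))).symm))
        x0 hX (pathExt_of_free hL hn2 (b := j) (by simpa using hf.notd j))
        ⟨true, rfl⟩ ⟨!j, by simp⟩).2 j (by simp)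
    obtain ⟨m, m', hne, hm, hm', h1, h2⟩ :=
      exists_mem_ne_pair (barbell_card_handle hn0 hn1 hn2 hL true) (φ w)
    by_cases h3 : m = φ (z (!j))
    · have h4 : m' ≠ φ (z (!j)) := fun h => hne (h3.trans h.symm)
      exact ⟨m', hm', h2, h4, hp m' hm' h2 h4⟩
    · exact ⟨m, hm, h1, h3, hp m hm h1 h3⟩
  -- Since `m` excludes only the colour of `w`, it is compatible with `m'`. Both ends of the handle
  -- can be recoloured at once, so `x i` and `z j` receive their free colours after all.
  have hX : PathExt (listAt L 1) (n 1 - 1) m m' := by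
    by_contra h
    exact k1 (eq_of_not_pathExt (by omega) (card_listAt_interior hL 1) h m3)
  exact (stuck m m' (boolPair i (c i) (φ (x (!i)))) (boolPair j (d j) (φ (z (!j))))
    ((bool_forall_iff i).2 ⟨by simpa using hf.memc i, by simpa using hφ.1 _⟩)
    ((bool_forall_iff j).2 ⟨by simpa using hf.memd j, by simpa using hφ.1 _⟩) hm hm'
    ((bool_forall_iff i).2 ⟨by simpa [hi] using m1, by simpa using m2⟩)
    ((bool_forall_iff j).2 ⟨by simpa [hj] using k1, by simpa using k2⟩)
    (key _ _ _ (hi ▸ (hφ.2 _ _ (avx (!i))).symm)) (key _ _ _ (hj ▸ (hφ.2 _ _ (awz (!j))).symm))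
    (pathExt_of_free hL hn0 (b := i) (by simpa using hf.notc i)) hX
    (pathExt_of_free hL hn2 (b := j) (by simpa using hf.notd j))
    ⟨!i, by simp⟩ ⟨!j, by simp⟩).1 i (by simp)

theorem barbell_hub (hn0 : 3 ≤ n 0) (hn1 : n 1 = 1) (hn2 : 3 ≤ n 2) {c d : Bool → C}
    (hf : FreeEnds L (by omega) (by omega) c d) :
    Hub (pathSystem n barbellLab) L (endVertex 1 (by omega) false) (endVertex 0 (by omega))
      (endVertex 2 (by omega)) c d := by
  refine ⟨?_, ?_, ?_, ?_, ?_, ?_, hf.memc, hf.memd, ?_, ?_⟩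
  · rintro ⟨k, s, hs⟩ hadj
    simp only [endVertex, barbell_adj, endPos] at hadj
    simp only [Bool.exists_bool, endVertex, sigma_fin_eq_iff, endPos]
    rcases fin_three_eq k with rfl | rfl | rfl <;> simp at hadj ⊢ <;> omega
  · intro b
    cases b <;> simp [endVertex, barbell_adj, endPos]
    omega
  · intro b
    cases b <;> simp [endVertex, barbell_adj, endPos] <;> omega
  · intro b
    cases b <;> simp [endVertex, barbell_adj, endPos] <;> omega
  · intro b
    cases b <;> simp [endVertex, barbell_adj, endPos] <;> omega
  · intro b b'
    simp [endVertex]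
  · exact hf.nbr_zero hn0 (by omega)
  · have := hf.nbr_two (by omega) hn2
    rwa [show endVertex 1 (by omega) true = endVertex (n := n) 1 (by omega) false by
      simp [endVertex, endPos, hn1]] at this

/-- Any free colour on path `0` occurs together with any free colour on path `2` in some colouring,
which joins all classes. -/
theorem barbell_swappable (hn0 : 3 ≤ n 0) (hn1 : 0 < n 1) (hn2 : 3 ≤ n 2)
    (hL : ∀ v, (L v).card = ((pathSystem n barbellLab).neighborSet v).ncard) :
    Swappable (pathSystem n barbellLab) L := by
  obtain ⟨c, d, hf⟩ := barbell_exists_free hn0 hn1 hn2 hL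
  obtain ⟨φ₀, p0, c0, d0⟩ := barbell_exists_coloring_free hn0 hn1 hn2 hL hf false false
  have core : ∀ φ, IsProperList (pathSystem n barbellLab) L φ →
      ∃ ψ, KempeEquiv (pathSystem n barbellLab) L φ ψ ∧
        ((∃ b, ψ (endVertex 0 (by omega) b) = c b) ∨
          ∃ b, ψ (endVertex 2 (by omega) b) = d b) := by
    intro φ hφ
    by_cases h1 : n 1 = 1
    · exact (barbell_hub hn0 h1 hn2 hf).exists_kempeEquiv (barbell_card_hub hn0 h1 hn2 hL false) hφ
    · exact barbell_exists_kempeEquiv hn0 (by omega) hn2 hL hf hφ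
  have key : ∀ φ, IsProperList (pathSystem n barbellLab) L φ →
      KempeEquiv (pathSystem n barbellLab) L φ φ₀ := by
    intro φ hφ
    obtain ⟨ψ, e, ⟨b, hb⟩ | ⟨b, hb⟩⟩ := core φ hφ
    · have hψ := e.isProperList hφ
      obtain ⟨χ, hχ, h1, h2⟩ := barbell_exists_coloring_free hn0 hn1 hn2 hL hf b false
      exact (e.trans (barbell_fix_zero hn0 hn1 hn2 hL hψ hχ (hb.trans h1.symm)
        (hb ▸ hf.notc b))).trans (barbell_fix_two hn0 hn1 hn2 hL hχ p0 (h2.trans d0.symm)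
        (h2 ▸ hf.notd false))
    · have hψ := e.isProperList hφ
      obtain ⟨χ, hχ, h1, h2⟩ := barbell_exists_coloring_free hn0 hn1 hn2 hL hf false b
      exact (e.trans (barbell_fix_two hn0 hn1 hn2 hL hψ hχ (hb.trans h2.symm)
        (hb ▸ hf.notd b))).trans (barbell_fix_zero hn0 hn1 hn2 hL hχ p0 (h1.trans c0.symm)
        (h1 ▸ hf.notc false))
  exact fun φ ψ hφ hψ => (key φ hφ).trans (key ψ hψ).symm

end Barbell

/-! ### Short barbells -/

section Short

variable {C : Type*} {n : Fin 3 → ℕ} {L : (Σ i, Fin (n i)) → Finset C}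

/-- All ends of paths are joined to each other. -/
def shortLab : Fin 3 → Bool → Bool := fun _ _ => false

theorem short_adj {i j : Fin 3} {s t : ℕ} {hs : s < n i} {ht : t < n j} :
    (pathSystem n shortLab).Adj ⟨i, ⟨s, hs⟩⟩ ⟨j, ⟨t, ht⟩⟩ ↔
      (i = j ∧ (s + 1 = t ∨ t + 1 = s)) ∨
      (¬ (i = j ∧ s = t) ∧ (s = 0 ∨ s + 1 = n i) ∧ (t = 0 ∨ t + 1 = n j)) := by
  rw [pathSystem_adj]
  simp only [shortLab, and_true]
  tauto

/-- The two non-empty paths of a short barbell. -/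
def shortPath : Bool → Fin 3
  | false => 0
  | true => 2

theorem shortPath_injective {a b : Bool} (h : shortPath a = shortPath b) : a = b := by
  revert a b
  decide

theorem shortPath_cover (hn1 : n 1 = 0) {k : Fin 3} {s : ℕ} (hs : s < n k) :
    ∃ a, k = shortPath a := by
  rcases fin_three_eq k with rfl | rfl | rfl
  · exact ⟨false, rfl⟩
  · omega
  · exact ⟨true, rfl⟩

/-- The ends of the two non-empty paths of a short barbell. -/
def shortEnd (hn : ∀ a, 3 ≤ n (shortPath a)) (p : Bool × Bool) : Σ i, Fin (n i) :=
  endVertex (shortPath p.1) (by have := hn p.1; omega) p.2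

theorem shortEnd_adj (hn : ∀ a, 3 ≤ n (shortPath a)) {p q : Bool × Bool} (hpq : p ≠ q) :
    (pathSystem n shortLab).Adj (shortEnd hn p) (shortEnd hn q) := by
  obtain ⟨a, b⟩ := p
  obtain ⟨a', b'⟩ := q
  have h1 := hn a
  have h2 := hn a'
  simp only [shortEnd, endVertex, short_adj]
  refine Or.inr ⟨?_, ?_, ?_⟩
  · rintro ⟨h3, h4⟩
    obtain rfl := shortPath_injective h3
    cases b <;> cases b' <;> simp [endPos] at h4 hpq <;> omega
  · cases b <;> simp [endPos]
    omega
  · cases b' <;> simp [endPos]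
    omega

/-- The colours at an end of a path that do not restrict the remaining path. -/
noncomputable def shortFree (hn : ∀ a, 3 ≤ n (shortPath a)) (L : (Σ i, Fin (n i)) → Finset C)
    (p : Bool × Bool) : Finset C :=
  open Classical in
  L (shortEnd hn p) \ listAt L (shortPath p.1) (nextPos (n (shortPath p.1)) p.2)

theorem mem_shortFree {hn : ∀ a, 3 ≤ n (shortPath a)} {p : Bool × Bool} {c : C} :
    c ∈ shortFree hn L p ↔ c ∈ L (shortEnd hn p) ∧
      c ∉ listAt L (shortPath p.1) (nextPos (n (shortPath p.1)) p.2) := by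
  simp [shortFree]

/-- Besides the clique of ends, an end has only its interior neighbour, whose list contains no free
colour by definition. -/
theorem short_nbr (hn : ∀ a, 3 ≤ n (shortPath a)) (hn1 : n 1 = 0) (p : Bool × Bool) (u)
    (hadj : (pathSystem n shortLab).Adj (shortEnd hn p) u) :
    (∃ q, u = shortEnd hn q) ∨ ∀ c ∈ shortFree hn L p, c ∉ L u := by
  obtain ⟨k, s, hs⟩ := u
  obtain ⟨a, rfl⟩ := shortPath_cover hn1 hs
  by_cases h0 : s = 0
  · subst h0
    exact Or.inl ⟨(a, false), rfl⟩
  by_cases h1 : s = n (shortPath a) - 1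
  · subst h1
    exact Or.inl ⟨(a, true), rfl⟩
  right
  intro c hc
  obtain ⟨b, e⟩ := p
  have := hn b
  have h2 := (mem_shortFree.1 hc).2
  simp only [shortEnd, endVertex, short_adj] at hadj h2
  rcases hadj with ⟨h3, h4⟩ | ⟨-, -, h4⟩
  · obtain rfl := shortPath_injective h3
    obtain rfl : s = nextPos (n (shortPath b)) e := by
      cases e <;> simp only [endPos, nextPos] at h4 ⊢ <;> omega
    rwa [listAt_of_lt hs] at h2
  · omega

theorem short_card (hn : ∀ a, 3 ≤ n (shortPath a))
    (hL : ∀ v, (L v).card = ((pathSystem n shortLab).neighborSet v).ncard) (p : Bool × Bool) :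
    4 ≤ (L (shortEnd hn p)).card := by
  rw [hL]
  obtain ⟨a, b⟩ := p
  have h1 := hn a
  have h2 := hn (!a)
  have ha : shortPath a ≠ shortPath (!a) := fun h => by simpa using shortPath_injective h
  refine four_le_ncard (a := shortEnd hn (a, !b)) (b := shortEnd hn (!a, false))
    (c := shortEnd hn (!a, true))
    (d := ⟨shortPath a, ⟨nextPos (n (shortPath a)) b, by
      cases b <;> simp only [nextPos] <;> omega⟩⟩) (shortEnd_adj hn (by simp))
    (shortEnd_adj hn (by simp)) (shortEnd_adj hn (by simp)) ?_
    (shortEnd_adj hn (by simp)).ne (shortEnd_adj hn (by simp)).ne ?_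
    (shortEnd_adj hn (by simp)).ne ?_ ?_
  · simp only [SimpleGraph.mem_neighborSet, shortEnd, endVertex, short_adj, true_and]
    left
    cases b <;> simp [endPos, nextPos]
    omega
  · rw [ne_eq, sigma_fin_eq_iff]
    cases b <;> simp [shortEnd, endVertex, endPos, nextPos] <;> omega
  · rw [ne_eq, sigma_fin_eq_iff]
    simp [shortEnd, endVertex, ha.symm]
  · rw [ne_eq, sigma_fin_eq_iff]
    simp [shortEnd, endVertex, ha.symm]

theorem short_card_free (hn : ∀ a, 3 ≤ n (shortPath a))
    (hL : ∀ v, (L v).card = ((pathSystem n shortLab).neighborSet v).ncard) (p : Bool × Bool) :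
    2 ≤ (shortFree hn L p).card := by
  classical
  have h1 := short_card hn hL p
  have h2 := card_listAt_nextPos hL (hn p.1) p.2
  have h3 := Finset.le_card_sdiff (listAt L (shortPath p.1) (nextPos (n (shortPath p.1)) p.2))
    (L (shortEnd hn p))
  have h4 : shortFree hn L p =
      L (shortEnd hn p) \ listAt L (shortPath p.1) (nextPos (n (shortPath p.1)) p.2) := by
    ext c
    simp [mem_shortFree]
  rw [h4]
  omega

/-- The ranks start at the interior neighbour of the fixed end, follow its path to the other end and
continue along the second path. -/
theorem short_fix (hn : ∀ a, 3 ≤ n (shortPath a)) (hn1 : n 1 = 0)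
    (hL : ∀ v, (L v).card = ((pathSystem n shortLab).neighborSet v).ncard)
    {φ ψ : (Σ i, Fin (n i)) → C} (hφ : IsProperList (pathSystem n shortLab) L φ)
    (hψ : IsProperList (pathSystem n shortLab) L ψ) {p : Bool × Bool}
    (h : φ (shortEnd hn p) = ψ (shortEnd hn p)) (hg : φ (shortEnd hn p) ∈ shortFree hn L p) :
    KempeEquiv (pathSystem n shortLab) L φ ψ := by
  obtain ⟨a, b⟩ := p
  have h1 := hn a
  have h2 := hn (!a)
  refine kempeEquiv_of_spare (fun v => (hL v).ge) hφ hψ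
    {q | ¬ (q.1 = shortPath a ∧ (q.2 : ℕ) = endPos (n (shortPath a)) b)} ?_
    (fun q => if q.1 = shortPath a then endDist (n (shortPath a)) q.2 b
      else n (shortPath a) + q.2) ?_
  · rw [sigma_fin_forall]
    intro i s hs hF
    simp only [Set.mem_ofPred_eq, not_not] at hF
    obtain ⟨rfl, rfl⟩ := hF
    exact h
  · rintro ⟨k, s, hs⟩ hF
    simp only [Set.mem_ofPred_eq] at hF
    obtain ⟨a', rfl⟩ := shortPath_cover hn1 hs
    by_cases ha : a' = a
    · subst ha
      have hF : s ≠ endPos (n (shortPath a')) b := fun h => hF ⟨rfl, h⟩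
      by_cases hs1 : s = nextPos (n (shortPath a')) b
      · subst hs1
        refine Or.inl ⟨shortEnd hn (a', b), ?_, by simp [shortEnd, endVertex], ?_⟩
        · cases b <;> simp [shortEnd, endVertex, short_adj, nextPos, endPos]
          omega
        · have := (mem_shortFree.1 hg).2
          rwa [listAt_of_lt hs] at this
      · right
        cases b
        · simp only [endPos, nextPos] at hF hs1
          refine ⟨⟨shortPath a', ⟨s - 1, by omega⟩⟩, ?_, ?_, ?_⟩
          · simp [endPos]
            omega
          · simp [short_adj]
            omega
          · simp [endDist]
            omega
        · simp only [endPos, nextPos] at hF hs1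
          refine ⟨⟨shortPath a', ⟨s + 1, by omega⟩⟩, ?_, ?_, ?_⟩
          · simp [endPos]
            omega
          · simp [short_adj]
          · simp [endDist]
            omega
    · have hne : shortPath a' ≠ shortPath a := fun h => ha (shortPath_injective h)
      right
      by_cases hs0 : s = 0
      · subst hs0
        refine ⟨shortEnd hn (a, !b), ?_, ?_, ?_⟩
        · cases b <;> simp [shortEnd, endVertex, endPos] <;> omega
        · exact shortEnd_adj hn (p := (a', false)) (by simp [ha])
        · cases b <;> simp [shortEnd, endVertex, endDist, endPos, hne] <;> omega
      · refine ⟨⟨shortPath a', ⟨s - 1, by omega⟩⟩, ?_, ?_, ?_⟩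
        · simp [hne]
        · simp [short_adj]
          omega
        · simp [hne]
          omega

/-- Extensions to the interiors of the two paths of a short barbell. -/
theorem short_exists_coloring (hn : ∀ a, 3 ≤ n (shortPath a)) (hn1 : n 1 = 0)
    {α : Bool → Bool → C} (hα : ∀ a b, α a b ∈ L (shortEnd hn (a, b)))
    (h1 : ∀ a, α a false ≠ α a true) (h2 : ∀ b b', α false b ≠ α true b')
    (hX : ∀ a, PathExt (listAt L (shortPath a)) (n (shortPath a) - 1) (α a false) (α a true)) :
    ∃ φ, IsProperList (pathSystem n shortLab) L φ ∧ ∀ a b, φ (shortEnd hn (a, b)) = α a b := by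
  choose g g0 g1 gm gs using hX
  let F : Fin 3 → ℕ → C := fun i => if i = 0 then g false else g true
  have Fa : ∀ a, F (shortPath a) = g a := by
    intro a
    cases a <;> rfl
  have e : ∀ a b, F (shortPath a) (endPos (n (shortPath a)) b) = α a b := by
    intro a b
    rw [Fa]
    cases b
    · exact g0 a
    · exact g1 a
  refine ⟨fun p => F p.1 p.2, isProperList_of_fun F ?_ ?_ ?_, e⟩
  · intro k s hs
    obtain ⟨a, rfl⟩ := shortPath_cover hn1 hs
    by_cases h0 : s = 0
    · subst h0
      rw [listAt_of_lt hs, show F (shortPath a) 0 = α a false from e a false]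
      exact hα a false
    by_cases h' : s = n (shortPath a) - 1
    · subst h'
      rw [listAt_of_lt hs, show F (shortPath a) (n (shortPath a) - 1) = α a true from e a true]
      exact hα a true
    · rw [Fa]
      exact gm a s (by omega) (by omega)
  · intro k s hs
    obtain ⟨a, rfl⟩ := shortPath_cover hn1 hs
    rw [Fa]
    exact gs a s (by omega)
  · intro i j b b' hi hj _ hne
    obtain ⟨a, rfl⟩ := shortPath_cover hn1 hi
    obtain ⟨a', rfl⟩ := shortPath_cover hn1 hj
    rw [e, e]
    have h1' := h1 a
    have h2' := h2 b b'
    have h2'' := h2 b' b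
    cases a <;> cases a' <;> first | exact h2' | exact h2''.symm | skip
    all_goals
      cases b <;> cases b' <;> first | exact h1' | exact h1'.symm | exact absurd ⟨rfl, rfl⟩ hne

/-- Two four-element lists at the ends of a path of odd length contain admissible colours different
from two given ones. -/
theorem exists_pathExt_of_odd {A B : Finset C} (hA : 4 ≤ A.card) (hB : 4 ≤ B.card) {m : ℕ}
    (hm : Odd m) {M : ℕ → Finset C} (hM : ∀ s, 0 < s → s < m → (M s).card = 2) (s t : C) :
    ∃ p ∈ A, ∃ q ∈ B, (p ≠ s ∧ p ≠ t) ∧ (q ≠ s ∧ q ≠ t) ∧ p ≠ q ∧ PathExt M m p q := by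
  by_contra hcon
  push Not at hcon
  have hm0 : 0 < m := hm.pos
  -- A colour `p` outside `B` would exclude two different colours of `B`.
  have key : ∀ p ∈ A, p ≠ s → p ≠ t → p ∈ B := by
    intro p hp h1 h2
    by_contra hpB
    obtain ⟨q, hq, q1, q2⟩ := exists_mem_ne_ne (hB.trans' (by omega)) s t
    obtain ⟨q', hq', q3, q4, hne⟩ := exists_mem_ne_ne_ne hB s t q
    exact hne (eq_of_not_pathExt hm0 hM
      (hcon p hp q' hq' ⟨h1, h2⟩ ⟨q3, q4⟩ (fun h => hpB (h ▸ hq')))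
      (hcon p hp q hq ⟨h1, h2⟩ ⟨q1, q2⟩ (fun h => hpB (h ▸ hq))))
  obtain ⟨p, hp, p1, p2⟩ := exists_mem_ne_ne (hA.trans' (by omega)) s t
  obtain ⟨q, hq, q1, q2, hne⟩ := exists_mem_ne_ne_ne hA s t p
  -- The pairs `(p, q)` and `(q, p)` are both excluded, but a path with an odd number of edges can
  -- only exclude equal pairs here.
  exact hne ((not_pathExt_parity hm0 hM hne.symm
    (hcon p hp q (key q hq q1 q2) ⟨p1, p2⟩ ⟨q1, q2⟩ hne.symm)
    (hcon q hq p (key p hp p1 p2) ⟨q1, q2⟩ ⟨p1, p2⟩ hne) (Or.inr rfl)).2 hm)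

theorem boolPair_ne {b : Bool} {p q : C} (h : p ≠ q) : boolPair b p q false ≠ boolPair b p q true := by
  cases b
  · simpa [boolPair] using h
  · simpa [boolPair] using h.symm


/-- If both colours sit on one path, the other path must avoid them at both ends; it has an even
number of vertices, hence an odd number of edges, and `exists_pathExt_of_odd` applies. If they sit
on different paths, neither path is restricted and the remaining ends are chosen greedily. -/
theorem short_exists_coloring_free (hn : ∀ a, 3 ≤ n (shortPath a)) (hn1 : n 1 = 0)
    (heven : ∀ a, Even (n (shortPath a)))
    (hL : ∀ v, (L v).card = ((pathSystem n shortLab).neighborSet v).ncard) {p q : Bool × Bool}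
    (hpq : p ≠ q) {s t : C} (hst : s ≠ t) (hs : s ∈ shortFree hn L p) (ht : t ∈ shortFree hn L q) :
    ∃ φ, IsProperList (pathSystem n shortLab) L φ ∧ φ (shortEnd hn p) = s ∧
      φ (shortEnd hn q) = t := by
  obtain ⟨a, b⟩ := p
  obtain ⟨a', b'⟩ := q
  have hs1 := (mem_shortFree.1 hs).1
  have hs2 := (mem_shortFree.1 hs).2
  have ht1 := (mem_shortFree.1 ht).1
  have ht2 := (mem_shortFree.1 ht).2
  simp only at hs2 ht2
  have cross : ∀ (a : Bool) (f g : Bool → C), (∀ b b', f b ≠ g b') →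
      ∀ b b', boolPair a f g false b ≠ boolPair a f g true b' := by
    intro a f g h b b'
    cases a
    · simpa [boolPair] using h b b'
    · simpa [boolPair] using (h b' b).symm
  by_cases ha : a' = a
  · subst ha
    have hb : b' ≠ b := by
      rintro rfl
      exact hpq rfl
    obtain rfl := Bool.eq_not_of_ne hb
    have := hn (!a')
    obtain ⟨u, hu, v, hv, ⟨u1, u2⟩, ⟨v1, v2⟩, huv, hX⟩ := exists_pathExt_of_odd
      (short_card hn hL (!a', false)) (short_card hn hL (!a', true))
      (m := n (shortPath !a') - 1) (Nat.Even.sub_odd (by omega) (heven _) odd_one)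
      (card_listAt_interior hL _) s t
    obtain ⟨φ, hφ, h⟩ := short_exists_coloring hn hn1 (L := L)
      (α := boolPair a' (boolPair b s t) (boolPair false u v))
      ((bool_forall_iff a').2 ⟨(bool_forall_iff b).2 ⟨by simpa using hs1, by simpa using ht1⟩,
        (bool_forall_iff false).2 ⟨by simpa using hu, by simpa using hv⟩⟩)
      ((bool_forall_iff a').2 ⟨by simpa using boolPair_ne hst, by simpa using huv⟩)
      (cross _ _ _ ((bool_forall_iff b).2
        ⟨(bool_forall_iff false).2 ⟨by simpa using u1.symm, by simpa using v1.symm⟩,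
         (bool_forall_iff false).2 ⟨by simpa using u2.symm, by simpa using v2.symm⟩⟩))
      ((bool_forall_iff a').2 ⟨by
        simpa using pathExt_of_free hL (hn a') (b := b) (α := boolPair b s t) (by simpa using hs2),
        by simpa using hX⟩)
    exact ⟨φ, hφ, by simp [h], by simp [h]⟩
  · obtain rfl := Bool.eq_not_of_ne ha
    obtain ⟨u, hu, u1, u2⟩ := exists_mem_ne_ne ((short_card hn hL (a, !b)).trans' (by omega)) s t
    obtain ⟨v, hv, v1, v2, v3⟩ := exists_mem_ne_ne_ne (short_card hn hL (!a, !b')) s t u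
    obtain ⟨φ, hφ, h⟩ := short_exists_coloring hn hn1 (L := L)
      (α := boolPair a (boolPair b s u) (boolPair b' t v))
      ((bool_forall_iff a).2 ⟨(bool_forall_iff b).2 ⟨by simpa using hs1, by simpa using hu⟩,
        (bool_forall_iff b').2 ⟨by simpa using ht1, by simpa using hv⟩⟩)
      ((bool_forall_iff a).2 ⟨by simpa using boolPair_ne u1.symm,
        by simpa using boolPair_ne v2.symm⟩)
      (cross _ _ _ ((bool_forall_iff b).2
        ⟨(bool_forall_iff b').2 ⟨by simpa using hst, by simpa using v1.symm⟩,
         (bool_forall_iff b').2 ⟨by simpa using u2, by simpa using v3.symm⟩⟩))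
      ((bool_forall_iff a).2 ⟨by
        simpa using pathExt_of_free hL (hn a) (b := b) (α := boolPair b s u) (by simpa using hs2),
        by
        simpa using pathExt_of_free hL (hn !a) (b := b') (α := boolPair b' t v)
          (by simpa using ht2)⟩)
    exact ⟨φ, hφ, by simp [h], by simp [h]⟩

/-- Different free colours at different ends are linked by a common colouring. Equal colours are
linked through a third end, and two colours at the same end through another end. -/
theorem short_swappable (hn : ∀ a, 3 ≤ n (shortPath a)) (hn1 : n 1 = 0)
    (heven : ∀ a, Even (n (shortPath a)))
    (hL : ∀ v, (L v).card = ((pathSystem n shortLab).neighborSet v).ncard) :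
    Swappable (pathSystem n shortLab) L := by
  have ex : ∀ p c, ∃ s ∈ shortFree hn L p, s ≠ c := fun p c =>
    Finset.exists_mem_ne (short_card_free hn hL p) c
  have link1 : ∀ {p q s t}, p ≠ q → s ≠ t → s ∈ shortFree hn L p → t ∈ shortFree hn L q →
      ∀ {φ ψ}, IsProperList (pathSystem n shortLab) L φ → IsProperList (pathSystem n shortLab) L ψ →
      φ (shortEnd hn p) = s → ψ (shortEnd hn q) = t →
      KempeEquiv (pathSystem n shortLab) L φ ψ := by
    rintro p q s t hpq hst hs ht φ ψ hφ hψ rfl rfl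
    obtain ⟨χ, hχ, h1, h2⟩ := short_exists_coloring_free hn hn1 heven hL hpq hst hs ht
    exact (short_fix hn hn1 hL hφ hχ h1.symm hs).trans
      (short_fix hn hn1 hL hψ hχ h2.symm ht).symm
  have exc : ∀ {p s}, s ∈ shortFree hn L p → ∃ χ, IsProperList (pathSystem n shortLab) L χ ∧
      χ (shortEnd hn p) = s := by
    intro p s hs
    obtain ⟨t, ht, hts⟩ := ex (!p.1, p.2) s
    obtain ⟨χ, hχ, h1, -⟩ := short_exists_coloring_free hn hn1 heven hL
      (p := p) (q := (!p.1, p.2)) (fun h => by simpa using congrArg Prod.fst h) hts.symm hs ht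
    exact ⟨χ, hχ, h1⟩
  have link2 : ∀ {p q s t}, p ≠ q → s ∈ shortFree hn L p → t ∈ shortFree hn L q →
      ∀ {φ ψ}, IsProperList (pathSystem n shortLab) L φ → IsProperList (pathSystem n shortLab) L ψ →
      φ (shortEnd hn p) = s → ψ (shortEnd hn q) = t →
      KempeEquiv (pathSystem n shortLab) L φ ψ := by
    intro p q s t hpq hs ht φ ψ hφ hψ h1 h2
    by_cases hst : s = t
    · obtain ⟨r, hrp, hrq⟩ : ∃ r : Bool × Bool, r ≠ p ∧ r ≠ q :=
        (by decide : ∀ p q : Bool × Bool, ∃ r, r ≠ p ∧ r ≠ q) p q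
      obtain ⟨c, hc, hcs⟩ := ex r s
      obtain ⟨χ, hχ, h3⟩ := exc hc
      exact (link1 hrp.symm hcs.symm hs hc hφ hχ h1 h3).trans
        (link1 hrq (hst ▸ hcs) hc ht hχ hψ h3 h2)
    · exact link1 hpq hst hs ht hφ hψ h1 h2
  have link3 : ∀ {p q s t}, s ∈ shortFree hn L p → t ∈ shortFree hn L q →
      ∀ {φ ψ}, IsProperList (pathSystem n shortLab) L φ → IsProperList (pathSystem n shortLab) L ψ →
      φ (shortEnd hn p) = s → ψ (shortEnd hn q) = t →
      KempeEquiv (pathSystem n shortLab) L φ ψ := by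
    intro p q s t hs ht φ ψ hφ hψ h1 h2
    by_cases hpq : p = q
    · subst hpq
      obtain ⟨c, hc, -⟩ := ex (!p.1, p.2) s
      obtain ⟨χ, hχ, h3⟩ := exc hc
      have hne : p ≠ (!p.1, p.2) := fun h => by simpa using congrArg Prod.fst h
      exact (link2 hne hs hc hφ hχ h1 h3).trans (link2 hne.symm hc ht hχ hψ h3 h2)
    · exact link2 hpq hs ht hφ hψ h1 h2
  have core : ∀ φ, IsProperList (pathSystem n shortLab) L φ →
      ∃ ψ, KempeEquiv (pathSystem n shortLab) L φ ψ ∧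
        ∃ p, ψ (shortEnd hn p) ∈ shortFree hn L p := by
    intro φ hφ
    let e : Fin 4 → Bool × Bool := ![(false, false), (false, true), (true, false), (true, true)]
    have e1 : ∀ i j, i ≠ j → e i ≠ e j := by decide
    have e2 : ∀ p, ∃ i, e i = p := by decide
    obtain ⟨ψ, h, i, hi⟩ := exists_kempeEquiv_of_clique hφ (K := fun i => shortEnd hn (e i))
      (fun i j hij => shortEnd_adj hn (e1 i j hij)) (U := fun i => shortFree hn L (e i))
      (fun i => short_card_free hn hL _) (fun i c hc => (mem_shortFree.1 hc).1) (by
        intro i u hu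
        rcases short_nbr hn hn1 (L := L) (e i) u hu with ⟨q, rfl⟩ | h
        · obtain ⟨j, rfl⟩ := e2 q
          exact Or.inl ⟨j, rfl⟩
        · exact Or.inr h)
    exact ⟨ψ, h, _, hi⟩
  intro φ ψ hφ hψ
  obtain ⟨φ', h1, p, hp⟩ := core φ hφ
  obtain ⟨ψ', h2, q, hq⟩ := core ψ hψ
  exact (h1.trans (link3 hp hq (h1.isProperList hφ) (h2.isProperList hψ) rfl rfl)).trans h2.symm

end Short

/-! ### The graph `K₄ □ K₂` -/

section Greedy

variable {V C : Type*} [Finite V] {G : SimpleGraph V} {L : V → Finset C}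

/-- Greedy extension of a partial colouring from the complement of `F`: every vertex of `F` is
linked inside `F` to a vertex with a spare colour. -/
theorem exists_isProperList_of_spare (hd : ∀ v, (G.neighborSet v).ncard ≤ (L v).card) (r : V → ℕ)
    (m : ℕ) : ∀ (F : Finset V) (_ : F.card = m) (φ : V → C) (_ : ∀ v ∉ F, φ v ∈ L v)
    (_ : ∀ u ∉ F, ∀ v ∉ F, G.Adj u v → φ u ≠ φ v)
    (_ : ∀ v ∈ F, (∃ u, G.Adj v u ∧ u ∉ F ∧ φ u ∉ L v) ∨ ∃ u ∈ F, G.Adj v u ∧ r u < r v),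
    ∃ ψ, IsProperList G L ψ ∧ ∀ v ∉ F, ψ v = φ v := by
  classical
  have : Fintype V := Fintype.ofFinite V
  induction m with
  | zero =>
    intro F hF φ h1 h2 _
    obtain rfl := Finset.card_eq_zero.1 hF
    exact ⟨φ, ⟨fun v => h1 v (by simp), fun u v h => h2 u (by simp) v (by simp) h⟩,
      fun v _ => rfl⟩
  | succ m ih =>
    intro F hF φ h1 h2 h3
    -- Colour from the highest rank downwards: either a neighbour of `v` is still uncoloured, or a
    -- coloured neighbour blocks no colour of `v`.
    obtain ⟨v, hv, hmax⟩ := F.exists_max_image r (Finset.card_pos.1 (by omega))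
    obtain ⟨c, hc, hc'⟩ : ∃ c ∈ L v, ∀ u ∉ F, G.Adj v u → φ u ≠ c := by
      set N := G.neighborFinset v with hN
      have hcard : N.card ≤ (L v).card := by
        have := hd v
        rwa [Set.ncard_eq_toFinset_card'] at this
      obtain ⟨x, hx, himg⟩ : ∃ x ∈ N, ∀ u ∉ F, G.Adj v u → φ u ∈ L v → u ∈ N.erase x := by
        rcases h3 v hv with ⟨x, hx, -, hxL⟩ | ⟨x, hx, hvx, -⟩
        · refine ⟨x, by simpa [hN], fun u _ hu hL => ?_⟩
          simp only [Finset.mem_erase, hN, SimpleGraph.mem_neighborFinset]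
          exact ⟨fun h => hxL (h ▸ hL), hu⟩
        · refine ⟨x, by simpa [hN], fun u hu hvu _ => ?_⟩
          simp only [Finset.mem_erase, hN, SimpleGraph.mem_neighborFinset]
          exact ⟨fun h => hu (h ▸ hx), hvu⟩
      have hlt : ((N.erase x).image φ).card < (L v).card := by
        have := Finset.card_image_le (s := N.erase x) (f := φ)
        have := Finset.card_erase_lt_of_mem hx
        omega
      obtain ⟨c, hc, hc'⟩ := Finset.exists_mem_notMem_of_card_lt_card hlt
      refine ⟨c, hc, fun u hu hvu h => hc' ?_⟩
      rw [← h]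
      exact Finset.mem_image_of_mem _ (himg u hu hvu (h ▸ hc))
    have hval : ∀ u, u ≠ v → Function.update φ v c u = φ u := fun u hu => by simp [hu]
    have hmem : ∀ u, u ∉ F.erase v → u = v ∨ u ∉ F := by
      intro u hu
      by_cases h : u = v
      · exact Or.inl h
      · exact Or.inr fun h' => hu (Finset.mem_erase.2 ⟨h, h'⟩)
    obtain ⟨ψ, hψ, hψ'⟩ := ih (F.erase v) (by rw [Finset.card_erase_of_mem hv]; omega)
      (Function.update φ v c) (fun u hu => by
        by_cases h : u = v
        · subst h
          simpa using hc
        · rw [hval u h]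
          exact h1 u ((hmem u hu).resolve_left h))
      (fun u hu w hw huw => by
        by_cases h : u = v
        · subst h
          rw [Function.update_self, hval w huw.ne']
          exact (hc' w ((hmem w hw).resolve_left huw.ne') huw).symm
        · rw [hval u h]
          by_cases h' : w = v
          · subst h'
            rw [Function.update_self]
            exact hc' u ((hmem u hu).resolve_left h) huw.symm
          · rw [hval w h']
            exact h2 u ((hmem u hu).resolve_left h) w ((hmem w hw).resolve_left h') huw)
      (fun w hw => by
        have hw' := (Finset.mem_erase.1 hw).2
        rcases h3 w hw' with ⟨u, hu, huF, huL⟩ | ⟨u, huF, hu, hlt⟩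
        · have : u ≠ v := fun h => huF (h ▸ hv)
          exact Or.inl ⟨u, hu, fun h => huF (Finset.mem_of_mem_erase h), by rwa [hval u this]⟩
        · have : u ≠ v := by
            rintro rfl
            have := hmax w hw'
            omega
          exact Or.inr ⟨u, Finset.mem_erase.2 ⟨this, huF⟩, hu, hlt⟩)
    refine ⟨ψ, hψ, fun u hu => ?_⟩
    have huv : u ≠ v := fun h => hu (h ▸ hv)
    rw [hψ' u (fun h => hu (Finset.mem_of_mem_erase h)), hval u huv]

end Greedy

/-- The Cartesian product of `K₄` and `K₂`. -/
abbrev cubeGraph : SimpleGraph (Fin 4 × Fin 2) :=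
  SimpleGraph.boxProd (⊤ : SimpleGraph (Fin 4)) (⊤ : SimpleGraph (Fin 2))

theorem cubeGraph_adj {p q : Fin 4 × Fin 2} :
    cubeGraph.Adj p q ↔ (p.1 ≠ q.1 ∧ p.2 = q.2) ∨ (p.2 ≠ q.2 ∧ p.1 = q.1) := by
  simp [SimpleGraph.boxProd_adj]

theorem cubeGraph_ncard (p : Fin 4 × Fin 2) : (cubeGraph.neighborSet p).ncard = 4 := by
  have h : cubeGraph.neighborSet p = ((Finset.univ.filter fun q : Fin 4 × Fin 2 =>
      (p.1 ≠ q.1 ∧ p.2 = q.2) ∨ (p.2 ≠ q.2 ∧ p.1 = q.1) : Finset _) : Set _) := by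
    ext q
    simp only [SimpleGraph.mem_neighborSet, cubeGraph_adj, Finset.coe_filter, Finset.mem_univ,
      true_and, Set.mem_ofPred_eq]
  rw [h, Set.ncard_coe_finset]
  clear h
  revert p
  decide

/-- The line graph of `K_{2,4}`. -/
theorem isLineGraphOf_cubeGraph :
    IsLineGraphOf cubeGraph (completeBipartiteGraph (Fin 2) (Fin 4)) := by
  let F : Fin 4 × Fin 2 → (completeBipartiteGraph (Fin 2) (Fin 4)).edgeSet := fun p =>
    ⟨s(Sum.inl p.2, Sum.inr p.1), by simp⟩
  have hF : Function.Bijective F := by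
    constructor
    · rintro ⟨a, b⟩ ⟨a', b'⟩ h
      have := congrArg Subtype.val h
      simp [F] at this
      simp [this]
    · rintro ⟨e, he⟩
      induction e with
      | _ x y =>
        rcases x with x | x <;> rcases y with y | y
        · simp at he
        · exact ⟨(y, x), rfl⟩
        · exact ⟨(x, y), Subtype.ext (Sym2.eq_swap)⟩
        · simp at he
  refine ⟨RelIso.mk (Equiv.ofBijective F hF) ?_⟩
  rintro ⟨a, b⟩ ⟨a', b'⟩
  rw [SimpleGraph.lineGraph_adj_iff_exists, cubeGraph_adj]
  simp [F, Equiv.ofBijective_apply]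
  tauto

section Cube

variable {C : Type*} {L : Fin 4 × Fin 2 → Finset C}

/-- After the deletion of two vertices, the remaining graph is connected. -/
theorem cubeGraph_rank (u w v : Fin 4 × Fin 2) (hu : v ≠ u) (hw : v ≠ w) :
    ∃ r : Fin 4 × Fin 2 → ℕ, ∀ x, x ≠ v →
      ∃ y, y ≠ u ∧ y ≠ w ∧ cubeGraph.Adj x y ∧ r y < r x := by
  classical
  obtain ⟨i, j⟩ := v
  let ok : Fin 4 × Fin 2 → Prop := fun y => y ≠ u ∧ y ≠ w
  -- The rank mimics the distance to `v` when `u` and `w` are absent: a vertex not adjacent to `v`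
  -- is at distance 2 unless its two common neighbours with `v` are the deleted vertices.
  let r : Fin 4 × Fin 2 → ℕ := fun x => if x = (i, j) then 0 else
    if x.1 = i ∨ x.2 = j then 1 else if ok (x.1, j) ∨ ok (i, x.2) then 2 else 3
  have r1 : ∀ x : Fin 4 × Fin 2, x.1 = i ∨ x.2 = j → r x ≤ 1 := by
    intro x hx
    simp only [r, hx, if_true]
    split_ifs <;> omega
  refine ⟨r, ?_⟩
  rintro ⟨a, b⟩ hx
  by_cases h1 : a = i ∨ b = j
  · refine ⟨(i, j), hu, hw, ?_, ?_⟩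
    · rw [cubeGraph_adj]
      simp only [ne_eq, Prod.mk.injEq, not_and] at hx ⊢
      tauto
    · have : 0 < r (a, b) := by
        simp only [r, hx, if_false]
        split_ifs <;> omega
      simpa [r] using this
  have hr : 2 ≤ r (a, b) := by
    simp only [r, hx, if_false, h1]
    split_ifs <;> omega
  push Not at h1
  by_cases h2 : ok (a, j)
  · refine ⟨(a, j), h2.1, h2.2, ?_, (r1 (a, j) (Or.inr rfl)).trans_lt hr⟩
    rw [cubeGraph_adj]
    exact Or.inr ⟨h1.2, rfl⟩
  by_cases h3 : ok (i, b)
  · refine ⟨(i, b), h3.1, h3.2, ?_, (r1 (i, b) (Or.inl rfl)).trans_lt hr⟩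
    rw [cubeGraph_adj]
    exact Or.inl ⟨h1.1, rfl⟩
  -- Both deleted vertices now have first coordinate `a` or `i`, so all vertices with a third
  -- coordinate `k` remain.
  obtain ⟨k, hk, hk'⟩ : ∃ k : Fin 4, k ≠ a ∧ k ≠ i := by
    have : ∀ a i : Fin 4, ∃ k : Fin 4, k ≠ a ∧ k ≠ i := by decide
    exact this a i
  have hne : ((a, j) : Fin 4 × Fin 2) ≠ (i, b) := fun h => h1.1 (congrArg Prod.fst h)
  have hall : ∀ y : Fin 4 × Fin 2, y.1 = k → ok y := by
    intro y hy
    have e1 : y ≠ (a, j) := fun h => hk (hy.symm.trans (congrArg Prod.fst h))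
    have e2 : y ≠ (i, b) := fun h => hk' (hy.symm.trans (congrArg Prod.fst h))
    simp only [ok, not_and_or, not_not] at h2 h3
    constructor
    · rintro rfl
      rcases h2 with h2 | h2
      · exact e1 h2.symm
      · rcases h3 with h3 | h3
        · exact e2 h3.symm
        · exact hne (h2.trans h3.symm)
    · rintro rfl
      rcases h2 with h2 | h2
      · rcases h3 with h3 | h3
        · exact hne (h2.trans h3.symm)
        · exact e2 h3.symm
      · exact e1 h2.symm
  refine ⟨(k, b), (hall _ rfl).1, (hall _ rfl).2, ?_, ?_⟩
  · rw [cubeGraph_adj]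
    exact Or.inl ⟨hk.symm, rfl⟩
  · have e1 : r (a, b) = 3 := by
      simp only [r, hx, if_false, h1.1, h1.2, or_self, h2, h3]
    have e2 : r (k, b) ≤ 2 := by
      have : ok (k, j) := hall _ rfl
      simp only [r, this, true_or, if_true]
      split_ifs <;> omega
    omega

/-- Colourings that agree in a colour missing from the list of a neighbour are equivalent. -/
theorem cubeGraph_fix (hL : ∀ v, (L v).card = 4) {φ ψ : Fin 4 × Fin 2 → C}
    (hφ : IsProperList cubeGraph L φ) (hψ : IsProperList cubeGraph L ψ) {u v : Fin 4 × Fin 2}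
    (huv : cubeGraph.Adj u v) (h : φ u = ψ u) (hv : φ u ∉ L v) : KempeEquiv cubeGraph L φ ψ := by
  obtain ⟨r, hr⟩ := cubeGraph_rank u u v huv.ne' huv.ne'
  refine kempeEquiv_of_spare (fun v => by rw [cubeGraph_ncard, hL]) hφ hψ {x | x ≠ u} ?_ r ?_
  · intro x hx
    simp only [Set.mem_ofPred_eq, not_not] at hx
    rw [hx, h]
  · intro x _
    by_cases hxv : x = v
    · subst hxv
      exact Or.inl ⟨u, huv.symm, by simp, hv⟩
    · obtain ⟨y, hy, -, hxy, hlt⟩ := hr x hxv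
      exact Or.inr ⟨y, hy, hxy, hlt⟩

theorem cubeGraph_exists_coloring (hL : ∀ v, (L v).card = 4) {u w v : Fin 4 × Fin 2} {c d : C}
    (hc : c ∈ L u) (hd : d ∈ L w) (huw : u ≠ w) (hcd : cubeGraph.Adj u w → c ≠ d) (hu : v ≠ u)
    (hw : v ≠ w) (h : (cubeGraph.Adj u v ∧ c ∉ L v) ∨ (cubeGraph.Adj w v ∧ d ∉ L v)) :
    ∃ φ, IsProperList cubeGraph L φ ∧ φ u = c ∧ φ w = d := by
  classical
  obtain ⟨r, hr⟩ := cubeGraph_rank u w v hu hw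
  let φ : Fin 4 × Fin 2 → C := fun x => if x = u then c else d
  have φu : φ u = c := by simp [φ]
  have φw : φ w = d := by simp [φ, huw.symm]
  have hF : ∀ x, x ∉ (Finset.univ.filter fun x => x ≠ u ∧ x ≠ w) ↔ x = u ∨ x = w := by
    intro x
    simp only [Finset.mem_filter, Finset.mem_univ, true_and, ne_eq]
    tauto
  obtain ⟨ψ, hψ, hag⟩ := exists_isProperList_of_spare (G := cubeGraph) (L := L)
    (fun v => by rw [cubeGraph_ncard, hL]) r _ (Finset.univ.filter fun x => x ≠ u ∧ x ≠ w) rfl φ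
    (by
      intro x hx
      rcases (hF x).1 hx with rfl | rfl
      · rwa [φu]
      · rwa [φw])
    (by
      intro x hx y hy hxy
      rcases (hF x).1 hx with rfl | rfl <;> rcases (hF y).1 hy with rfl | rfl
      · exact absurd rfl hxy.ne
      · rw [φu, φw]
        exact hcd hxy
      · rw [φu, φw]
        exact (hcd hxy.symm).symm
      · exact absurd rfl hxy.ne)
    (by
      intro x _
      by_cases hxv : x = v
      · subst hxv
        rcases h with ⟨h1, h2⟩ | ⟨h1, h2⟩
        · exact Or.inl ⟨u, h1.symm, (hF u).2 (Or.inl rfl), by rwa [φu]⟩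
        · exact Or.inl ⟨w, h1.symm, (hF w).2 (Or.inr rfl), by rwa [φw]⟩
      · obtain ⟨y, hy, hy', hxy, hlt⟩ := hr x hxv
        exact Or.inr ⟨y, by simp [hy, hy'], hxy, hlt⟩)
  exact ⟨ψ, hψ, by rw [hag u ((hF u).2 (Or.inl rfl)), φu],
    by rw [hag w ((hF w).2 (Or.inr rfl)), φw]⟩

end Cube

/-! ### Linking free colours of `K₄ □ K₂`. -/

section Cube

variable {C : Type*} {L : Fin 4 × Fin 2 → Finset C}

/-- The colour `c` at `u` is missing from the list of a neighbour of `u`. -/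
def FreeColor (L : Fin 4 × Fin 2 → Finset C) (u : Fin 4 × Fin 2) (c : C) : Prop :=
  c ∈ L u ∧ ∃ v, cubeGraph.Adj u v ∧ c ∉ L v

/-- All colourings with colour `c` at `u` are equivalent to all colourings with colour `d` at `w`. -/
def ColorsLinked (L : Fin 4 × Fin 2 → Finset C) (u w : Fin 4 × Fin 2) (c d : C) : Prop :=
  ∀ φ ψ, IsProperList cubeGraph L φ → IsProperList cubeGraph L ψ → φ u = c → ψ w = d →
    KempeEquiv cubeGraph L φ ψ

theorem FreeColor.exists_coloring (hL : ∀ v, (L v).card = 4) {u : Fin 4 × Fin 2} {c : C}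
    (h : FreeColor L u c) : ∃ φ, IsProperList cubeGraph L φ ∧ φ u = c := by
  obtain ⟨hc, v, huv, hv⟩ := h
  obtain ⟨w, hwu, hwv, hadj⟩ : ∃ w, w ≠ u ∧ w ≠ v ∧ ¬ cubeGraph.Adj u w := by
    simp only [cubeGraph_adj]
    have : ∀ u v : Fin 4 × Fin 2, ∃ w, w ≠ u ∧ w ≠ v ∧
      ¬ ((u.1 ≠ w.1 ∧ u.2 = w.2) ∨ (u.2 ≠ w.2 ∧ u.1 = w.1)) := by decide
    exact this u v
  obtain ⟨d, hd⟩ := Finset.card_pos.1 (show 0 < (L w).card by rw [hL]; omega)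
  obtain ⟨φ, hφ, h1, -⟩ := cubeGraph_exists_coloring hL hc hd hwu.symm (fun h => absurd h hadj)
    huv.ne' hwv.symm (Or.inl ⟨huv, hv⟩)
  exact ⟨φ, hφ, h1⟩

/-- Freeness provides a colouring that realises the intermediate colour; otherwise the link could be
vacuous. -/
theorem ColorsLinked.trans (hL : ∀ v, (L v).card = 4) {u v w : Fin 4 × Fin 2} {c d e : C}
    (hd : FreeColor L v d) (h : ColorsLinked L u v c d) (h' : ColorsLinked L v w d e) :
    ColorsLinked L u w c e := by
  intro φ ψ hφ hψ h1 h2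
  obtain ⟨χ, hχ, h3⟩ := hd.exists_coloring hL
  exact (h φ χ hφ hχ h1 h3).trans (h' χ ψ hχ hψ h3 h2)

/-- The slack at `v` allows a colouring with both colours, to which `φ` and `ψ` are equivalent by
their free colours. -/
theorem colorsLinked_of_spare (hL : ∀ v, (L v).card = 4) {u w : Fin 4 × Fin 2} {c d : C}
    (hc : FreeColor L u c) (hd : FreeColor L w d) (huw : u ≠ w) (hcd : cubeGraph.Adj u w → c ≠ d)
    (v : Fin 4 × Fin 2) (hu : v ≠ u) (hw : v ≠ w)
    (h : (cubeGraph.Adj u v ∧ c ∉ L v) ∨ (cubeGraph.Adj w v ∧ d ∉ L v)) :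
    ColorsLinked L u w c d := by
  intro φ ψ hφ hψ h1 h2
  obtain ⟨χ, hχ, h3, h4⟩ := cubeGraph_exists_coloring hL hc.1 hd.1 huw hcd hu hw h
  obtain ⟨-, x, hx, hx'⟩ := hc
  obtain ⟨-, y, hy, hy'⟩ := hd
  exact (cubeGraph_fix hL hφ hχ hx (h1.trans h3.symm) (h1 ▸ hx')).trans
    (cubeGraph_fix hL hχ hψ hy (h4.trans h2.symm) (h4 ▸ hy'))

theorem exists_two_others : ∀ i i' : Fin 4, ∃ k l : Fin 4, k ≠ l ∧ k ≠ i ∧ k ≠ i' ∧ l ≠ i ∧ l ≠ i' := by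
  decide

/-- The exceptional case: `c` is missing only at `w` and `d` only at `u`, among their neighbours, so
no third vertex provides slack. Both colours are then free at further vertices, and a detour through
these avoids the obstruction. -/
theorem colorsLinked_of_adj (hL : ∀ v, (L v).card = 4) {u w : Fin 4 × Fin 2} {c d : C}
    (hc : FreeColor L u c) (hd : FreeColor L w d) (huw : cubeGraph.Adj u w) (hcw : c ∉ L w)
    (hdu : d ∉ L u) (hc' : ∀ v, v ≠ w → cubeGraph.Adj u v → c ∈ L v)
    (hd' : ∀ v, v ≠ u → cubeGraph.Adj w v → d ∈ L v) : ColorsLinked L u w c d := by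
  have hcd : c ≠ d := fun h => hcw (h ▸ hd.1)
  obtain ⟨i, j⟩ := u
  obtain ⟨i', j'⟩ := w
  have huw' := huw
  rw [cubeGraph_adj] at huw'
  simp only at huw'
  obtain ⟨k, l, hkl, hki, hki', hli, hli'⟩ := exists_two_others i i'
  rcases huw' with ⟨hi, rfl⟩ | ⟨hj, rfl⟩
  · have adj : ∀ {a b : Fin 4}, a ≠ b → cubeGraph.Adj (a, j) (b, j) := fun h =>
      cubeGraph_adj.2 (Or.inl ⟨h, rfl⟩)
    have ne : ∀ {a b : Fin 4}, a ≠ b → ((a, j) : Fin 4 × Fin 2) ≠ (b, j) := fun h => (adj h).ne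
    have g1 : FreeColor L (l, j) d := ⟨hd' _ (ne hli) (adj hli'.symm), (i, j), adj hli, hdu⟩
    have g2 : FreeColor L (k, j) c := ⟨hc' _ (ne hki') (adj hki.symm), (i', j), adj hki', hcw⟩
    refine ColorsLinked.trans hL g1 ?_ (ColorsLinked.trans hL g2 ?_ ?_)
    · exact colorsLinked_of_spare hL hc g1 (ne hli.symm) (fun _ => hcd) (i', j) (ne hi.symm)
        (ne hli'.symm) (Or.inl ⟨huw, hcw⟩)
    · exact colorsLinked_of_spare hL g1 g2 (ne hkl.symm) (fun _ => hcd.symm) (i, j) (ne hli.symm)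
        (ne hki.symm) (Or.inl ⟨adj hli, hdu⟩)
    · exact colorsLinked_of_spare hL g2 hd (ne hki') (fun _ => hcd) (i, j) (ne hki.symm)
        (ne hi) (Or.inr ⟨huw.symm, hdu⟩)
  · have adj : ∀ {a b : Fin 4} {m : Fin 2}, a ≠ b → cubeGraph.Adj (a, m) (b, m) := fun h =>
      cubeGraph_adj.2 (Or.inl ⟨h, rfl⟩)
    have adj' : ∀ {a : Fin 4}, cubeGraph.Adj (a, j) (a, j') :=
      cubeGraph_adj.2 (Or.inr ⟨hj, rfl⟩)
    have nadj : ∀ {a b : Fin 4}, a ≠ b → ¬ cubeGraph.Adj (a, j) (b, j') := by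
      intro a b h
      simp [h, hj]
    have ne : ∀ {a b : Fin 4} {m m' : Fin 2}, a ≠ b → ((a, m) : Fin 4 × Fin 2) ≠ (b, m') :=
      fun h h' => h (congrArg Prod.fst h')
    have ne' : ∀ {a b : Fin 4}, ((a, j) : Fin 4 × Fin 2) ≠ (b, j') :=
      fun h' => hj (congrArg Prod.snd h')
    -- One intermediate vertex suffices if `c` also occurs beside `w`, or `d` beside `u`, in their
    -- copies of `K₄`.
    have key : ∀ k, k ≠ i → (c ∈ L (k, j') ∨ d ∈ L (k, j)) → ColorsLinked L (i, j) (i, j') c d := by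
      rintro k hk (h | h)
      · have g : FreeColor L (k, j') c := ⟨h, (i, j'), adj hk, hcw⟩
        refine ColorsLinked.trans hL g ?_ ?_
        · exact colorsLinked_of_spare hL hc g ne' (fun h => absurd h (nadj hk.symm)) (i, j')
            ne'.symm (ne hk.symm) (Or.inl ⟨adj', hcw⟩)
        · exact colorsLinked_of_spare hL g hd (ne hk) (fun _ => hcd) (i, j) (ne hk.symm)
            ne' (Or.inr ⟨adj'.symm, hdu⟩)
      · have g : FreeColor L (k, j) d := ⟨h, (i, j), adj hk, hdu⟩
        refine ColorsLinked.trans hL g ?_ ?_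
        · exact colorsLinked_of_spare hL hc g (ne hk.symm) (fun _ => hcd) (i, j')
            ne'.symm (ne hk.symm) (Or.inl ⟨adj', hcw⟩)
        · exact colorsLinked_of_spare hL g hd ne' (fun h => absurd h (nadj hk)) (i, j) (ne hk.symm)
            ne' (Or.inr ⟨adj'.symm, hdu⟩)
    by_cases hk : c ∈ L (k, j') ∨ d ∈ L (k, j)
    · exact key k hki hk
    by_cases hl : c ∈ L (l, j') ∨ d ∈ L (l, j)
    · exact key l hli hl
    -- Now `c` is free at `(k, j)` because of `(k, j')`, and `d` is free at `(l, j')` because of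
    -- `(l, j)`.
    push Not at hk hl
    have g1 : FreeColor L (l, j') d := ⟨hd' _ ne'.symm (adj hli'.symm), (l, j), adj'.symm, hl.2⟩
    have g2 : FreeColor L (k, j) c := ⟨hc' _ ne' (adj hki.symm), (k, j'), adj', hk.1⟩
    refine ColorsLinked.trans hL g1 ?_ (ColorsLinked.trans hL g2 ?_ ?_)
    · exact colorsLinked_of_spare hL hc g1 ne' (fun _ => hcd) (i, j') ne'.symm
        (ne hli.symm) (Or.inl ⟨huw, hcw⟩)
    · exact colorsLinked_of_spare hL g1 g2 ne'.symm (fun _ => hcd.symm) (k, j') (ne hkl)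
        ne'.symm (Or.inr ⟨adj', hk.1⟩)
    · exact colorsLinked_of_spare hL g2 hd ne' (fun _ => hcd) (i, j) (ne hki.symm)
        ne' (Or.inr ⟨huw.symm, hdu⟩)

/-- If no third vertex has slack, the neighbour of `u` lacking `c` is `w` and the neighbour of `w`
lacking `d` is `u`. -/
theorem colorsLinked_of_ne (hL : ∀ v, (L v).card = 4) {u w : Fin 4 × Fin 2} {c d : C}
    (hc : FreeColor L u c) (hd : FreeColor L w d) (huw : u ≠ w)
    (hcd : cubeGraph.Adj u w → c ≠ d) : ColorsLinked L u w c d := by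
  by_cases h : ∃ v, v ≠ u ∧ v ≠ w ∧
      ((cubeGraph.Adj u v ∧ c ∉ L v) ∨ (cubeGraph.Adj w v ∧ d ∉ L v))
  · obtain ⟨v, h1, h2, h3⟩ := h
    exact colorsLinked_of_spare hL hc hd huw hcd v h1 h2 h3
  push Not at h
  obtain ⟨-, x, hx, hx'⟩ := id hc
  obtain ⟨-, y, hy, hy'⟩ := id hd
  have hxw : x = w := by
    by_contra hne
    exact hx' ((h x hx.ne' hne).1 hx)
  have hyu : y = u := by
    by_contra hne
    exact hy' ((h y hne hy.ne').2 hy)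
  subst hxw hyu
  exact colorsLinked_of_adj hL hc hd hx hx' hy' (fun v hv hadj => (h v hadj.ne' hv).1 hadj)
    (fun v hv hadj => (h v hv hadj.ne').2 hadj)

/-- The lists of `u` and `v` have the same size but differ, so `v` has a colour that `u` lacks, and
this colour is free. -/
theorem FreeColor.exists_neighbor (hL : ∀ v, (L v).card = 4) {u : Fin 4 × Fin 2} {c : C}
    (h : FreeColor L u c) : ∃ v e, cubeGraph.Adj u v ∧ c ∉ L v ∧ FreeColor L v e ∧ c ≠ e := by
  classical
  obtain ⟨hc, v, huv, hv⟩ := h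
  obtain ⟨e, he, he'⟩ : ∃ e ∈ L v, e ∉ L u := by
    by_contra hcon
    push Not at hcon
    have := Finset.eq_of_subset_of_card_le hcon (by rw [hL, hL])
    exact hv (this ▸ hc)
  exact ⟨v, e, huv, hv, ⟨he, u, huv.symm, he'⟩, fun h => hv (h ▸ he)⟩

/-- Equal colours or equal vertices are treated by inserting a free colour of a neighbour. -/
theorem colorsLinked (hL : ∀ v, (L v).card = 4) {u w : Fin 4 × Fin 2} {c d : C}
    (hc : FreeColor L u c) (hd : FreeColor L w d) : ColorsLinked L u w c d := by
  have main : ∀ {u w : Fin 4 × Fin 2} {c d : C}, FreeColor L u c → FreeColor L w d → u ≠ w →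
      ColorsLinked L u w c d := by
    intro u w c d hc hd huw
    by_cases hcd : c = d
    · subst hcd
      obtain ⟨v, e, huv, hv, hg, hce⟩ := hc.exists_neighbor hL
      exact ColorsLinked.trans hL hg (colorsLinked_of_ne hL hc hg huv.ne fun _ => hce)
        (colorsLinked_of_ne hL hg hd (fun h => hv (h ▸ hd.1)) fun _ => hce.symm)
    · exact colorsLinked_of_ne hL hc hd huw fun _ => hcd
  by_cases huw : u = w
  · subst huw
    obtain ⟨v, e, huv, -, hg, -⟩ := hc.exists_neighbor hL
    exact ColorsLinked.trans hL hg (main hc hg huv.ne) (main hg hd huv.ne')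
  · exact main hc hd huw

/-- If no colour of `φ` is missing from the list of a neighbour, then all lists are equal. -/
theorem exists_freeColor (hL : ∀ v, (L v).card = 4) (hne : ¬ ∀ v, L v = L (0, 0))
    {φ : Fin 4 × Fin 2 → C} (hφ : IsProperList cubeGraph L φ) : ∃ u, FreeColor L u (φ u) := by
  classical
  by_contra hcon
  push Not at hcon
  have h1 : ∀ u v, cubeGraph.Adj u v → φ u ∈ L v := fun u v huv => by
    by_contra hv
    exact hcon u ⟨hφ.1 u, v, huv, hv⟩
  -- Each copy of `K₄` shows four different colours, all of which lie in each list of this copy.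
  have h2 : ∀ i j, L (i, j) = Finset.univ.image fun k => φ (k, j) := by
    intro i j
    symm
    refine Finset.eq_of_subset_of_card_le ?_ ?_
    · intro c hc
      obtain ⟨k, -, rfl⟩ := Finset.mem_image.1 hc
      by_cases hki : k = i
      · exact hki ▸ hφ.1 _
      · exact h1 _ _ (cubeGraph_adj.2 (Or.inl ⟨hki, rfl⟩))
    · rw [hL, Finset.card_image_of_injective, Finset.card_univ, Fintype.card_fin]
      intro k l hkl
      by_contra h
      exact hφ.2 (k, j) (l, j) (cubeGraph_adj.2 (Or.inl ⟨h, rfl⟩)) hkl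
  have h3 : ∀ j, L (0, j) = L (0, 0) := by
    intro j
    by_cases hj : j = 0
    · rw [hj]
    · refine Finset.eq_of_subset_of_card_le ?_ (by rw [hL, hL])
      rw [h2 0 j]
      intro c hc
      obtain ⟨k, -, rfl⟩ := Finset.mem_image.1 hc
      rw [h2 0 0, ← h2 k 0]
      exact h1 _ _ (cubeGraph_adj.2 (Or.inr ⟨hj, rfl⟩))
  refine hne fun ⟨i, j⟩ => ?_
  rw [← h3 j, h2 i j, h2 0 j]

/-! ### Identical lists: derangements of four colours. -/

/-- The colouring of `K₄ □ K₂` with the identity on the first copy of `K₄` and `t` on the second. -/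
def standardColoring (t : Fin 4 → Fin 4) (p : Fin 4 × Fin 2) : Fin 4 := if p.2 = 0 then p.1 else t p.1

theorem isProperList_standardColoring {t : Fin 4 → Fin 4} (h1 : ∀ i j, i ≠ j → t i ≠ t j)
    (h2 : ∀ i, t i ≠ i) : IsProperList cubeGraph (fun _ => Finset.univ) (standardColoring t) := by
  refine ⟨fun v => Finset.mem_univ _, ?_⟩
  rintro ⟨i, j⟩ ⟨i', j'⟩ hadj
  rw [cubeGraph_adj] at hadj
  simp only at hadj
  simp only [standardColoring]
  rcases hadj with ⟨h, rfl⟩ | ⟨h, rfl⟩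
  · split_ifs
    · exact h
    · exact h1 _ _ h
  · split_ifs with h3 h4 h4
    · omega
    · exact (h2 i).symm
    · exact h2 i
    · omega

/-- `t` is a derangement. -/
def IsDerangement (t : Fin 4 → Fin 4) : Prop := (∀ i j, i ≠ j → t i ≠ t j) ∧ ∀ i, t i ≠ i

instance : DecidablePred IsDerangement := fun t =>
  inferInstanceAs (Decidable ((∀ i j, i ≠ j → t i ≠ t j) ∧ ∀ i, t i ≠ i))

/-- The colours `a` and `b` are interchanged in the second copy only. -/
theorem standardColoring_swap {t : Fin 4 → Fin 4} (h : IsDerangement t) (a b : Fin 4)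
    (h' : IsDerangement (Equiv.swap a b ∘ t)) :
    KempeEquiv cubeGraph (fun _ => Finset.univ) (standardColoring t)
      (standardColoring (Equiv.swap a b ∘ t)) := by
  refine MultiSwap.kempeEquiv ⟨isProperList_standardColoring h.1 h.2,
    isProperList_standardColoring h'.1 h'.2, a, b, ?_⟩
  rintro ⟨i, j⟩
  simp only [standardColoring, Function.comp_apply]
  split_ifs
  · exact Or.inl rfl
  · by_cases ha : t i = a
    · exact Or.inr (Or.inl ⟨ha, by rw [ha, Equiv.swap_apply_left]⟩)
    by_cases hb : t i = b
    · exact Or.inr (Or.inr ⟨hb, by rw [hb, Equiv.swap_apply_right]⟩)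
    · exact Or.inl (Equiv.swap_apply_of_ne_of_ne ha hb).symm

/-- A derangement of four points is a 4-cycle or a product of two transpositions, and a suitable
transposition turns a 4-cycle into the latter. The choice `a = b` covers the involutions themselves.
-/
theorem derangement_to_involution : ∀ x y z w : Fin 4, IsDerangement ![x, y, z, w] →
    ∃ a b : Fin 4, IsDerangement (Equiv.swap a b ∘ ![x, y, z, w]) ∧
      ∀ i, (Equiv.swap a b ∘ ![x, y, z, w]) ((Equiv.swap a b ∘ ![x, y, z, w]) i) = i := by
  decide

theorem involution_to_base : ∀ x y z w : Fin 4, IsDerangement ![x, y, z, w] →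
    (∀ i, ![x, y, z, w] (![x, y, z, w] i) = i) →
    ∃ a b c d : Fin 4, IsDerangement (Equiv.swap a b ∘ ![x, y, z, w]) ∧
      Equiv.swap c d ∘ (Equiv.swap a b ∘ ![x, y, z, w]) = ![1, 0, 3, 2] := by
  decide

theorem standardColoring_base {t : Fin 4 → Fin 4} (h : IsDerangement t) :
    KempeEquiv cubeGraph (fun _ => Finset.univ) (standardColoring t)
      (standardColoring ![1, 0, 3, 2]) := by
  have vec : ∀ t : Fin 4 → Fin 4, t = ![t 0, t 1, t 2, t 3] := by
    intro t
    ext i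
    fin_cases i <;> rfl
  obtain ⟨a, b, h1, h2⟩ := derangement_to_involution (t 0) (t 1) (t 2) (t 3) (vec t ▸ h)
  rw [← vec t] at h1 h2
  refine (standardColoring_swap h a b h1).trans ?_
  generalize Equiv.swap a b ∘ t = t' at h1 h2
  obtain ⟨a, b, c, d, h3, h4⟩ := involution_to_base (t' 0) (t' 1) (t' 2) (t' 3) (vec t' ▸ h1)
    (by rw [← vec t']; exact h2)
  rw [← vec t'] at h3 h4
  refine (standardColoring_swap h1 a b h3).trans ?_
  rw [← h4]
  refine standardColoring_swap h3 c d ?_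
  rw [h4]
  decide

/-- A permutation is a product of transpositions, each of which interchanges two colours on the
whole graph. -/
theorem kempeEquiv_perm {V : Type*} {G : SimpleGraph V} {φ : V → Fin 4}
    (hφ : IsProperList G (fun _ => Finset.univ) φ) (π : Equiv.Perm (Fin 4)) :
    KempeEquiv G (fun _ => Finset.univ) φ (π ∘ φ) := by
  have hp : ∀ π : Equiv.Perm (Fin 4), IsProperList G (fun _ => Finset.univ) (π ∘ φ) := fun π =>
    ⟨fun v => Finset.mem_univ _, fun u v huv h => hφ.2 u v huv (π.injective h)⟩
  induction π using Equiv.Perm.swap_induction_on with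
  | one => exact KempeEquiv.refl φ
  | swap_mul f x y _ ih =>
    refine ih.trans (MultiSwap.kempeEquiv ⟨hp f, hp _, x, y, fun v => ?_⟩)
    simp only [Function.comp_apply, Equiv.Perm.mul_apply]
    by_cases hx : f (φ v) = x
    · exact Or.inr (Or.inl ⟨hx, by rw [hx, Equiv.swap_apply_left]⟩)
    by_cases hy : f (φ v) = y
    · exact Or.inr (Or.inr ⟨hy, by rw [hy, Equiv.swap_apply_right]⟩)
    · exact Or.inl (Equiv.swap_apply_of_ne_of_ne hx hy).symm

/-- After renaming the colours the first copy carries the identity, and the second a derangement. -/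
theorem cubeGraph_swappable_univ :
    Swappable cubeGraph (fun _ => (Finset.univ : Finset (Fin 4))) := by
  have key : ∀ φ : Fin 4 × Fin 2 → Fin 4, IsProperList cubeGraph (fun _ => Finset.univ) φ →
      KempeEquiv cubeGraph (fun _ => Finset.univ) φ (standardColoring ![1, 0, 3, 2]) := by
    intro φ hφ
    have hinj : ∀ j, Function.Injective fun i => φ (i, j) := by
      intro j i i' h
      by_contra hne
      exact hφ.2 (i, j) (i', j) (cubeGraph_adj.2 (Or.inl ⟨hne, rfl⟩)) h
    let σ : Equiv.Perm (Fin 4) := Equiv.ofBijective _ (Finite.injective_iff_bijective.1 (hinj 0))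
    have hσ : ∀ i, σ.symm (φ (i, 0)) = i := fun i => σ.symm_apply_apply i
    refine (kempeEquiv_perm hφ σ.symm).trans ?_
    have e : σ.symm ∘ φ = standardColoring fun i => σ.symm (φ (i, 1)) := by
      funext ⟨i, j⟩
      fin_cases j
      · simp [standardColoring, hσ]
      · simp [standardColoring]
    rw [e]
    refine standardColoring_base ⟨fun i i' hne h => hne (hinj 1 (σ.symm.injective h)), ?_⟩
    intro i h
    have := σ.symm.injective (h.trans (hσ i).symm)
    exact hφ.2 (i, 1) (i, 0) (cubeGraph_adj.2 (Or.inr ⟨by simp, rfl⟩)) this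
  exact fun φ ψ hφ hψ => (key φ hφ).trans (key ψ hψ).symm

/-- Swappability for one list used at all vertices depends only on the number of colours. -/
theorem Swappable.of_equiv {V K : Type*} {G : SimpleGraph V} [Fintype K] {S : Finset C}
    (e : K ≃ S) (h : Swappable G (fun _ => (Finset.univ : Finset K))) :
    Swappable G (fun _ => S) := by
  have hpush : ∀ f : V → K, IsProperList G (fun _ => Finset.univ) f →
      IsProperList G (fun _ => S) (fun v => (e (f v) : C)) := fun f hf =>
    ⟨fun v => (e (f v)).2, fun u v huv h => hf.2 u v huv (e.injective (Subtype.ext h))⟩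
  have hmap : ∀ f g : V → K, KempeEquiv G (fun _ => Finset.univ) f g →
      KempeEquiv G (fun _ => S) (fun v => (e (f v) : C)) (fun v => (e (g v) : C)) := by
    intro f g hfg
    induction hfg with
    | refl => exact KempeEquiv.refl _
    | tail _ hs ih =>
      obtain ⟨h1, h2, a, b, hd⟩ := hs
      refine ih.tail ⟨hpush _ h1, hpush _ h2, e a, e b, fun v => ?_⟩
      rcases hd v with h | ⟨h, h'⟩ | ⟨h, h'⟩
      · exact Or.inl (by simp only [h])
      · exact Or.inr (Or.inl ⟨by simp only [h], by simp only [h']⟩)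
      · exact Or.inr (Or.inr ⟨by simp only [h], by simp only [h']⟩)
  have hpull : ∀ φ : V → C, IsProperList G (fun _ => S) φ →
      ∃ f : V → K, IsProperList G (fun _ => Finset.univ) f ∧ (fun v => (e (f v) : C)) = φ := by
    intro φ hφ
    refine ⟨fun v => e.symm ⟨φ v, hφ.1 v⟩, ⟨fun v => Finset.mem_univ _, fun u v huv h => ?_⟩, ?_⟩
    · exact hφ.2 u v huv (congrArg Subtype.val (e.symm.injective h))
    · funext v
      simp
  intro φ ψ hφ hψ
  obtain ⟨f, hf, rfl⟩ := hpull φ hφ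
  obtain ⟨g, hg, rfl⟩ := hpull ψ hψ
  exact hmap f g (h f g hf hg)

theorem cubeGraph_swappable (hL : ∀ v, (L v).card = (cubeGraph.neighborSet v).ncard) :
    Swappable cubeGraph L := by
  have hL : ∀ v, (L v).card = 4 := fun v => (hL v).trans (cubeGraph_ncard v)
  by_cases hne : ∀ v, L v = L (0, 0)
  · rw [show L = fun _ => L (0, 0) from funext hne]
    exact cubeGraph_swappable_univ.of_equiv (Finset.equivFinOfCardEq (hL (0, 0))).symm
  · intro φ ψ hφ hψ
    obtain ⟨u, hu⟩ := exists_freeColor hL hne hφ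
    obtain ⟨w, hw⟩ := exists_freeColor hL hne hψ
    exact colorsLinked hL hu hw φ ψ hφ hψ rfl rfl

end Cube

/-! ### From walks to the models -/

section Transfer

universe v₁ v₂ v₃

/-- Degree-swappability is transferred along an isomorphism from a finite graph. -/
theorem degreeSwappable_of_iso {V : Type v₁} {W : Type v₂} [Finite V] {G : SimpleGraph V}
    {H : SimpleGraph W} (e : H ≃g G)
    (h : ∀ (C : Type v₃) (L : V → Finset C),
      (∀ v, (L v).card = (G.neighborSet v).ncard) → Swappable G L) :
    DegreeSwappable.{v₂, v₃} H := by
  intro C L hL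
  have : Finite W := Finite.of_injective e e.injective
  refine (Swappable.of_iso e (h C _ fun v => ?_)).listSwappable
  have h1 := hL (e.symm v)
  rw [Set.encard_coe_eq_coe_finsetCard] at h1
  have h2 : G.neighborSet v = e '' H.neighborSet (e.symm v) := by
    ext u
    simp only [SimpleGraph.mem_neighborSet, Set.mem_image]
    constructor
    · intro hu
      exact ⟨e.symm u, e.symm.map_adj_iff.2 hu, e.apply_symm_apply u⟩
    · rintro ⟨w, hw, rfl⟩
      have := e.map_adj_iff.2 hw
      rwa [e.apply_symm_apply] at this
  rw [h2, Set.ncard_image_of_injective _ e.injective, Set.ncard_def, ← h1]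
  simp

end Transfer

/-! ### Positions on paths and cycles, and parity of walks. -/

section Walks

variable {V : Type*} {G : SimpleGraph V}

theorem walk_even_length_iff {x y : V} (h : G.IsBipartite) (p q : G.Walk x y) :
    Even p.length ↔ Even q.length := by
  obtain ⟨c⟩ := h
  have c' : G.Coloring Bool := SimpleGraph.Coloring.mk (fun v => c v == 0) (by
    intro v w hvw
    have := c.valid hvw
    generalize c v = a at *
    generalize c w = b at *
    revert a b
    decide)
  rw [c'.even_length_iff_congr p, c'.even_length_iff_congr q]

theorem closed_walk_even_length {x : V} (h : G.IsBipartite) (p : G.Walk x x) :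
    Even p.length :=
  (walk_even_length_iff h p .nil).2 (by simp)

theorem SimpleGraph.Walk.IsPath.getVert_eq_iff {x y : V} {p : G.Walk x y} (hp : p.IsPath)
    {s t : ℕ} (hs : s ≤ p.length) (ht : t ≤ p.length) : p.getVert s = p.getVert t ↔ s = t :=
  ⟨fun h => hp.getVert_injOn hs ht h, fun h => h ▸ rfl⟩

theorem SimpleGraph.Walk.IsPath.getVert_eq_start_iff' {x y : V} {p : G.Walk x y} (hp : p.IsPath)
    {s : ℕ} (hs : s ≤ p.length) : p.getVert s = x ↔ s = 0 := by
  rw [← hp.getVert_eq_iff hs (Nat.zero_le _), p.getVert_zero]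

theorem SimpleGraph.Walk.IsPath.getVert_eq_end_iff' {x y : V} {p : G.Walk x y} (hp : p.IsPath)
    {s : ℕ} (hs : s ≤ p.length) : p.getVert s = y ↔ s = p.length := by
  rw [← hp.getVert_eq_iff hs le_rfl, p.getVert_length]

theorem SimpleGraph.Walk.IsCycle.getVert_eq_iff {x : V} {p : G.Walk x x} (hp : p.IsCycle)
    {s t : ℕ} (hs : s ≤ p.length) (ht : t ≤ p.length) : p.getVert s = p.getVert t ↔
      s = t ∨ (s = 0 ∨ s = p.length) ∧ (t = 0 ∨ t = p.length) := by
  constructor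
  · intro h
    by_cases h1 : s = 0 ∨ s = p.length
    · have := (hp.getVert_endpoint_iff hs).2 h1
      rw [this] at h
      exact Or.inr ⟨h1, (hp.getVert_endpoint_iff ht).1 h.symm⟩
    · by_cases h2 : t = 0 ∨ t = p.length
      · have := (hp.getVert_endpoint_iff ht).2 h2
        rw [this] at h
        exact absurd ((hp.getVert_endpoint_iff hs).1 h) h1
      · refine Or.inl (hp.getVert_injOn' ?_ ?_ h) <;> simp only [Set.mem_ofPred_eq] <;> omega
  · rintro (rfl | ⟨h1, h2⟩)
    · rfl
    · rw [(hp.getVert_endpoint_iff hs).2 h1, (hp.getVert_endpoint_iff ht).2 h2]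

theorem SimpleGraph.Walk.exists_getVert_of_mem_edges {x y : V} {p : G.Walk x y} {e : Sym2 V}
    (h : e ∈ p.edges) : ∃ s < p.length, e = s(p.getVert s, p.getVert (s + 1)) := by
  induction e with | _ u v =>
  obtain ⟨s, hs, h⟩ := (SimpleGraph.Walk.mk_mem_edges_iff_exists _).1 h
  exact ⟨s, hs, h.symm⟩

/-- Two internally disjoint paths with the same ends. -/
theorem getVert_eq_iff_of_disjoint {x y : V} {p q : G.Walk x y} (hp : p.IsPath)
    (hq : q.IsPath) (h : ∀ z ∈ p.support, z ∈ q.support → z = x ∨ z = y)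
    {s t : ℕ} (hs : s ≤ p.length) (ht : t ≤ q.length) : p.getVert s = q.getVert t ↔
      (s = 0 ∧ t = 0) ∨ (s = p.length ∧ t = q.length) := by
  constructor
  · intro he
    rcases h _ (p.getVert_mem_support s) (he ▸ q.getVert_mem_support t) with h1 | h1
    · exact Or.inl ⟨(hp.getVert_eq_start_iff' hs).1 h1, (hq.getVert_eq_start_iff' ht).1 (he ▸ h1)⟩
    · exact Or.inr ⟨(hp.getVert_eq_end_iff' hs).1 h1, (hq.getVert_eq_end_iff' ht).1 (he ▸ h1)⟩
  · rintro (⟨rfl, rfl⟩ | ⟨rfl, rfl⟩) <;> simp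

end Walks

/-! ### Path systems from theta-graphs. -/

section ThetaWalks

variable {V : Type*} {T : SimpleGraph V} {x y : V} {P : Fin 3 → T.Walk x y}

theorem exists_lineGraph_iso_theta (hxy : x ≠ y) (hP : ∀ i, (P i).IsPath)
    (hne : ∀ i j, i ≠ j → P i ≠ P j)
    (hdisj : ∀ i j, i ≠ j → ∀ z ∈ (P i).support, z ∈ (P j).support → z = x ∨ z = y)
    (hE : ∀ e ∈ T.edgeSet, ∃ i, e ∈ (P i).edges) :
    Nonempty (T.lineGraph ≃g pathSystem (fun i => (P i).length) thetaLab) := by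
  have hpos : ∀ i, 0 < (P i).length := fun i =>
    Nat.pos_of_ne_zero fun h => hxy (SimpleGraph.Walk.eq_of_length_eq_zero h)
  -- Two paths of length one would use the same edge, and the correspondence with edges would not be
  -- injective.
  have hone : ∀ i j, (P i).length = 1 → (P j).length = 1 → i = j := by
    intro i j hi hj
    by_contra hij
    refine hne i j hij (SimpleGraph.Walk.ext_getVert_le_length (hi.trans hj.symm) fun k hk => ?_)
    rw [getVert_eq_iff_of_disjoint (hP i) (hP j) (hdisj i j hij) hk (by omega)]
    omega
  have hcoin : ∀ i, ∀ s ≤ (P i).length, ∀ j, ∀ t ≤ (P j).length,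
      ((P i).getVert s = (P j).getVert t ↔
        (i = j ∧ s = t) ∨ (s = 0 ∧ t = 0) ∨ (s = (P i).length ∧ t = (P j).length)) := by
    intro i s hs j t ht
    by_cases hij : i = j
    · subst hij
      rw [(hP i).getVert_eq_iff hs ht]
      omega
    · rw [getVert_eq_iff_of_disjoint (hP i) (hP j) (hdisj i j hij) hs ht]
      simp [hij]
  refine lineGraph_iso_pathSystem _ _ (fun i s => (P i).getVert s)
    (fun i s hs => (P i).adj_getVert_succ hs) ?_ ?_ ?_
  · intro e he
    obtain ⟨i, hi⟩ := hE e he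
    exact ⟨i, SimpleGraph.Walk.exists_getVert_of_mem_edges hi⟩
  · intro i s hs j t ht h
    have hi := hpos i
    have hj := hpos j
    have h1 := hone i j
    rw [Sym2.eq_iff, hcoin i s hs.le j t ht.le, hcoin i (s + 1) hs j (t + 1) ht,
      hcoin i s hs.le j (t + 1) ht, hcoin i (s + 1) hs j t ht.le] at h
    by_cases hij : i = j
    · subst hij
      exact ⟨rfl, by omega⟩
    · simp only [hij, false_and, false_or] at h
      omega
  · intro i s hs j t ht
    rw [hcoin i s hs j t ht]
    simp only [thetaLab, AtEnd]
    constructor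
    · rintro (h | h | h)
      · exact Or.inl h
      · exact Or.inr ⟨false, false, by simp [h]⟩
      · exact Or.inr ⟨true, true, by simp [h]⟩
    · rintro (h | ⟨b, b', h1, h2, rfl⟩)
      · exact Or.inl h
      · cases b
        · simp at h1 h2
          omega
        · simp at h1 h2
          omega

/-- Three paths of length two form `K_{2,3}`. -/
theorem exists_iso_completeBipartite (hxy : x ≠ y) (hP : ∀ i, (P i).IsPath)
    (hdisj : ∀ i j, i ≠ j → ∀ z ∈ (P i).support, z ∈ (P j).support → z = x ∨ z = y)
    (hV : ∀ z : V, ∃ i, z ∈ (P i).support)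
    (hE : ∀ e ∈ T.edgeSet, ∃ i, e ∈ (P i).edges) (h2 : ∀ i, (P i).length = 2) :
    Nonempty (T ≃g completeBipartiteGraph (Fin 2) (Fin 3)) := by
  have h0 : ∀ i, (P i).getVert 0 = x := fun i => (P i).getVert_zero
  have hend : ∀ i, (P i).getVert 2 = y := fun i => h2 i ▸ (P i).getVert_length
  have hx : ∀ i, (P i).getVert 1 ≠ x := fun i h =>
    absurd (((hP i).getVert_eq_start_iff' (by rw [h2]; omega)).1 h) (by omega)
  have hy : ∀ i, (P i).getVert 1 ≠ y := fun i h =>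
    absurd (((hP i).getVert_eq_end_iff' (by rw [h2]; omega)).1 h) (by rw [h2]; omega)
  have hinj : ∀ i j, (P i).getVert 1 = (P j).getVert 1 → i = j := by
    intro i j h
    by_contra hij
    have := (getVert_eq_iff_of_disjoint (hP i) (hP j) (hdisj i j hij)
      (by rw [h2]; omega) (by rw [h2]; omega)).1 h
    rw [h2] at this
    omega
  have hadj : ∀ i, T.Adj x ((P i).getVert 1) ∧ T.Adj y ((P i).getVert 1) := by
    intro i
    have k1 := (P i).adj_getVert_succ (i := 0) (by rw [h2]; omega)
    have k2 := (P i).adj_getVert_succ (i := 1) (by rw [h2]; omega)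
    rw [h0] at k1
    rw [show 1 + 1 = 2 from rfl, hend] at k2
    exact ⟨k1, k2.symm⟩
  have hedge : ∀ u v, T.Adj u v → ∃ i, (u = (P i).getVert 1 ∧ (v = x ∨ v = y)) ∨
      (v = (P i).getVert 1 ∧ (u = x ∨ u = y)) := by
    intro u v huv
    obtain ⟨i, hi⟩ := hE s(u, v) huv
    obtain ⟨s, hs, h⟩ := SimpleGraph.Walk.exists_getVert_of_mem_edges hi
    refine ⟨i, ?_⟩
    rw [h2] at hs
    have : s = 0 ∨ s = 1 := by omega
    rcases this with rfl | rfl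
    · rw [h0, Sym2.eq_iff] at h
      tauto
    · rw [show 1 + 1 = 2 from rfl, hend, Sym2.eq_iff] at h
      tauto
  let f : Fin 2 ⊕ Fin 3 → V := Sum.elim (fun a => if a = 0 then x else y) fun i => (P i).getVert 1
  have hf : Function.Bijective f := by
    constructor
    · rintro (a | i) (b | j) h
      · fin_cases a <;> fin_cases b <;> simp_all [f]
      · fin_cases a
        · exact absurd h.symm (hx j)
        · exact absurd h.symm (hy j)
      · fin_cases b
        · exact absurd h (hx i)
        · exact absurd h (hy i)
      · rw [hinj i j h]
    · intro z
      obtain ⟨i, hi⟩ := hV z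
      obtain ⟨s, hs, hs'⟩ := SimpleGraph.Walk.mem_support_iff_exists_getVert.1 hi
      rw [h2] at hs'
      have : s = 0 ∨ s = 1 ∨ s = 2 := by omega
      rcases this with rfl | rfl | rfl
      · exact ⟨Sum.inl 0, by rw [← hs, h0]; rfl⟩
      · exact ⟨Sum.inr i, hs⟩
      · exact ⟨Sum.inl 1, by rw [← hs, hend]; rfl⟩
  have hxx : ∀ u v, (u = x ∨ u = y) → (v = x ∨ v = y) → ¬ T.Adj u v := by
    intro u v hu hv h
    obtain ⟨i, ⟨rfl, -⟩ | ⟨rfl, -⟩⟩ := hedge u v h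
    · exact hu.elim (hx i) (hy i)
    · exact hv.elim (hx i) (hy i)
  have hmid : ∀ i j, ¬ T.Adj ((P i).getVert 1) ((P j).getVert 1) := by
    intro i j h
    obtain ⟨k, ⟨-, h⟩ | ⟨-, h⟩⟩ := hedge _ _ h
    · exact h.elim (hx j) (hy j)
    · exact h.elim (hx i) (hy i)
  have hfa : ∀ a : Fin 2, f (Sum.inl a) = x ∨ f (Sum.inl a) = y := by
    intro a
    fin_cases a
    · exact Or.inl rfl
    · exact Or.inr rfl
  have hfai : ∀ (a : Fin 2) i, T.Adj (f (Sum.inl a)) (f (Sum.inr i)) := by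
    intro a i
    fin_cases a
    · exact (hadj i).1
    · exact (hadj i).2
  refine ⟨SimpleGraph.Iso.symm ⟨Equiv.ofBijective f hf, ?_⟩⟩
  rintro (a | i) (b | j)
  · simpa using hxx _ _ (hfa a) (hfa b)
  · simpa using hfai a j
  · simpa using (hfai b i).symm
  · simpa [f] using hmid i j

end ThetaWalks

section Theta

universe v₁ v₂ v₃

/-- If some path has length 1, all lengths are odd and the other two are at least 3. Otherwise the
line graph is a prism model, and excluding `K_{2,3}` guarantees a path with an interior vertex. -/
theorem degreeSwappable_of_theta {V : Type v₁} {W : Type v₂} {T : SimpleGraph V}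
    {H : SimpleGraph W} (hT : IsThetaGraph T) (hbip : T.IsBipartite)
    (h23 : IsEmpty (T ≃g completeBipartiteGraph (Fin 2) (Fin 3))) (hH : IsLineGraphOf H T) :
    DegreeSwappable.{v₂, v₃} H := by
  obtain ⟨x, y, P, hxy, hP, hne, hdisj, hV, hE⟩ := hT
  obtain ⟨e⟩ := hH
  obtain ⟨e'⟩ := exists_lineGraph_iso_theta hxy hP hne hdisj hE
  refine degreeSwappable_of_iso (e.trans e') fun C L hL => ?_
  have hpos : ∀ i, 0 < (P i).length := fun i =>
    Nat.pos_of_ne_zero fun h => hxy (SimpleGraph.Walk.eq_of_length_eq_zero h)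
  have hpar : ∀ i j, (Even (P i).length ↔ Even (P j).length) := fun i j =>
    walk_even_length_iff hbip (P i) (P j)
  by_cases hl : ∃ l, (P l).length = 1
  · obtain ⟨l, hl⟩ := hl
    have hodd : ∀ i, Odd (P i).length := by
      intro i
      rw [← Nat.not_even_iff_odd, hpar i l, hl]
      decide
    have hthree : ∀ i, i ≠ l → 3 ≤ (P i).length := by
      intro i hi
      have h1 : (P i).length ≠ 1 := by
        intro h1
        refine hne i l hi (SimpleGraph.Walk.ext_getVert_le_length (h1.trans hl.symm) fun k hk => ?_)
        rw [getVert_eq_iff_of_disjoint (hP i) (hP l) (hdisj i l hi) hk (by omega)]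
        omega
      obtain ⟨k, hk⟩ := hodd i
      omega
    obtain ⟨w, hw1, hw2, hw3⟩ : ∃ w : Bool → Fin 3, (∀ b, w b ≠ l) ∧ (∀ b, w b ≠ w (!b)) ∧
        ∀ k, k = l ∨ ∃ b, k = w b := by
      revert l
      have : ∀ l : Fin 3, ∃ w : Bool → Fin 3, (∀ b, w b ≠ l) ∧ (∀ b, w b ≠ w (!b)) ∧
        ∀ k, k = l ∨ ∃ b, k = w b := by
        intro l
        refine ⟨fun b => if b then l + 1 else l + 2, ?_, ?_, ?_⟩ <;> revert l <;> decide
      intro l _ _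
      exact this l
    exact IsBowtie.swappable (w := w) (l := l) ⟨hl, fun b => hthree _ (hw1 b), hw1, hw2, hw3⟩ hL
      (hodd _)
  · push Not at hl
    have htwo : ∀ i, 2 ≤ (P i).length := fun i => by
      have := hpos i
      have := hl i
      omega
    obtain ⟨k, hk⟩ : ∃ k, (P k).length ≠ 2 := by
      by_contra h
      push Not at h
      exact (not_nonempty_iff.2 h23) (exists_iso_completeBipartite hxy hP hdisj hV hE h)
    exact theta_swappable htwo hL (k := k) (by have := htwo k; omega)

end Theta

/-! ### Path systems from barbells. -/

section BarbellWalks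

variable {V : Type*} {B : SimpleGraph V} {x y : V} {c₁ : B.Walk x x} {p : B.Walk x y}
  {c₂ : B.Walk y y}

theorem cycle_getVert_eq_start_iff (h₁ : c₁.IsCycle) (hp : p.IsPath)
    (h : ∀ z ∈ c₁.support, z ∈ p.support → z = x) {s t : ℕ} (hs : s ≤ c₁.length)
    (ht : t ≤ p.length) : c₁.getVert s = p.getVert t ↔ (s = 0 ∨ s = c₁.length) ∧ t = 0 := by
  constructor
  · intro he
    have hx := h _ (c₁.getVert_mem_support s) (he ▸ p.getVert_mem_support t)
    exact ⟨(h₁.getVert_endpoint_iff hs).1 hx, (hp.getVert_eq_start_iff' ht).1 (he ▸ hx)⟩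
  · rintro ⟨h1, rfl⟩
    rw [(h₁.getVert_endpoint_iff hs).2 h1, p.getVert_zero]

theorem cycle_getVert_eq_end_iff (h₂ : c₂.IsCycle) (hp : p.IsPath)
    (h : ∀ z ∈ c₂.support, z ∈ p.support → z = y) {s t : ℕ} (hs : s ≤ c₂.length)
    (ht : t ≤ p.length) :
    c₂.getVert s = p.getVert t ↔ (s = 0 ∨ s = c₂.length) ∧ t = p.length := by
  constructor
  · intro he
    have hy := h _ (c₂.getVert_mem_support s) (he ▸ p.getVert_mem_support t)
    exact ⟨(h₂.getVert_endpoint_iff hs).1 hy, (hp.getVert_eq_end_iff' ht).1 (he ▸ hy)⟩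
  · rintro ⟨h1, rfl⟩
    rw [(h₂.getVert_endpoint_iff hs).2 h1, p.getVert_length]

theorem cycle_getVert_eq_cycle_iff (h₁ : c₁.IsCycle) (h₂ : c₂.IsCycle) (hp : p.IsPath)
    (h : ∀ z ∈ c₁.support, z ∈ c₂.support → z = x ∧ z = y) {s t : ℕ} (hs : s ≤ c₁.length)
    (ht : t ≤ c₂.length) : c₁.getVert s = c₂.getVert t ↔
      (s = 0 ∨ s = c₁.length) ∧ (t = 0 ∨ t = c₂.length) ∧ p.length = 0 := by
  constructor
  · intro he
    obtain ⟨hx, hy⟩ := h _ (c₁.getVert_mem_support s) (he ▸ c₂.getVert_mem_support t)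
    exact ⟨(h₁.getVert_endpoint_iff hs).1 hx, (h₂.getVert_endpoint_iff ht).1 (he ▸ hy),
      ((hp.getVert_eq_start_iff' le_rfl).1 (p.getVert_length.trans (hy.symm.trans hx)))⟩
  · rintro ⟨h1, h2, h3⟩
    rw [(h₁.getVert_endpoint_iff hs).2 h1, (h₂.getVert_endpoint_iff ht).2 h2,
      SimpleGraph.Walk.eq_of_length_eq_zero h3]

/-- The line graph of a barbell, with any labels that describe which ends of its walks
coincide. -/
theorem exists_lineGraph_iso_barbell (h₁ : c₁.IsCycle) (hp : p.IsPath) (h₂ : c₂.IsCycle)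
    (h1p : ∀ z ∈ c₁.support, z ∈ p.support → z = x)
    (h2p : ∀ z ∈ c₂.support, z ∈ p.support → z = y)
    (h12 : ∀ z ∈ c₁.support, z ∈ c₂.support → z = x ∧ z = y)
    (hE : ∀ e ∈ B.edgeSet, e ∈ c₁.edges ∨ e ∈ p.edges ∨ e ∈ c₂.edges)
    (lab : Fin 3 → Bool → Bool)
    (hlab : (p.length = 0 ∧ lab = shortLab) ∨ (p.length ≠ 0 ∧ lab = barbellLab)) :
    Nonempty (B.lineGraph ≃g pathSystem ![c₁.length, p.length, c₂.length] lab) := by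
  have l₁ := h₁.three_le_length
  have l₂ := h₂.three_le_length
  have k11 := @SimpleGraph.Walk.IsCycle.getVert_eq_iff _ _ _ _ h₁
  have k22 := @SimpleGraph.Walk.IsCycle.getVert_eq_iff _ _ _ _ h₂
  have kpp := @SimpleGraph.Walk.IsPath.getVert_eq_iff _ _ _ _ _ hp
  have k1p := @cycle_getVert_eq_start_iff _ _ _ _ _ _ h₁ hp h1p
  have k2p := @cycle_getVert_eq_end_iff _ _ _ _ _ _ h₂ hp h2p
  have k12 := @cycle_getVert_eq_cycle_iff _ _ _ _ _ _ _ h₁ h₂ hp h12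
  have kp1 := fun s t hs ht => eq_comm.trans (@k1p s t hs ht)
  have kp2 := fun s t hs ht => eq_comm.trans (@k2p s t hs ht)
  have k21 := fun s t hs ht => eq_comm.trans (@k12 s t hs ht)
  have forall3 : ∀ {Q : Fin 3 → Prop}, Q 0 → Q 1 → Q 2 → ∀ i, Q i := by
    intro Q q0 q1 q2 i
    rcases fin_three_eq i with rfl | rfl | rfl <;> assumption
  refine lineGraph_iso_pathSystem _ lab ![c₁.getVert, p.getVert, c₂.getVert]
    (forall3 (fun s hs => c₁.adj_getVert_succ hs) (fun s hs => p.adj_getVert_succ hs)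
      (fun s hs => c₂.adj_getVert_succ hs)) ?_ ?_ ?_
  · intro e he
    rcases hE e he with h | h | h
    · exact ⟨0, SimpleGraph.Walk.exists_getVert_of_mem_edges h⟩
    · exact ⟨1, SimpleGraph.Walk.exists_getVert_of_mem_edges h⟩
    · exact ⟨2, SimpleGraph.Walk.exists_getVert_of_mem_edges h⟩
  · refine forall3 (fun s hs => forall3 (fun t ht h => ?_) (fun t ht h => ?_) fun t ht h => ?_)
      (fun s hs => forall3 (fun t ht h => ?_) (fun t ht h => ?_) fun t ht h => ?_)
      (fun s hs => forall3 (fun t ht h => ?_) (fun t ht h => ?_) fun t ht h => ?_) <;>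
    dsimp only [Matrix.cons_val] at hs ht h <;> rw [Sym2.eq_iff] at h
    · rw [k11 hs.le ht.le, k11 hs ht, k11 hs.le ht, k11 hs ht.le] at h
      exact ⟨rfl, by omega⟩
    · rw [k1p hs.le ht.le, k1p hs ht, k1p hs.le ht, k1p hs ht.le] at h
      omega
    · rw [k12 hs.le ht.le, k12 hs ht, k12 hs.le ht, k12 hs ht.le] at h
      omega
    · rw [kp1 _ _ ht.le hs.le, kp1 _ _ ht hs, kp1 _ _ ht hs.le, kp1 _ _ ht.le hs] at h
      omega
    · rw [kpp hs.le ht.le, kpp hs ht, kpp hs.le ht, kpp hs ht.le] at h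
      exact ⟨rfl, by omega⟩
    · rw [kp2 _ _ ht.le hs.le, kp2 _ _ ht hs, kp2 _ _ ht hs.le, kp2 _ _ ht.le hs] at h
      omega
    · rw [k21 _ _ ht.le hs.le, k21 _ _ ht hs, k21 _ _ ht hs.le, k21 _ _ ht.le hs] at h
      omega
    · rw [k2p hs.le ht.le, k2p hs ht, k2p hs.le ht, k2p hs ht.le] at h
      omega
    · rw [k22 hs.le ht.le, k22 hs ht, k22 hs.le ht, k22 hs ht.le] at h
      exact ⟨rfl, by omega⟩
  · refine forall3 (fun s hs => forall3 (fun t ht => ?_) (fun t ht => ?_) fun t ht => ?_)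
      (fun s hs => forall3 (fun t ht => ?_) (fun t ht => ?_) fun t ht => ?_)
      (fun s hs => forall3 (fun t ht => ?_) (fun t ht => ?_) fun t ht => ?_) <;>
    dsimp only [Matrix.cons_val] at hs ht ⊢ <;>
    (first
    | rw [k11 hs ht] | rw [k1p hs ht] | rw [k12 hs ht] | rw [kp1 _ _ ht hs] | rw [kpp hs ht]
    | rw [kp2 _ _ ht hs] | rw [k21 _ _ ht hs] | rw [k2p hs ht] | rw [k22 hs ht]) <;>
    rcases hlab with ⟨hl, rfl⟩ | ⟨hl, rfl⟩ <;>
    simp [Bool.exists_bool, AtEnd, shortLab, barbellLab_zero, barbellLab_one, barbellLab_two] <;>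
    grind

end BarbellWalks

section Barbell

universe v₁ v₂ v₃

theorem degreeSwappable_of_barbell {V : Type v₁} {W : Type v₂} {B : SimpleGraph V}
    {H : SimpleGraph W} (hB : IsBarbell B) (hbip : B.IsBipartite) (hH : IsLineGraphOf H B) :
    DegreeSwappable.{v₂, v₃} H := by
  obtain ⟨x, y, c₁, p, c₂, h₁, hp, h₂, h1p, h2p, h12, -, hE⟩ := hB
  obtain ⟨e⟩ := hH
  have l₁ := h₁.three_le_length
  have l₂ := h₂.three_le_length
  by_cases h0 : p.length = 0
  · obtain ⟨e'⟩ := exists_lineGraph_iso_barbell h₁ hp h₂ h1p h2p h12 hE _ (Or.inl ⟨h0, rfl⟩)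
    refine degreeSwappable_of_iso (e.trans e') fun C L hL => ?_
    refine short_swappable ?_ h0 ?_ hL
    · rintro (_ | _)
      · exact l₁
      · exact l₂
    · rintro (_ | _)
      · exact closed_walk_even_length hbip c₁
      · exact closed_walk_even_length hbip c₂
  · obtain ⟨e'⟩ := exists_lineGraph_iso_barbell h₁ hp h₂ h1p h2p h12 hE _ (Or.inr ⟨h0, rfl⟩)
    exact degreeSwappable_of_iso (e.trans e') fun C L hL =>
      barbell_swappable l₁ (Nat.pos_of_ne_zero h0) l₂ hL

end Barbell

/-! ### Path systems from prisms. -/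

section PrismWalks

variable {W : Type*} {H : SimpleGraph W} {v w : Fin 3 → W} {P : ∀ i, H.Walk (v i) (w i)}

/-- Here the vertices of the walks are the vertices of the model, so the number of vertices is the
length plus one. -/
theorem exists_iso_prism (hP : ∀ i, (P i).IsPath)
    (hdisj : ∀ i j, i ≠ j → ∀ z ∈ (P i).support, z ∉ (P j).support)
    (hadj : ∀ i j, i ≠ j → H.Adj (v i) (v j) ∧ H.Adj (w i) (w j))
    (hV : ∀ z : W, ∃ i, z ∈ (P i).support)
    (hE : ∀ e ∈ H.edgeSet, (∃ i, e ∈ (P i).edges) ∨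
      ∃ i j, i ≠ j ∧ (e = s(v i, v j) ∨ e = s(w i, w j))) :
    Nonempty (H ≃g pathSystem (fun i => (P i).length + 1) thetaLab) := by
  let F : (Σ i, Fin ((P i).length + 1)) → W := fun p => (P p.1).getVert p.2
  have hcoin : ∀ i, ∀ s ≤ (P i).length, ∀ j, ∀ t ≤ (P j).length,
      (P i).getVert s = (P j).getVert t → i = j ∧ s = t := by
    intro i s hs j t ht h
    by_cases hij : i = j
    · subst hij
      exact ⟨rfl, ((hP i).getVert_eq_iff hs ht).1 h⟩
    · exact absurd (h ▸ (P j).getVert_mem_support t) (hdisj i j hij _ ((P i).getVert_mem_support s))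
  have hF : Function.Bijective F := by
    constructor
    · intro p q h
      rw [sigma_fin_eq_iff]
      exact hcoin _ _ (Nat.le_of_lt_succ p.2.2) _ _ (Nat.le_of_lt_succ q.2.2) h
    · intro z
      obtain ⟨i, hi⟩ := hV z
      obtain ⟨s, hs, hs'⟩ := SimpleGraph.Walk.mem_support_iff_exists_getVert.1 hi
      exact ⟨⟨i, ⟨s, Nat.lt_succ_of_le hs'⟩⟩, hs⟩
  have hv : ∀ i, ∀ s ≤ (P i).length, ∀ j, (P i).getVert s = v j → i = j ∧ s = 0 :=
    fun i s hs j h => hcoin i s hs j 0 (Nat.zero_le _) (h.trans (P j).getVert_zero.symm)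
  have hw : ∀ i, ∀ s ≤ (P i).length, ∀ j, (P i).getVert s = w j → i = j ∧ s = (P j).length :=
    fun i s hs j h => hcoin i s hs j _ le_rfl (h.trans (P j).getVert_length.symm)
  refine ⟨(RelIso.mk (Equiv.ofBijective F hF) ?_ :
    pathSystem (fun i => (P i).length + 1) thetaLab ≃g H).symm⟩
  rintro ⟨i, s, hs⟩ ⟨j, t, ht⟩
  rw [theta_adj]
  have hs' := Nat.le_of_lt_succ hs
  have ht' := Nat.le_of_lt_succ ht
  change H.Adj ((P i).getVert s) ((P j).getVert t) ↔ _
  dsimp only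
  constructor
  · intro h
    rcases hE s((P i).getVert s, (P j).getVert t) h with ⟨k, hk⟩ | ⟨k, l, hkl, hk | hk⟩
    · obtain ⟨r, hr, he⟩ := SimpleGraph.Walk.exists_getVert_of_mem_edges hk
      rw [Sym2.eq_iff] at he
      rcases he with ⟨h1, h2⟩ | ⟨h1, h2⟩
      · have k1 := hcoin i s hs' k r hr.le h1
        have k2 := hcoin j t ht' k (r + 1) hr h2
        exact Or.inl ⟨k1.1.trans k2.1.symm, by omega⟩
      · have k1 := hcoin i s hs' k (r + 1) hr h1
        have k2 := hcoin j t ht' k r hr.le h2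
        exact Or.inl ⟨k1.1.trans k2.1.symm, by omega⟩
    · rw [Sym2.eq_iff] at hk
      rcases hk with ⟨h1, h2⟩ | ⟨h1, h2⟩
      · obtain ⟨rfl, h3⟩ := hv i s hs' _ h1
        obtain ⟨rfl, h4⟩ := hv j t ht' _ h2
        exact Or.inr ⟨hkl, Or.inl ⟨h3, h4⟩⟩
      · obtain ⟨rfl, h3⟩ := hv i s hs' _ h1
        obtain ⟨rfl, h4⟩ := hv j t ht' _ h2
        exact Or.inr ⟨hkl.symm, Or.inl ⟨h3, h4⟩⟩
    · rw [Sym2.eq_iff] at hk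
      rcases hk with ⟨h1, h2⟩ | ⟨h1, h2⟩
      · obtain ⟨rfl, h3⟩ := hw i s hs' _ h1
        obtain ⟨rfl, h4⟩ := hw j t ht' _ h2
        exact Or.inr ⟨hkl, Or.inr ⟨by omega, by omega⟩⟩
      · obtain ⟨rfl, h3⟩ := hw i s hs' _ h1
        obtain ⟨rfl, h4⟩ := hw j t ht' _ h2
        exact Or.inr ⟨hkl.symm, Or.inr ⟨by omega, by omega⟩⟩
  · rintro (⟨rfl, rfl | rfl⟩ | ⟨hij, ⟨rfl, rfl⟩ | ⟨h1, h2⟩⟩)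
    · exact (P i).adj_getVert_succ (by omega)
    · exact ((P i).adj_getVert_succ (by omega)).symm
    · simpa using (hadj i j hij).1
    · obtain rfl : s = (P i).length := by omega
      obtain rfl : t = (P j).length := by omega
      simpa using (hadj i j hij).2

theorem exists_iso_boxProd_of_two {n : Fin 3 → ℕ} (h2 : ∀ i, n i = 2) :
    Nonempty (pathSystem n thetaLab ≃g
      SimpleGraph.boxProd (⊤ : SimpleGraph (Fin 3)) (⊤ : SimpleGraph (Fin 2))) := by
  obtain rfl : n = fun _ => 2 := funext h2
  refine ⟨⟨Equiv.sigmaEquivProd (Fin 3) (Fin 2), ?_⟩⟩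
  rintro ⟨i, s⟩ ⟨j, t⟩
  rw [theta_adj]
  simp only [Equiv.sigmaEquivProd_apply, SimpleGraph.boxProd_adj, SimpleGraph.top_adj]
  revert i j s t
  decide

end PrismWalks

section Prism

universe v₂ v₃

theorem degreeSwappable_of_prism {W : Type v₂} {H : SimpleGraph W} (hH : IsPrism H)
    (h32 : IsEmpty (H ≃g
      SimpleGraph.boxProd (⊤ : SimpleGraph (Fin 3)) (⊤ : SimpleGraph (Fin 2)))) :
    DegreeSwappable.{v₂, v₃} H := by
  obtain ⟨v, w, P, hP, hpos, hdisj, hadj, hV, hE⟩ := hH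
  obtain ⟨e⟩ := exists_iso_prism hP hdisj hadj hV hE
  refine degreeSwappable_of_iso e fun C L hL => ?_
  obtain ⟨k, hk⟩ : ∃ k, (P k).length + 1 ≠ 2 := by
    by_contra h
    push Not at h
    obtain ⟨e'⟩ := exists_iso_boxProd_of_two h
    exact h32.false (e.trans e')
  have := hpos k
  exact theta_swappable (fun i => by have := hpos i; omega) hL (k := k) (by omega)

end Prism

section CubeLine

universe v₂ v₃

theorem degreeSwappable_of_lineGraph_completeBipartite {W : Type v₂} {H : SimpleGraph W}
    (hH : IsLineGraphOf H (completeBipartiteGraph (Fin 2) (Fin 4))) :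
    DegreeSwappable.{v₂, v₃} H := by
  obtain ⟨e⟩ := hH
  obtain ⟨e'⟩ := isLineGraphOf_cubeGraph
  exact degreeSwappable_of_iso (e.trans e'.symm) fun C L hL => cubeGraph_swappable hL

end CubeLine
theorem lemma3 :
    -- line graphs of bipartite barbells (possibly short)
    (∀ {V : Type u₁} {W : Type u₂} (B : SimpleGraph V) (H : SimpleGraph W),
      IsBarbell B → B.IsBipartite → IsLineGraphOf H B → DegreeSwappable.{u₂, u₃} H) ∧
    -- line graphs of bipartite theta-graphs other than `K_{2,3}`
    (∀ {V : Type u₁} {W : Type u₂} (T : SimpleGraph V) (H : SimpleGraph W),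
      IsThetaGraph T → T.IsBipartite →
      IsEmpty (T ≃g completeBipartiteGraph (Fin 2) (Fin 3)) →
      IsLineGraphOf H T → DegreeSwappable.{u₂, u₃} H) ∧
    -- the line graph of `K_{2,4}`, which is the Cartesian product of `K_4` and `K_2`
    (∀ {W : Type u₂} (H : SimpleGraph W),
      IsLineGraphOf H (completeBipartiteGraph (Fin 2) (Fin 4)) → DegreeSwappable.{u₂, u₃} H) ∧
    IsLineGraphOf (SimpleGraph.boxProd (⊤ : SimpleGraph (Fin 4)) (⊤ : SimpleGraph (Fin 2)))
      (completeBipartiteGraph (Fin 2) (Fin 4)) ∧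
    -- prisms other than the Cartesian product of `K_3` and `K_2`
    (∀ {W : Type u₂} (H : SimpleGraph W),
      IsPrism H →
      IsEmpty (H ≃g SimpleGraph.boxProd (⊤ : SimpleGraph (Fin 3)) (⊤ : SimpleGraph (Fin 2))) →
      DegreeSwappable.{u₂, u₃} H) := by
  exact ⟨fun _ _ => degreeSwappable_of_barbell, fun _ _ => degreeSwappable_of_theta,
    fun _ => degreeSwappable_of_lineGraph_completeBipartite, isLineGraphOf_cubeGraph,
    fun _ => degreeSwappable_of_prism⟩
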